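/- Let $E$ and $\mathcal U$ be compact metric spaces, $E_0\subseteq E$ open, and $\Xi\subseteq (E\setminus E_0)\times\mathcal U$ closed, such that for every $x\in E\setminus E_0$ there is $u\in\mathcal U$ with $(x,u)\in\Xi$. Let $A\subseteq C(E)\times C(E)$ and $B\subseteq C(E)\times C(\Xi)$ be operators (given by their graphs) with $(1,0)\in A$ and $(1,0)\in B$, and suppose that $\mathcal D:=\mathcal D(A)\cap\mathcal D(B)$ is dense in $C(E)$. A solution of the controlled martingale problem for $(A,E_0,B,\Xi)$ is a triple $(Y,\lambda_0,\Lambda_1)$ on some probability space, where $Y$ is a process with paths in $D_E[0,\infty)$, $\lambda_0$ is a nonnegative, nondecreasing, right continuous process, and $\Lambda_1$ is a random Borel measure on $[0,\infty)\times\mathcal U$ that is finite on each $[0,t]\times\mathcal U$, such that, almost surely, for all $t\ge 0$, $$\lambda_0(t)=\int_{[0,t]}\mathbf 1_{\overline{E_0}}(Y(s))\,d\lambda_0(s),\qquad \lambda_1(t):=\Lambda_1([0,t]\times\mathcal U)=\int_{[0,t]\times\mathcal U}\mathbf 1_{\Xi}(Y(s),u)\,\Lambda_1(ds\times du),\qquad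 \lambda_0(t)+\lambda_1(t)=t,$$ and, for every $f\in\mathcal D$, $$f(Y(t))-f(Y(0))-\int_0^tAf(Y(s))\,d\lambda_0(s)-\int_{[0,t]\times\mathcal U}Bf(Y(s),u)\,\Lambda_1(ds\times du)$$ is a martingale with respect to $\mathcal F_t:=\sigma\big(Y(s),\lambda_0(s),\Lambda_1([0,s]\times\cdot):s\le t\big)$ (for multivalued $A$, $B$: for every choice of $Af$ and $Bf$). Put $\lambda_0^{-1}(t):=\inf\{s\ge 0:\lambda_0(s)>t\}$ with $\inf\emptyset=\infty$ and $\lambda_0^{-1}(\infty)=\infty$, and $X(t):=Y(\lambda_0^{-1}(t))$, where $Y(\infty):=\lim_{t\to\infty}Y(t)$ when this limit exists (otherwise an arbitrary point of $E$). Let $\mathcal F_{\lambda_0^{-1}(t)}$ be the $\sigma$-algebra of the $\{\mathcal F_{s+}\}$-stopping time $\lambda_0^{-1}(t)$. Suppose that for every probability measure $\nu$ on $E$ there is a solution of the controlled martingale problem with $Y(0)\sim\nu$, and that every solution satisfies, almost surely, $\lambda_0(t)>0$ for all $t>0$. Then for every solution $\lambda_0$ is almost surely strictly increasing, and for every open set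 $U\subseteq E$ the following condition holds: (i) for every probability measure $\nu$ on $E$ there is a solution with $Y(0)\sim\nu$; and, for every solution $(Y,\lambda_0,\Lambda_1)$, (ii) $\lim_{t\to\infty}\lambda_0(t)=\infty$ almost surely; (iii) there are $\{\mathcal F_{\lambda_0^{-1}(t)}\}_{t\ge 0}$-stopping times $\gamma_n$ with $\gamma_n\to\infty$ almost surely and $\mathbb E[\lambda_0^{-1}(\gamma_n)]<\infty$ for each $n$; (iv) with $\tau:=\inf\{t\ge 0: X(t)\notin U\text{ or }X(t-)\notin U\}$ and $\theta:=\inf\{t\ge 0: Y(t)\notin U\text{ or }Y(t-)\notin U\}$ (where $X(0-):=X(0)$ and $Y(0-):=Y(0)$), $\lambda_0^{-1}(\tau)=\theta$ almost surely. -/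

import Mathlib

open MeasureTheory Filter Topology
open scoped NNReal ENNReal

universe u v

noncomputable section

/-- The data `(A, E₀, B, Ξ)` of a controlled martingale problem on the state space `E` with control
space `𝒰`. The operators `A ⊆ C(E) × C(E)` and `B ⊆ C(E) × C(Ξ)` are given by their graphs. -/
structure ControlledData (E : Type u) (𝒰 : Type v) [MetricSpace E] [MetricSpace 𝒰] where
  E₀ : Set E
  isOpen_E₀ : IsOpen E₀
  Ξ : Set (E × 𝒰)
  isClosed_Ξ : IsClosed Ξ
  Ξ_subset : ∀ p ∈ Ξ, p.1 ∉ E₀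
  exists_control : ∀ x, x ∉ E₀ → ∃ c, (x, c) ∈ Ξ
  A : Set (C(E, ℝ) × C(E, ℝ))
  one_mem_A : (1, 0) ∈ A
  B : Set (C(E, ℝ) × C(Ξ, ℝ))
  one_mem_B : (1, 0) ∈ B
  dense_domain : Dense {f : C(E, ℝ) | (∃ g, (f, g) ∈ A) ∧ ∃ h, (f, h) ∈ B}

/-- Right continuous with left limits, on `[0, ∞)`. -/
def IsCadlag {E : Type u} [TopologicalSpace E] (y : ℝ≥0 → E) : Prop :=
  (∀ t, ContinuousWithinAt y (Set.Ici t) t) ∧ ∀ t, 0 < t → ∃ z, Tendsto y (𝓝[<] t) (𝓝 z)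

/-- A nondecreasing right continuous path `l ≥ 0` on `[0, ∞)`, as a Stieltjes function. -/
def pathStieltjes (l : ℝ≥0 → ℝ≥0) (hm : Monotone l)
    (hc : ∀ t, ContinuousWithinAt l (Set.Ici t) t) : StieltjesFunction ℝ≥0 where
  toFun t := (l t : ℝ)
  mono' _ _ h := NNReal.coe_le_coe.2 (hm h)
  right_continuous' t := NNReal.continuous_coe.continuousAt.comp_continuousWithinAt (hc t)

/-- The measure `dl` on `[0, ∞)`, normalised by `dl [0, t] = l t`
(Mathlib's Stieltjes measures never charge the least element, so the mass at `0` is added). -/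
def pathMeasure (l : ℝ≥0 → ℝ≥0) (hm : Monotone l)
    (hc : ∀ t, ContinuousWithinAt l (Set.Ici t) t) : Measure ℝ≥0 :=
  (pathStieltjes l hm hc).measure + (l 0 : ℝ≥0∞) • Measure.dirac 0

theorem pathMeasure_Iic (l : ℝ≥0 → ℝ≥0) (hm : Monotone l)
    (hc : ∀ t, ContinuousWithinAt l (Set.Ici t) t) (t : ℝ≥0) :
    pathMeasure l hm hc (Set.Iic t) = l t := by
  have h0 : (⊥ : ℝ≥0) = 0 := rfl
  have hI : Set.Iic t = Set.Icc 0 t := by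
    rw [← h0, Set.Icc_bot]
  have hleft : Function.leftLim (pathStieltjes l hm hc) 0 = pathStieltjes l hm hc 0 := by
    apply leftLim_eq_of_eq_bot
    have : Set.Iio (0 : ℝ≥0) = ∅ := by
      ext x
      simp
    rw [this, nhdsWithin_empty]
  have h01 : (l 0 : ℝ≥0) ≤ l t := hm (zero_le)
  rw [pathMeasure, Measure.add_apply, hI, StieltjesFunction.measure_Icc, hleft]
  simp only [pathStieltjes, Measure.smul_apply, smul_eq_mul]
  rw [Measure.dirac_apply_of_mem (by simp), mul_one, ← NNReal.coe_sub h01,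
    ENNReal.ofReal_coe_nnreal, ← ENNReal.coe_add, tsub_add_cancel_of_le h01]

/-- For a measure `L` on `[0, ∞) × 𝒰`, the measure `L(t) = L([0, t] × ·)` on `𝒰`. -/
def upTo {𝒰 : Type v} [MeasurableSpace 𝒰] (L : Measure (ℝ≥0 × 𝒰)) (t : ℝ≥0) : Measure 𝒰 :=
  (L.restrict (Set.Iic t ×ˢ Set.univ)).map Prod.snd

/-- A triple of processes `(Y, λ₀, Λ₁)` on `Ω`: `Y` has paths in `D_E[0, ∞)`, `λ₀` is nonnegative,
nondecreasing and right continuous, and `Λ₁` is a random measure on `[0, ∞) × 𝒰` that is finite on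
each `[0, t] × 𝒰`. The σ-algebra on the space of such measures is generated by the evaluations. -/
structure ProcessTriple (Ω : Type*) [MeasurableSpace Ω] (E : Type u) (𝒰 : Type v)
    [MetricSpace E] [MeasurableSpace E] [MeasurableSpace 𝒰] where
  Y : ℝ≥0 → Ω → E
  lam : ℝ≥0 → Ω → ℝ≥0
  Lam : Ω → Measure (ℝ≥0 × 𝒰)
  measurable_Y : ∀ t, Measurable (Y t)
  cadlag_Y : ∀ ω, IsCadlag (fun t => Y t ω)
  measurable_lam : ∀ t, Measurable (lam t)
  mono_lam : ∀ ω, Monotone (fun t => lam t ω)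
  rightCont_lam : ∀ ω t, ContinuousWithinAt (fun s => lam s ω) (Set.Ici t) t
  measurable_Lam : Measurable Lam
  finite_Lam : ∀ ω t, Lam ω (Set.Iic t ×ˢ Set.univ) < ∞

theorem measurable_upTo {𝒰 : Type v} [MeasurableSpace 𝒰] (t : ℝ≥0) :
    Measurable (fun L : Measure (ℝ≥0 × 𝒰) => upTo L t) := by
  refine (Measure.measurable_map _ measurable_snd).comp
    (Measure.measurable_of_measurable_coe _ fun S hS => ?_)
  simp only [Measure.restrict_apply hS]
  exact Measure.measurable_coe (hS.inter (measurableSet_Iic.prod MeasurableSet.univ))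

namespace ProcessTriple

variable {Ω : Type*} [mΩ : MeasurableSpace Ω] {E : Type u} {𝒰 : Type v}
  [MetricSpace E] [MeasurableSpace E] [MeasurableSpace 𝒰]

/-- The natural filtration `σ(Y(s), λ₀(s), Λ₁([0, s] × ·) : s ≤ t)`. -/
def filtration (Z : ProcessTriple Ω E 𝒰) : Filtration ℝ≥0 mΩ where
  seq t := ⨆ s ≤ t, (MeasurableSpace.comap (Z.Y s) inferInstance ⊔
    MeasurableSpace.comap (Z.lam s) inferInstance ⊔
    MeasurableSpace.comap (fun ω => upTo (Z.Lam ω) s) inferInstance)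
  mono' _ _ hij := biSup_mono fun _ hs => hs.trans hij
  le' _ := iSup₂_le fun s _ => sup_le (sup_le (Z.measurable_Y s).comap_le
    (Z.measurable_lam s).comap_le) ((measurable_upTo s).comp Z.measurable_Lam).comap_le

/-- The measure `dλ₀` on `[0, ∞)`. -/
def dlam (Z : ProcessTriple Ω E 𝒰) (ω : Ω) : Measure ℝ≥0 :=
  pathMeasure (fun t => Z.lam t ω) (Z.mono_lam ω) (Z.rightCont_lam ω)

end ProcessTriple

/-- A function on `Ξ`, extended by `0` to `E × 𝒰`. -/
def extendZero {E : Type u} {𝒰 : Type v} {Ξ : Set (E × 𝒰)} (h : Ξ → ℝ) : E × 𝒰 → ℝ :=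
  Function.extend Subtype.val h 0

/-- `(Y, λ₀, Λ₁)` is, under `P`, a solution of the controlled martingale problem for
`(A, E₀, B, Ξ)`. -/
structure IsControlledSolution {E : Type u} {𝒰 : Type v} [MetricSpace E] [MeasurableSpace E]
    [MetricSpace 𝒰] [MeasurableSpace 𝒰] (D : ControlledData E 𝒰) {Ω : Type*} [MeasurableSpace Ω]
    (P : Measure Ω) (Z : ProcessTriple Ω E 𝒰) : Prop where
  /-- `λ₀(t) = ∫_{[0,t]} 1_{closure E₀}(Y(s)) dλ₀(s)`. -/
  support_lam : ∀ᵐ ω ∂P, ∀ t : ℝ≥0, (Z.lam t ω : ℝ≥0∞) =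
    ∫⁻ s in Set.Iic t, (closure D.E₀).indicator 1 (Z.Y s ω) ∂(Z.dlam ω)
  /-- `Λ₁([0,t] × 𝒰) = ∫_{[0,t] × 𝒰} 1_Ξ(Y(s), c) Λ₁(ds × dc)`. -/
  support_Lam : ∀ᵐ ω ∂P, ∀ t : ℝ≥0, Z.Lam ω (Set.Iic t ×ˢ Set.univ) =
    ∫⁻ p in Set.Iic t ×ˢ Set.univ, D.Ξ.indicator 1 (Z.Y p.1 ω, p.2) ∂(Z.Lam ω)
  /-- `λ₀(t) + λ₁(t) = t`. -/
  lam_add : ∀ᵐ ω ∂P, ∀ t : ℝ≥0,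
    (Z.lam t ω : ℝ≥0∞) + Z.Lam ω (Set.Iic t ×ˢ Set.univ) = t
  /-- `f(Y(t)) - f(Y(0)) - ∫_{[0,t]} Af(Y(s)) dλ₀(s) - ∫_{[0,t] × 𝒰} Bf(Y(s), c) Λ₁(ds × dc)` is a
  martingale for every `f ∈ 𝒟(A) ∩ 𝒟(B)`. -/
  martingale : ∀ (f g : C(E, ℝ)) (h : C(D.Ξ, ℝ)), (f, g) ∈ D.A → (f, h) ∈ D.B →
    Martingale (fun t ω => f (Z.Y t ω) - f (Z.Y 0 ω)
      - (∫ s in Set.Iic t, g (Z.Y s ω) ∂(Z.dlam ω))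
      - ∫ p in Set.Iic t ×ˢ Set.univ, extendZero h (Z.Y p.1 ω, p.2) ∂(Z.Lam ω))
      Z.filtration P

/-- The inverse `l⁻¹(t) = inf {s ≥ 0 : l(s) > t}`, with `inf ∅ = ∞`; in particular `l⁻¹(∞) = ∞`. -/
def invTime (l : ℝ≥0 → ℝ≥0) (t : ℝ≥0∞) : ℝ≥0∞ :=
  ⨅ (s : ℝ≥0) (_ : t < (l s : ℝ≥0∞)), (s : ℝ≥0∞)

/-- The value `y(t)` of a path at `t ∈ [0, ∞]`, where `y(∞) = lim_{t → ∞} y(t)`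
(an unspecified point if that limit does not exist). -/
def valueAt {E : Type u} [TopologicalSpace E] (y : ℝ≥0 → E) (t : ℝ≥0∞) : E :=
  haveI : Nonempty E := ⟨y 0⟩
  if t = ∞ then limUnder atTop y else y t.toNNReal

/-- `inf {t ≥ 0 : x(t) ∉ U or x(t-) ∉ U}`, where `x(0-) = x(0)`. -/
def exitTime {E : Type u} [TopologicalSpace E] (U : Set E) (x : ℝ≥0 → E) : ℝ≥0∞ :=
  ⨅ (t : ℝ≥0) (_ : x t ∉ U ∨ Function.leftLim x t ∉ U), (t : ℝ≥0∞)

namespace ProcessTriple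

variable {Ω : Type*} [mΩ : MeasurableSpace Ω] {E : Type u} {𝒰 : Type v}
  [MetricSpace E] [MeasurableSpace E] [MeasurableSpace 𝒰]

/-- `λ₀⁻¹(t)`. -/
def invLam (Z : ProcessTriple Ω E 𝒰) (t : ℝ≥0∞) (ω : Ω) : ℝ≥0∞ :=
  invTime (fun s => Z.lam s ω) t

/-- The time-changed process `X(t) = Y(λ₀⁻¹(t))`. -/
def X (Z : ProcessTriple Ω E 𝒰) (t : ℝ≥0) (ω : Ω) : E :=
  valueAt (fun s => Z.Y s ω) (Z.invLam t ω)

theorem invLam_mono (Z : ProcessTriple Ω E 𝒰) {s t : ℝ≥0∞} (h : s ≤ t) :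
    Z.invLam s ≤ Z.invLam t := fun _ =>
  le_iInf₂ fun r hr => iInf₂_le r (h.trans_lt hr)

theorem invLam_lt_iff (Z : ProcessTriple Ω E 𝒰) (t : ℝ≥0∞) (ω : Ω) (s : ℝ≥0) :
    Z.invLam t ω < s ↔ ∃ q : ℚ, ∃ _ : (q : ℝ).toNNReal < s, t < Z.lam (q : ℝ).toNNReal ω := by
  constructor
  · intro h
    simp only [invLam, invTime, iInf_lt_iff] at h
    obtain ⟨r, hr, hrs⟩ := h
    have hrs' : (r : ℝ) < s := by exact_mod_cast hrs
    obtain ⟨q, hq1, hq2⟩ := exists_rat_btwn hrs'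
    have hq0 : (0 : ℝ) ≤ q := r.2.trans hq1.le
    refine ⟨q, ?_, ?_⟩
    · rw [← NNReal.coe_lt_coe, Real.coe_toNNReal _ hq0]
      exact hq2
    · refine hr.trans_le (ENNReal.coe_le_coe.2 (Z.mono_lam ω ?_))
      rw [← NNReal.coe_le_coe, Real.coe_toNNReal _ hq0]
      exact hq1.le
  · rintro ⟨q, hq, h⟩
    exact lt_of_le_of_lt (iInf₂_le (f := fun (r : ℝ≥0) (_ : t < (Z.lam r ω : ℝ≥0∞)) => (r : ℝ≥0∞)) _ h)
      (ENNReal.coe_lt_coe.2 hq)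

theorem isStoppingTime_invLam (Z : ProcessTriple Ω E 𝒰) (t : ℝ≥0∞) :
    IsStoppingTime Z.filtration.rightCont (Z.invLam t) := by
  refine isStoppingTime_of_measurableSet_lt_of_isRightContinuous fun s => ?_
  refine Z.filtration.le_rightCont s _ ?_
  have : {ω | Z.invLam t ω < (s : ℝ≥0∞)} = ⋃ (q : ℚ) (_ : (q : ℝ).toNNReal < s),
      {ω | t < (Z.lam (q : ℝ).toNNReal ω : ℝ≥0∞)} := by
    ext ω
    simp only [Set.mem_iUnion, Set.mem_ofPred_eq]
    exact Z.invLam_lt_iff t ω s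
  change MeasurableSet[Z.filtration s] {ω | Z.invLam t ω < (s : ℝ≥0∞)}
  rw [this]
  refine MeasurableSet.iUnion fun q => MeasurableSet.iUnion fun hq => ?_
  have hm : Measurable[Z.filtration s] (Z.lam (q : ℝ).toNNReal) := by
    refine Measurable.mono (measurable_iff_comap_le.2 le_rfl) ?_ le_rfl
    exact le_trans (le_sup_right.trans le_sup_left)
      (le_iSup₂_of_le (f := fun r (_ : r ≤ s) => MeasurableSpace.comap (Z.Y r) inferInstance ⊔
        MeasurableSpace.comap (Z.lam r) inferInstance ⊔
        MeasurableSpace.comap (fun ω => upTo (Z.Lam ω) r) inferInstance) _ hq.le le_rfl)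
  exact hm (measurableSet_lt measurable_const measurable_coe_nnreal_ennreal)

/-- The time-changed filtration `ℱ_{λ₀⁻¹(t)}`. In general `λ₀⁻¹(t)` is a stopping time of the right
continuous filtration `ℱ_{t+}`, and its σ-algebra of events is taken with respect to it. -/
def timeChangedFiltration (Z : ProcessTriple Ω E 𝒰) : Filtration ℝ≥0 mΩ where
  seq t := (Z.isStoppingTime_invLam t).measurableSpace
  mono' _ _ hst := IsStoppingTime.measurableSpace_mono _ _
    (Z.invLam_mono (ENNReal.coe_le_coe.2 hst))
  le' t := (Z.isStoppingTime_invLam t).measurableSpace_le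

end ProcessTriple

variable {E : Type u} {𝒰 : Type v} [MetricSpace E] [MeasurableSpace E]
  [MetricSpace 𝒰] [MeasurableSpace 𝒰]

/-- For every initial law there is a solution of the controlled martingale problem. -/
def HasSolutions (D : ControlledData E 𝒰) : Prop :=
  ∀ ν : Measure E, IsProbabilityMeasure ν →
    ∃ (Ω : Type (max u v)) (_ : MeasurableSpace Ω) (P : Measure Ω) (Z : ProcessTriple Ω E 𝒰),
      IsProbabilityMeasure P ∧ IsControlledSolution D P Z ∧ P.map (Z.Y 0) = ν

/-- The property `Q` holds for every solution of the controlled martingale problem, on any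
probability space. -/
def ForEachSolution (D : ControlledData E 𝒰)
    (Q : ∀ {Ω : Type (max u v)} [MeasurableSpace Ω], Measure Ω → ProcessTriple Ω E 𝒰 → Prop) :
    Prop :=
  ∀ (Ω : Type (max u v)) [MeasurableSpace Ω] (P : Measure Ω) [IsProbabilityMeasure P]
    (Z : ProcessTriple Ω E 𝒰), IsControlledSolution D P Z → Q P Z

/-- The condition on `(A, E₀, B, Ξ)` and the open set `U` under which solutions of the controlled
martingale problem can be localized on `U`. -/
structure LocalizationCondition (D : ControlledData E 𝒰) (U : Set E) : Prop where
  hasSolutions : HasSolutions D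
  /-- `λ₀(t) → ∞` almost surely. -/
  tendsto_lam : ForEachSolution D fun P Z =>
    ∀ᵐ ω ∂P, Tendsto (fun t => Z.lam t ω) atTop atTop
  /-- There are `ℱ_{λ₀⁻¹(t)}`-stopping times `γ n → ∞` with `𝔼[λ₀⁻¹(γ n)] < ∞`. -/
  exists_stopping : ForEachSolution D fun {Ω} _ P Z =>
    ∃ γ : ℕ → Ω → ℝ≥0∞, (∀ n, IsStoppingTime Z.timeChangedFiltration (γ n)) ∧
      (∀ᵐ ω ∂P, Tendsto (fun n => γ n ω) atTop (𝓝 ∞)) ∧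
      ∀ n, ∫⁻ ω, Z.invLam (γ n ω) ω ∂P < ∞
  /-- `λ₀⁻¹(τ) = θ` almost surely, `τ` and `θ` being the exit times of `X` and `Y` from `U`. -/
  exit_eq : ForEachSolution D fun P Z =>
    ∀ᵐ ω ∂P, Z.invLam (exitTime U (fun t => Z.X t ω)) ω = exitTime U (fun t => Z.Y t ω)

end

set_option linter.unusedSectionVars false

universe w

/-! Everything rests on one estimate that is uniform over all solutions: there is `ρ < 1` with
`𝔼[exp (-λ₀(1))] ≤ ρ` for every solution (`exists_integral_exp_lam_le`).

Why the estimate suffices. A solution restarted at time `s` is again a solution, even after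
reweighting by a bounded `ℱ s`-measurable density (`isControlledSolution_shift`). Reweighting by the
normalised `exp (-λ₀(n))` and applying the estimate to the process restarted at `n` gives `𝔼[exp
(-λ₀(n))] ≤ ρ ^ n` by induction (`integral_exp_lam_le`). Markov's inequality makes `P(λ₀(n) ≤ a)`
geometrically small, so `λ₀ → ∞` and `𝔼[λ₀⁻¹(a)] < ∞`; the deterministic times `γ n = n` then serve
as stopping times. Restarting at all rational times turns positivity of `λ₀` after `0` into strict
monotonicity. Since `λ₀ + λ₁ = t`, `λ₀` is 1-Lipschitz, hence almost surely an increasing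
homeomorphism of `[0, ∞)`, and such a time change carries exit times to exit times
(`invTime_exitTime`).

Why the estimate holds. If it failed, there would be solutions with `𝔼[exp (-λ₀(1))]` arbitrarily
close to `1`. A limit of them would be a solution with `λ₀(1) = 0` almost surely, against the
positivity assumption. To take the limit, `dλ₀` and `Λ₁` are merged into a single measure on `[0, ∞)
× (Unit ⊕ 𝒰)` with Lebesgue time marginal. No topology on càdlàg paths is used: a solution is
recorded by its values at rational times together with the joint occupation measure of time, state
and control. These data form a compact metrizable space (`RelaxedPath`), so the laws on it form a
compact set. The martingale property, the constraint on state and control, and a mean-square modulus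
of continuity are written as conditions on integrals of continuous functions (`IsRelaxedSolution`),
hence survive weak limits.

A limit law is turned back into a solution as follows. Doob's upcrossing inequality gives one-sided
limits along the rationals, hence a càdlàg path `Y`. The uniform modulus
(`exists_integral_sq_sub_le`) forces the state component of the limiting occupation measure to be
`Y` (`IsRelaxedSolution.ae_apply_eq`). The martingale property then passes from rational to real
times by right continuity. -/

noncomputable section

/-! ### Measurability and uniqueness for random measures on `[0, ∞) × V`. -/

section MeasureTools

open ProbabilityTheory

/-- Cut the base along the integer part of the total mass: on the piece with integer part `n` the
mass is at most `n + 1`, and the kernel is the sum of its pieces. No uniform bound on the masses is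
needed. -/
theorem isSFiniteKernel_of_isFiniteMeasure {α β : Type*} {mα : MeasurableSpace α}
    {mβ : MeasurableSpace β} (κ : Kernel α β) (h : ∀ a, IsFiniteMeasure (κ a)) :
    IsSFiniteKernel κ := by
  classical
  have hm : ∀ n : ℕ, MeasurableSet {a | ⌊(κ a Set.univ).toReal⌋₊ = n} := fun n =>
    (Nat.measurable_floor.comp (κ.measurable_coe MeasurableSet.univ).ennreal_toReal)
      (measurableSet_singleton n)
  let K : ℕ → Kernel α β := fun n => Kernel.piecewise (hm n) κ 0
  have hK : ∀ n, IsFiniteKernel (K n) := fun n => by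
    refine ⟨⟨ENNReal.ofReal (n + 1), ENNReal.ofReal_lt_top, fun a => ?_⟩⟩
    simp only [K, Kernel.piecewise_apply, Set.mem_ofPred_eq]
    split_ifs with ha
    · rw [← ENNReal.ofReal_toReal (measure_ne_top (κ a) Set.univ)]
      refine ENNReal.ofReal_le_ofReal ?_
      rw [← ha]
      exact (Nat.lt_floor_add_one _).le
    · simp
  have : κ = Kernel.sum K := by
    ext a s hs
    rw [Kernel.sum_apply' _ _ hs, tsum_eq_single ⌊(κ a Set.univ).toReal⌋₊]
    · simp [K, Kernel.piecewise_apply]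
    · intro n hn
      simp [K, Kernel.piecewise_apply, hn.symm]
  rw [this]
  infer_instance

theorem isPiSystem_Iic_prod {V : Type*} [MeasurableSpace V] :
    IsPiSystem (Set.image2 (· ×ˢ ·) (Set.range (Set.Iic : ℝ≥0 → Set ℝ≥0))
      {B : Set V | MeasurableSet B}) :=
  isPiSystem_Iic.prod MeasurableSpace.isPiSystem_measurableSet

theorem generateFrom_Iic_prod {V : Type*} [mV : MeasurableSpace V] :
    (inferInstance : MeasurableSpace (ℝ≥0 × V)) = MeasurableSpace.generateFrom
      (Set.image2 (· ×ˢ ·) (Set.range (Set.Iic : ℝ≥0 → Set ℝ≥0)) {B : Set V | MeasurableSet B}) := by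
  refine (generateFrom_eq_prod ?_ MeasurableSpace.generateFrom_measurableSet ?_ ?_).symm
  · rw [← borel_eq_generateFrom_Iic, BorelSpace.measurable_eq (α := ℝ≥0)]
  · refine ⟨fun n : ℕ => Set.Iic (n : ℝ≥0), fun n => ⟨_, rfl⟩, ?_⟩
    refine Set.eq_univ_of_forall fun x => ?_
    obtain ⟨n, hn⟩ := exists_nat_ge x
    exact Set.mem_iUnion.2 ⟨n, hn⟩
  · exact ⟨fun _ => Set.univ, fun _ => MeasurableSet.univ, Set.iUnion_const _⟩

/-- Measures on `[0, ∞) × V` that are finite on each `[0, t] × V` are determined by their values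
on the sets `[0, t] × B`. -/
theorem measure_ext_Iic_prod {V : Type*} [MeasurableSpace V] {μ ν : Measure (ℝ≥0 × V)}
    (hμ : ∀ t : ℝ≥0, μ (Set.Iic t ×ˢ Set.univ) ≠ ∞)
    (h : ∀ (t : ℝ≥0) (B : Set V), MeasurableSet B → μ (Set.Iic t ×ˢ B) = ν (Set.Iic t ×ˢ B)) :
    μ = ν := by
  refine Measure.ext_of_generateFrom_of_iUnion _ (fun n : ℕ => Set.Iic (n : ℝ≥0) ×ˢ Set.univ)
    generateFrom_Iic_prod isPiSystem_Iic_prod ?_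
    (fun n => ⟨_, ⟨_, rfl⟩, _, MeasurableSet.univ, rfl⟩) (fun n => hμ n) ?_
  · refine Set.eq_univ_of_forall fun x => ?_
    obtain ⟨n, hn⟩ := exists_nat_ge x.1
    exact Set.mem_iUnion.2 ⟨n, hn, trivial⟩
  · rintro _ ⟨_, ⟨t, rfl⟩, B, hB, rfl⟩
    exact h t B hB

theorem measure_ext_Iic {μ ν : Measure ℝ≥0} (hμ : ∀ t : ℝ≥0, μ (Set.Iic t) ≠ ∞)
    (h : ∀ t : ℝ≥0, μ (Set.Iic t) = ν (Set.Iic t)) : μ = ν := by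
  refine Measure.ext_of_generateFrom_of_iUnion _ (fun n : ℕ => Set.Iic (n : ℝ≥0))
    (by rw [BorelSpace.measurable_eq (α := ℝ≥0)]; exact borel_eq_generateFrom_Iic ℝ≥0)
    isPiSystem_Iic ?_ (fun n => ⟨_, rfl⟩) (fun n => hμ n) ?_
  · refine Set.eq_univ_of_forall fun x => ?_
    obtain ⟨n, hn⟩ := exists_nat_ge x
    exact Set.mem_iUnion.2 ⟨n, hn⟩
  · rintro _ ⟨t, rfl⟩
    exact h t

/-- Dynkin's argument on the π-system of sets `[0, t] × B`; the total mass is the supremum over `[0,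
n] × V`. Natural filtrations give access to exactly these values. -/
theorem measurable_measure_of_Iic_prod {Ω V : Type*} [MeasurableSpace Ω] [MeasurableSpace V]
    {μ : Ω → Measure (ℝ≥0 × V)} (hf : ∀ ω, IsFiniteMeasure (μ ω))
    (h : ∀ (t : ℝ≥0) (B : Set V), MeasurableSet B → Measurable fun ω => μ ω (Set.Iic t ×ˢ B)) :
    Measurable μ := by
  refine Measurable.measure_of_isPiSystem generateFrom_Iic_prod isPiSystem_Iic_prod ?_ ?_
  · rintro _ ⟨_, ⟨t, rfl⟩, B, hB, rfl⟩
    exact h t B hB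
  · have hU : (Set.univ : Set (ℝ≥0 × V)) = ⋃ n : ℕ, Set.Iic (n : ℝ≥0) ×ˢ Set.univ := by
      refine (Set.eq_univ_of_forall fun x => ?_).symm
      obtain ⟨n, hn⟩ := exists_nat_ge x.1
      exact Set.mem_iUnion.2 ⟨n, hn, trivial⟩
    have hmono : Monotone fun n : ℕ => (Set.Iic (n : ℝ≥0) ×ˢ Set.univ : Set (ℝ≥0 × V)) :=
      fun a b hab => Set.prod_mono (Set.Iic_subset_Iic.2 (by exact_mod_cast hab)) le_rfl
    rw [hU]
    simp_rw [hmono.measure_iUnion]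
    exact Measurable.iSup fun n => h n _ MeasurableSet.univ

/-- A family of finite measures whose integrals of continuous functions are measurable is
measurable. -/
theorem measurable_measure_of_lintegral {Ω X : Type*} [MeasurableSpace Ω] [TopologicalSpace X]
    [HasOuterApproxClosed X] [MeasurableSpace X] [BorelSpace X] {μ : Ω → Measure X}
    (hf : ∀ ω, IsFiniteMeasure (μ ω))
    (h : ∀ g : BoundedContinuousFunction X ℝ≥0, Measurable fun ω => ∫⁻ x, g x ∂(μ ω)) :
    Measurable μ := by
  refine Measurable.measure_of_isPiSystem (S := {s : Set X | IsClosed s})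
    (by rw [BorelSpace.measurable_eq (α := X), borel_eq_generateFrom_isClosed])
    isPiSystem_isClosed (fun F hF => ?_) ?_
  · exact measurable_of_tendsto_metrizable (fun n => h (hF.apprSeq n))
      (tendsto_pi_nhds.2 fun ω =>
        HasOuterApproxClosed.tendsto_lintegral_apprSeq hF (μ ω))
  · simpa using h (BoundedContinuousFunction.const X 1)

end MeasureTools

/-! ### The factorial time grid and joint measurability of right continuous processes. -/

section Progressive

/-- The least point `> t` of the form `k / n!` (for `k ≥ 1`), as a nonnegative rational. -/
noncomputable def gridSucc (n : ℕ) (t : ℝ≥0) : ℚ≥0 :=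
  ((⌊t * (n.factorial : ℝ≥0)⌋₊ + 1 : ℕ) : ℚ≥0) / (n.factorial : ℚ≥0)

theorem lt_gridSucc (n : ℕ) (t : ℝ≥0) : t < (gridSucc n t : ℝ≥0) := by
  have h : (0 : ℝ≥0) < n.factorial := by exact_mod_cast n.factorial_pos
  rw [gridSucc, NNRat.cast_div, NNRat.cast_natCast, NNRat.cast_natCast, lt_div_iff₀ h]
  push_cast
  exact Nat.lt_floor_add_one _

theorem gridSucc_le (n : ℕ) (t : ℝ≥0) : (gridSucc n t : ℝ≥0) ≤ t + 1 / (n.factorial : ℝ≥0) := by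
  have h : (0 : ℝ≥0) < n.factorial := by exact_mod_cast n.factorial_pos
  rw [gridSucc, NNRat.cast_div, NNRat.cast_natCast, NNRat.cast_natCast, div_le_iff₀ h, add_mul,
    one_div, inv_mul_cancel₀ h.ne']
  push_cast
  gcongr
  exact Nat.floor_le (zero_le)

theorem gridSucc_mono (n : ℕ) : Monotone (gridSucc n) := fun s t h => by
  unfold gridSucc
  gcongr

theorem tendsto_one_div_factorial :
    Tendsto (fun n : ℕ => 1 / (n.factorial : ℝ≥0)) atTop (𝓝 0) := by
  have h1 : Tendsto (fun n : ℕ => 1 / (n : ℝ≥0)) atTop (𝓝 0) := by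
    simpa using tendsto_inv_atTop_nhds_zero_nat (𝕜 := ℝ≥0)
  exact h1.comp (tendsto_atTop_mono Nat.self_le_factorial tendsto_id)

theorem tendsto_gridSucc (t : ℝ≥0) :
    Tendsto (fun n => (gridSucc n t : ℝ≥0)) atTop (𝓝[>] t) := by
  refine tendsto_nhdsWithin_iff.2 ⟨?_, Eventually.of_forall fun n => lt_gridSucc n t⟩
  refine tendsto_of_tendsto_of_tendsto_of_le_of_le tendsto_const_nhds ?_
    (fun n => (lt_gridSucc n t).le) fun n => gridSucc_le n t
  simpa using tendsto_const_nhds.add tendsto_one_div_factorial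

/-- Time enters only through a natural number, so joint measurability reduces to countably many
sections. -/
theorem measurable_comp_gridSucc {α β : Type*} [MeasurableSpace α] [MeasurableSpace β]
    {f : ℚ≥0 → α → β} (hf : ∀ q, Measurable (f q)) (n : ℕ) :
    Measurable fun p : ℝ≥0 × α => f (gridSucc n p.1) p.2 := by
  have h : Measurable fun t : ℝ≥0 => ⌊t * (n.factorial : ℝ≥0)⌋₊ :=
    Nat.measurable_floor.comp (measurable_id.mul_const _)
  have h2 : Measurable fun p : ℕ × α => f (((p.1 + 1 : ℕ) : ℚ≥0) / (n.factorial : ℚ≥0)) p.2 :=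
    by
    refine measurable_from_prod_countable_right fun k => ?_
    have := hf (((k + 1 : ℕ) : ℚ≥0) / (n.factorial : ℚ≥0))
    exact this
  exact h2.comp ((h.comp measurable_fst).prodMk measurable_snd)

attribute [irreducible] gridSucc

/-- Right continuous processes are jointly measurable. -/
theorem measurable_uncurry_of_rightCont {Ω E : Type*} {m : MeasurableSpace Ω} [PseudoMetricSpace E]
    [MeasurableSpace E] [BorelSpace E] {Y : ℝ≥0 → Ω → E} (hY : ∀ t, Measurable (Y t))
    (hc : ∀ ω t, ContinuousWithinAt (fun s => Y s ω) (Set.Ici t) t) :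
    Measurable fun p : ℝ≥0 × Ω => Y p.1 p.2 := by
  have h1 : ∀ n, Measurable fun p : ℝ≥0 × Ω => Y (gridSucc n p.1) p.2 :=
    fun n => measurable_comp_gridSucc (f := fun (q : ℚ≥0) => Y q) (fun q => hY q) n
  refine measurable_of_tendsto_metrizable h1 (tendsto_pi_nhds.2 fun p => ?_)
  exact (hc p.2 p.1).tendsto.comp ((tendsto_gridSucc p.1).mono_right
    (nhdsWithin_mono _ Set.Ioi_subset_Ici_self))

theorem measurable_path_of_rightCont {E : Type*} [PseudoMetricSpace E]
    [MeasurableSpace E] [BorelSpace E] {y : ℝ≥0 → E}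
    (hc : ∀ t, ContinuousWithinAt y (Set.Ici t) t) : Measurable y := by
  refine measurable_of_tendsto_metrizable (f := fun n t => y (gridSucc n t))
    (fun n => ?_) (tendsto_pi_nhds.2 fun t => ?_)
  · have h := measurable_comp_gridSucc (α := Unit) (f := fun (q : ℚ≥0) _ => y q)
      (fun q => measurable_const) n
    have h2 : Measurable fun t : ℝ≥0 => ((t, ()) : ℝ≥0 × Unit) :=
      measurable_id.prodMk measurable_const
    exact h.comp h2
  exact (hc t).tendsto.comp ((tendsto_gridSucc t).mono_right
    (nhdsWithin_mono _ Set.Ioi_subset_Ici_self))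

/-- Integrals of an adapted right continuous process against an adapted random measure are
adapted. -/
theorem stronglyMeasurable_integral_Iic {Ω E V : Type*} (m : MeasurableSpace Ω)
    [PseudoMetricSpace E] [MeasurableSpace E] [BorelSpace E] [MeasurableSpace V]
    {Y : ℝ≥0 → Ω → E} {N : Ω → Measure (ℝ≥0 × V)} (t : ℝ≥0)
    (hY : ∀ s ≤ t, Measurable (Y s))
    (hc : ∀ ω s, ContinuousWithinAt (fun s => Y s ω) (Set.Ici s) s)
    (hN : ∀ s ≤ t, ∀ B, MeasurableSet B → Measurable fun ω => N ω (Set.Iic s ×ˢ B))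
    (hf : ∀ ω, N ω (Set.Iic t ×ˢ Set.univ) < ∞)
    {H : E × V → ℝ} (hH : Measurable H) :
    StronglyMeasurable fun ω => ∫ p in Set.Iic t ×ˢ Set.univ, H (Y p.1 ω, p.2) ∂(N ω) := by
  have hfin : ∀ ω, IsFiniteMeasure ((N ω).restrict (Set.Iic t ×ˢ Set.univ)) := fun ω =>
    ⟨by rw [Measure.restrict_apply_univ]; exact hf ω⟩
  have hK : Measurable fun ω => (N ω).restrict (Set.Iic t ×ˢ Set.univ) := by
    refine measurable_measure_of_Iic_prod hfin fun s B hB => ?_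
    have : ∀ ω, (N ω).restrict (Set.Iic t ×ˢ Set.univ) (Set.Iic s ×ˢ B)
        = N ω (Set.Iic (s ⊓ t) ×ˢ B) := fun ω => by
      rw [Measure.restrict_apply (measurableSet_Iic.prod hB), Set.prod_inter_prod,
        Set.Iic_inter_Iic, Set.inter_univ]
    simp_rw [this]
    exact hN _ inf_le_right B hB
  let κ : ProbabilityTheory.Kernel Ω (ℝ≥0 × V) := ⟨_, hK⟩
  have : ProbabilityTheory.IsSFiniteKernel κ := isSFiniteKernel_of_isFiniteMeasure κ hfin
  -- Stopping the process at `t` changes nothing on `[0, t]` and leaves only times at which `Y` is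
  -- `m`-measurable.
  have hYm : Measurable fun p : ℝ≥0 × Ω => Y (p.1 ⊓ t) p.2 := by
    refine measurable_uncurry_of_rightCont (Y := fun s => Y (s ⊓ t)) (fun s => hY _ inf_le_right)
      fun ω s => ?_
    refine ContinuousWithinAt.comp (t := Set.Ici (s ⊓ t)) (f := fun r : ℝ≥0 => r ⊓ t)
      (hc ω (s ⊓ t)) (by fun_prop) fun r hr => ?_
    exact inf_le_inf_right t hr
  have hG : StronglyMeasurable fun q : Ω × (ℝ≥0 × V) => H (Y (q.2.1 ⊓ t) q.1, q.2.2) := by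
    refine Measurable.stronglyMeasurable ?_
    exact hH.comp ((hYm.comp ((measurable_fst.comp measurable_snd).prodMk measurable_fst)).prodMk
      (measurable_snd.comp measurable_snd))
  have := hG.integral_kernel_prod_right' (κ := κ)
  convert this using 2 with ω
  refine setIntegral_congr_fun (measurableSet_Iic.prod MeasurableSet.univ) fun p hp => ?_
  have : p.1 ⊓ t = p.1 := inf_eq_left.2 hp.1
  simp only [this]

end Progressive

/-! ### Testing the martingale property against products of continuous functions. -/

section TestFunctions

/-- To check that the integral of `D` vanishes on the σ-algebra generated by real variables `ζ i`,
it suffices to test `D` against products of bounded continuous functions of the `ζ i`. -/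
theorem setIntegral_eq_zero_of_test {Ω ι : Type*} {mΩ : MeasurableSpace Ω} {P : Measure Ω}
    [IsFiniteMeasure P] {ζ : ι → Ω → ℝ} (hζ : ∀ i, Measurable (ζ i)) (T : Set ι) {D : Ω → ℝ}
    (hD : Integrable D P)
    (h : ∀ J : Finset ι, (J : Set ι) ⊆ T → ∀ c : ι → ℝ → ℝ, (∀ i, Continuous (c i)) →
      (∀ i x, |c i x| ≤ 1) → ∫ ω, D ω * ∏ i ∈ J, c i (ζ i ω) ∂P = 0)
    {A : Set Ω}
    (hA : MeasurableSet[⨆ i ∈ T, MeasurableSpace.comap (ζ i) inferInstance] A) :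
    ∫ ω in A, D ω ∂P = 0 := by
  let π : ι → Set (Set Ω) := fun i => {s | ∃ C : Set ℝ, IsClosed C ∧ ζ i ⁻¹' C = s}
  have hπ : ∀ i, IsPiSystem (π i) := by
    rintro i _ ⟨C, hC, rfl⟩ _ ⟨C', hC', rfl⟩ -
    exact ⟨C ∩ C', hC.inter hC', rfl⟩
  have hle : (⨆ i ∈ T, MeasurableSpace.comap (ζ i) inferInstance)
      ≤ MeasurableSpace.generateFrom (piiUnionInter π T) := by
    refine iSup₂_le fun i hi => ?_
    rw [BorelSpace.measurable_eq (α := ℝ), borel_eq_generateFrom_isClosed,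
      MeasurableSpace.comap_generateFrom]
    refine MeasurableSpace.generateFrom_mono ?_
    rintro _ ⟨C, hC, rfl⟩
    exact subset_piiUnionInter hi ⟨C, hC, rfl⟩
  have hgen : MeasurableSpace.generateFrom (piiUnionInter π T) ≤ mΩ := by
    refine generateFrom_piiUnionInter_le _ (fun i => ?_) _
    refine MeasurableSpace.generateFrom_le ?_
    rintro _ ⟨C, hC, rfl⟩
    exact hζ i hC.measurableSet
  -- The empty product: this is what closes the system of good sets under complements.
  have h0 : ∫ ω, D ω ∂P = 0 := by
    simpa using h ∅ (by simp) (fun _ _ => 0) (fun _ => continuous_const) (by simp)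
  refine MeasurableSpace.induction_on_inter
    (C := fun s _ => ∫ ω in s, D ω ∂P = 0) rfl (isPiSystem_piiUnionInter π hπ T)
    (by simp) ?_ ?_ ?_ A (hle _ hA)
  · rintro _ ⟨J, hJ, f, hf, rfl⟩
    have hf' : ∀ i, ∃ C : Set ℝ, IsClosed C ∧ (i ∈ J → ζ i ⁻¹' C = f i) := fun i => by
      by_cases hi : i ∈ J
      · obtain ⟨C, hC, h⟩ := hf i hi
        exact ⟨C, hC, fun _ => h⟩
      · exact ⟨∅, isClosed_empty, fun h => absurd h hi⟩
    choose C hC hCf using hf'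
    have hm : MeasurableSet (⋂ i ∈ J, f i) := by
      refine Finset.measurableSet_biInter _ fun i hi => ?_
      rw [← hCf i hi]
      exact hζ i (hC i).measurableSet
    -- Indicators of closed sets are limits of continuous functions with values in `[0, 1]`; `|D|`
    -- dominates the resulting integrands.
    let c : ℕ → ι → ℝ → ℝ := fun n i x => ((hC i).apprSeq n x : ℝ)
    have hc1 : ∀ n i x, |c n i x| ≤ 1 := fun n i x => by
      simp only [c, NNReal.abs_eq]
      exact_mod_cast HasOuterApproxClosed.apprSeq_apply_le_one (hC i) n x
    have hcc : ∀ n i, Continuous (c n i) := fun n i =>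
      NNReal.continuous_coe.comp ((hC i).apprSeq n).continuous
    have hlim : Tendsto (fun n => ∫ ω, D ω * ∏ i ∈ J, c n i (ζ i ω) ∂P) atTop
        (𝓝 (∫ ω, (⋂ i ∈ J, f i).indicator D ω ∂P)) := by
      refine tendsto_integral_of_dominated_convergence (fun ω => ‖D ω‖) (fun n => ?_) hD.norm
        (fun n => Eventually.of_forall fun ω => ?_) (Eventually.of_forall fun ω => ?_)
      · refine hD.1.mul (Measurable.aestronglyMeasurable ?_)
        exact Finset.measurable_prod _ fun i _ => (hcc n i).measurable.comp (hζ i)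
      · rw [norm_mul, norm_prod]
        refine mul_le_of_le_one_right (norm_nonneg _) ?_
        exact Finset.prod_le_one (fun _ _ => norm_nonneg _) fun i _ => hc1 n i _
      · have h1 : ∀ i ∈ J, Tendsto (fun n => c n i (ζ i ω)) atTop
            (𝓝 ((f i).indicator (fun _ => (1 : ℝ)) ω)) := fun i hi => by
          have h2 := (tendsto_pi_nhds.1 (HasOuterApproxClosed.tendsto_apprSeq (hC i))) (ζ i ω)
          have h3 := (NNReal.tendsto_coe.2 h2)
          convert h3 using 2
          rw [← hCf i hi]
          by_cases hx : ζ i ω ∈ C i <;> simp [hx]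
        have h2 := (tendsto_finsetProd J h1).const_mul (D ω)
        convert h2 using 2
        by_cases hx : ω ∈ ⋂ i ∈ J, f i
        · rw [Set.indicator_of_mem hx, Finset.prod_eq_one, mul_one]
          intro i hi
          exact Set.indicator_of_mem (Set.mem_iInter₂.1 hx i hi) _
        · rw [Set.indicator_of_notMem hx]
          simp only [Set.mem_iInter, not_forall] at hx
          obtain ⟨i, hi, hx⟩ := hx
          rw [Finset.prod_eq_zero hi (Set.indicator_of_notMem hx _), mul_zero]
    rw [integral_indicator hm] at hlim
    refine tendsto_nhds_unique hlim ?_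
    simp_rw [fun n => h J hJ (c n) (hcc n) (hc1 n)]
    exact tendsto_const_nhds
  · intro t ht hC
    have := integral_add_compl (hgen _ ht) hD
    rw [hC, h0, zero_add] at this
    exact this
  · intro f hd hm hC
    rw [integral_iUnion (fun i => hgen _ (hm i)) hd hD.integrableOn]
    simp [hC]

theorem martingale_of_setIntegral_sub_eq_zero {Ω ι : Type*} [Preorder ι] {mΩ : MeasurableSpace Ω}
    {P : Measure Ω} [IsFiniteMeasure P] {ℱ : Filtration ι mΩ} {M : ι → Ω → ℝ}
    (ha : ∀ t, StronglyMeasurable[ℱ t] (M t)) (hi : ∀ t, Integrable (M t) P)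
    (h : ∀ s t, s ≤ t → ∀ A, MeasurableSet[ℱ s] A → ∫ ω in A, (M t ω - M s ω) ∂P = 0) :
    Martingale M ℱ P := by
  refine ⟨ha, fun s t hst => ?_⟩
  refine (ae_eq_condExp_of_forall_setIntegral_eq (ℱ.le s) (hi t)
    (fun A _ _ => (hi s).integrableOn) (fun A hA _ => ?_)
    (ha s).aestronglyMeasurable).symm
  have := h s t hst A hA
  rw [integral_sub (hi t).integrableOn (hi s).integrableOn] at this
  linarith

/-- Increments of a martingale are orthogonal to bounded functions of the past. -/
theorem integral_sub_mul_eq_zero_of_martingale {Ω : Type*} {mΩ : MeasurableSpace Ω} {P : Measure Ω}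
    [IsFiniteMeasure P] {ℱ : Filtration ℝ≥0 mΩ} {M : ℝ≥0 → Ω → ℝ} (hM : Martingale M ℱ P)
    {s t : ℝ≥0} (hst : s ≤ t) {F : Ω → ℝ} (hF : StronglyMeasurable[ℱ s] F) {C : ℝ}
    (hC : ∀ ω, |F ω| ≤ C) : ∫ ω, (M t ω - M s ω) * F ω ∂P = 0 := by
  have hI : Integrable (fun ω => M t ω - M s ω) P := (hM.integrable t).sub (hM.integrable s)
  have hFm := hF.mono (ℱ.le s)
  have hIF : Integrable (fun ω => (M t ω - M s ω) * F ω) P :=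
    hI.mul_bdd (c := C) hFm.aestronglyMeasurable (Eventually.of_forall fun ω => hC ω)
  have h1 := condExp_mul_of_stronglyMeasurable_right (m := ℱ s) (μ := P)
    (f := fun ω => M t ω - M s ω) hF hIF hI
  have h2 : P[fun ω => M t ω - M s ω | ℱ s] =ᵐ[P] 0 := by
    refine (condExp_sub (hM.integrable t) (hM.integrable s) _).trans ?_
    filter_upwards [hM.2 s t hst, hM.2 s s le_rfl] with ω h1 h2
    simp [h1, h2]
  rw [← integral_condExp (ℱ.le s)]
  refine integral_eq_zero_of_ae (h1.trans ?_)
  filter_upwards [h2] with ω h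
  simp [h]

end TestFunctions

/-! ### Measurability, continuity and Borel structure on disjoint sums. -/

section SumSpaces

theorem measurable_prod_sum {α β γ δ : Type*} [MeasurableSpace α] [MeasurableSpace β]
    [MeasurableSpace γ] [MeasurableSpace δ] {f : α × (β ⊕ γ) → δ}
    (h1 : Measurable fun p : α × β => f (p.1, Sum.inl p.2))
    (h2 : Measurable fun p : α × γ => f (p.1, Sum.inr p.2)) : Measurable f := by
  have h : Measurable (f ∘ (MeasurableEquiv.prodSumDistrib α β γ).symm) :=
    measurable_fun_sum h1 h2
  convert h.comp (MeasurableEquiv.prodSumDistrib α β γ).measurable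
  ext x
  simp

theorem continuous_prod_sum {α β γ δ : Type*} [TopologicalSpace α] [TopologicalSpace β]
    [TopologicalSpace γ] [TopologicalSpace δ] {f : α × (β ⊕ γ) → δ}
    (h1 : Continuous fun p : α × β => f (p.1, Sum.inl p.2))
    (h2 : Continuous fun p : α × γ => f (p.1, Sum.inr p.2)) : Continuous f := by
  have h : Continuous (f ∘ (Homeomorph.prodSumDistrib (X := α) (Y := β) (Z := γ)).symm) := by
    refine continuous_sum_dom.2 ⟨h1, h2⟩
  convert h.comp (Homeomorph.prodSumDistrib (X := α) (Y := β) (Z := γ)).continuous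
  ext x
  simp

/-- Both injections are open embeddings, so they carry the measurable traces of a set on the two
summands to Borel sets. -/
instance instBorelSpaceSum {β γ : Type*} [TopologicalSpace β] [MeasurableSpace β] [BorelSpace β]
    [TopologicalSpace γ] [MeasurableSpace γ] [BorelSpace γ] : BorelSpace (β ⊕ γ) := by
  constructor
  refine le_antisymm (fun s hs => ?_) ?_
  · have h1 : MeasurableSet[borel (β ⊕ γ)] (Sum.inl '' (Sum.inl ⁻¹' s : Set β)) := by
      let _ : MeasurableSpace (β ⊕ γ) := borel _
      have : BorelSpace (β ⊕ γ) := ⟨rfl⟩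
      exact (Topology.IsOpenEmbedding.inl (X := β) (Y := γ)).measurableEmbedding.measurableSet_image.2
        (measurableSet_sum_iff.1 hs).1
    have h2 : MeasurableSet[borel (β ⊕ γ)] (Sum.inr '' (Sum.inr ⁻¹' s : Set γ)) := by
      let _ : MeasurableSpace (β ⊕ γ) := borel _
      have : BorelSpace (β ⊕ γ) := ⟨rfl⟩
      exact (Topology.IsOpenEmbedding.inr (X := β) (Y := γ)).measurableEmbedding.measurableSet_image.2
        (measurableSet_sum_iff.1 hs).2
    have := MeasurableSet.union h1 h2
    rwa [Set.image_preimage_inl_union_image_preimage_inr] at this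
  · refine MeasurableSpace.generateFrom_le fun s hs => ?_
    exact measurableSet_sum_iff.2 ⟨(isOpen_sum_iff.1 hs).1.measurableSet,
      (isOpen_sum_iff.1 hs).2.measurableSet⟩

end SumSpaces


/-! ### Embedding the two kinds of control into `Unit ⊕ 𝒰`. -/

section ControlMeasure

variable {𝒰 : Type v} [MeasurableSpace 𝒰]

/-- The embedding of `[0, ∞)` into `[0, ∞) × (Unit ⊕ 𝒰)`. -/
def inlTime (s : ℝ≥0) : ℝ≥0 × (Unit ⊕ 𝒰) := (s, Sum.inl ())

/-- The embedding of `[0, ∞) × 𝒰` into `[0, ∞) × (Unit ⊕ 𝒰)`. -/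
def inrTime (p : ℝ≥0 × 𝒰) : ℝ≥0 × (Unit ⊕ 𝒰) := (p.1, Sum.inr p.2)

theorem measurable_inlTime : Measurable (inlTime (𝒰 := 𝒰)) :=
  measurable_id.prodMk measurable_const

theorem measurable_inrTime : Measurable (inrTime (𝒰 := 𝒰)) :=
  measurable_fst.prodMk (measurable_inr.comp measurable_snd)

theorem inrTime_injective : Function.Injective (inrTime (𝒰 := 𝒰)) := fun _ _ h =>
  Prod.ext (Prod.ext_iff.1 h).1 (Sum.inr_injective (Prod.ext_iff.1 h).2)

theorem inrTime_image_prod (S : Set ℝ≥0) (B : Set 𝒰) :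
    inrTime '' (S ×ˢ B) = S ×ˢ (Sum.inr '' B) := by
  ext ⟨s, w⟩
  simp only [inrTime, Set.mem_image, Set.mem_prod, Prod.exists, Prod.mk.injEq]
  constructor
  · rintro ⟨a, b, ⟨h1, h2⟩, rfl, rfl⟩
    exact ⟨h1, b, h2, rfl⟩
  · rintro ⟨h1, b, h2, rfl⟩
    exact ⟨s, b, ⟨h1, h2⟩, rfl, rfl⟩

theorem inlTime_image (S : Set ℝ≥0) :
    inlTime (𝒰 := 𝒰) '' S = S ×ˢ {Sum.inl ()} := by
  ext ⟨s, w⟩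
  simp only [inlTime, Set.mem_image, Set.mem_prod, Prod.mk.injEq, Set.mem_singleton_iff]
  constructor
  · rintro ⟨a, h1, rfl, rfl⟩
    exact ⟨h1, rfl⟩
  · rintro ⟨h1, rfl⟩
    exact ⟨s, h1, rfl, rfl⟩

theorem measurableEmbedding_inrTime : MeasurableEmbedding (inrTime (𝒰 := 𝒰)) where
  injective := inrTime_injective
  measurable := measurable_inrTime
  measurableSet_image' {s} hs := by
    have h : inrTime '' s = (MeasurableEquiv.prodSumDistrib ℝ≥0 Unit 𝒰).symm ''
        (Sum.inr '' s) := by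
      rw [Set.image_image]
      rfl
    rw [h, MeasurableEquiv.measurableSet_image]
    exact measurableSet_inr_image.2 hs

end ControlMeasure

/-! ### The combined control measure of a triple, and triples built from a control measure. -/

namespace ProcessTriple

variable {Ω : Type*} [mΩ : MeasurableSpace Ω] {E : Type u} {𝒰 : Type v}
  [MetricSpace E] [MeasurableSpace E] [MeasurableSpace 𝒰]

/-- The control measure: `dλ₀` and `Λ₁`, combined into one measure on `[0, ∞) × (Unit ⊕ 𝒰)`. -/
def ctl (Z : ProcessTriple Ω E 𝒰) (ω : Ω) : Measure (ℝ≥0 × (Unit ⊕ 𝒰)) :=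
  (Z.dlam ω).map inlTime + (Z.Lam ω).map inrTime

theorem dlam_Iic (Z : ProcessTriple Ω E 𝒰) (ω : Ω) (t : ℝ≥0) :
    Z.dlam ω (Set.Iic t) = Z.lam t ω :=
  pathMeasure_Iic _ _ _ t

theorem upTo_apply (L : Measure (ℝ≥0 × 𝒰)) (t : ℝ≥0) {B : Set 𝒰} (hB : MeasurableSet B) :
    upTo L t B = L (Set.Iic t ×ˢ B) := by
  rw [upTo, Measure.map_apply measurable_snd hB, Measure.restrict_apply (measurable_snd hB)]
  congr 1
  ext p
  simp [and_comm]

theorem ctl_Iic_prod (Z : ProcessTriple Ω E 𝒰) (ω : Ω) (t : ℝ≥0) {B : Set (Unit ⊕ 𝒰)}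
    (hB : MeasurableSet B) : Z.ctl ω (Set.Iic t ×ˢ B) =
      Z.lam t ω * B.indicator 1 (Sum.inl ()) + upTo (Z.Lam ω) t (Sum.inr ⁻¹' B) := by
  have hm : MeasurableSet (Set.Iic t ×ˢ B) := measurableSet_Iic.prod hB
  rw [ctl, Measure.add_apply, Measure.map_apply measurable_inlTime hm,
    Measure.map_apply measurable_inrTime hm, upTo_apply _ _ (measurable_inr hB)]
  congr 1
  by_cases h : Sum.inl () ∈ B
  · have : inlTime ⁻¹' (Set.Iic t ×ˢ B) = Set.Iic t := by ext; simp [inlTime, h]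
    rw [this, dlam_Iic]
    simp [h]
  · have : inlTime ⁻¹' (Set.Iic t ×ˢ B) = ∅ := by ext; simp [inlTime, h]
    rw [this]
    simp [h]

theorem ctl_Iic_univ (Z : ProcessTriple Ω E 𝒰) (ω : Ω) (t : ℝ≥0) :
    Z.ctl ω (Set.Iic t ×ˢ Set.univ) = Z.lam t ω + Z.Lam ω (Set.Iic t ×ˢ Set.univ) := by
  rw [ctl_Iic_prod _ _ _ MeasurableSet.univ, Set.preimage_univ, upTo_apply _ _ MeasurableSet.univ]
  simp

theorem ctl_Iic_lt_top (Z : ProcessTriple Ω E 𝒰) (ω : Ω) (t : ℝ≥0) :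
    Z.ctl ω (Set.Iic t ×ˢ Set.univ) < ∞ := by
  rw [ctl_Iic_univ]
  exact ENNReal.add_lt_top.2 ⟨ENNReal.coe_lt_top, Z.finite_Lam ω t⟩

theorem coe_lam_eq (Z : ProcessTriple Ω E 𝒰) (ω : Ω) (t : ℝ≥0) :
    (Z.lam t ω : ℝ≥0∞) = Z.ctl ω (Set.Iic t ×ˢ {Sum.inl ()}) := by
  have h : MeasurableSet ({Sum.inl ()} : Set (Unit ⊕ 𝒰)) := by
    rw [← Set.image_singleton]
    exact measurableSet_inl_image.2 (measurableSet_singleton _)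
  rw [ctl_Iic_prod _ _ _ h]
  have : (Sum.inr ⁻¹' {Sum.inl ()} : Set 𝒰) = ∅ := by ext; simp
  simp [this]

theorem measurable_Y_filtration (Z : ProcessTriple Ω E 𝒰) {s t : ℝ≥0} (h : s ≤ t) :
    Measurable[Z.filtration t] (Z.Y s) := by
  refine Measurable.mono (measurable_iff_comap_le.2 le_rfl) ?_ le_rfl
  exact le_trans (le_sup_left.trans le_sup_left)
    (le_iSup₂_of_le (f := fun r (_ : r ≤ t) => MeasurableSpace.comap (Z.Y r) inferInstance ⊔
      MeasurableSpace.comap (Z.lam r) inferInstance ⊔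
      MeasurableSpace.comap (fun ω => upTo (Z.Lam ω) r) inferInstance) _ h le_rfl)

theorem measurable_lam_filtration (Z : ProcessTriple Ω E 𝒰) {s t : ℝ≥0} (h : s ≤ t) :
    Measurable[Z.filtration t] (Z.lam s) := by
  refine Measurable.mono (measurable_iff_comap_le.2 le_rfl) ?_ le_rfl
  exact le_trans (le_sup_right.trans le_sup_left)
    (le_iSup₂_of_le (f := fun r (_ : r ≤ t) => MeasurableSpace.comap (Z.Y r) inferInstance ⊔
      MeasurableSpace.comap (Z.lam r) inferInstance ⊔
      MeasurableSpace.comap (fun ω => upTo (Z.Lam ω) r) inferInstance) _ h le_rfl)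

theorem measurable_upTo_filtration (Z : ProcessTriple Ω E 𝒰) {s t : ℝ≥0} (h : s ≤ t) :
    Measurable[Z.filtration t] (fun ω => upTo (Z.Lam ω) s) := by
  refine Measurable.mono (measurable_iff_comap_le.2 le_rfl) ?_ le_rfl
  exact le_trans le_sup_right
    (le_iSup₂_of_le (f := fun r (_ : r ≤ t) => MeasurableSpace.comap (Z.Y r) inferInstance ⊔
      MeasurableSpace.comap (Z.lam r) inferInstance ⊔
      MeasurableSpace.comap (fun ω => upTo (Z.Lam ω) r) inferInstance) _ h le_rfl)

theorem measurable_ctl_filtration (Z : ProcessTriple Ω E 𝒰) {s t : ℝ≥0} (h : s ≤ t)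
    {B : Set (Unit ⊕ 𝒰)} (hB : MeasurableSet B) :
    Measurable[Z.filtration t] (fun ω => Z.ctl ω (Set.Iic s ×ˢ B)) := by
  simp_rw [fun ω => Z.ctl_Iic_prod ω s hB]
  refine Measurable.add ?_ ?_
  · exact (measurable_coe_nnreal_ennreal.comp (Z.measurable_lam_filtration h)).mul_const _
  · exact (Measure.measurable_coe (measurable_inr hB)).comp (Z.measurable_upTo_filtration h)

/-- Both `λ₀` and `Λ₁` can be read off the combined control measure, so the natural filtration
contains nothing beyond the state and this measure. The lemma bounds the filtrations of restarted
and of limiting processes. -/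
theorem filtration_le_of (Z : ProcessTriple Ω E 𝒰) (t : ℝ≥0) : ∀ m : MeasurableSpace Ω,
    (∀ s ≤ t, Measurable[m] (@Y Ω mΩ E 𝒰 _ _ _ Z s)) →
    (∀ s ≤ t, ∀ B, MeasurableSet B →
      Measurable[m] fun ω => @ctl Ω mΩ E 𝒰 _ _ _ Z ω (Set.Iic s ×ˢ B)) →
    @filtration Ω mΩ E 𝒰 _ _ _ Z t ≤ m := by
  have hl : ∀ s, Z.lam s = fun ω => (Z.ctl ω (Set.Iic s ×ˢ {Sum.inl ()})).toNNReal := fun s => by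
    funext ω
    rw [← coe_lam_eq, ENNReal.toNNReal_coe]
  have hu : ∀ s (B : Set 𝒰), MeasurableSet B →
      (fun ω => Z.ctl ω (Set.Iic s ×ˢ (Sum.inr '' B))) = fun ω => upTo (Z.Lam ω) s B :=
    fun s B hB => by
      funext ω
      rw [Z.ctl_Iic_prod ω s (measurableSet_inr_image.2 hB),
        Set.preimage_image_eq _ Sum.inr_injective]
      simp
  intro m hY hN
  refine iSup₂_le fun s hs => sup_le (sup_le (hY s hs).comap_le ?_) ?_
  · refine Measurable.comap_le ?_
    have h1 : MeasurableSet ({Sum.inl ()} : Set (Unit ⊕ 𝒰)) := by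
      rw [← Set.image_singleton]
      exact measurableSet_inl_image.2 (measurableSet_singleton _)
    rw [hl s]
    exact (hN s hs _ h1).ennreal_toNNReal
  · refine Measurable.comap_le (Measure.measurable_of_measurable_coe _ fun B hB => ?_)
    have h := hN s hs _ (measurableSet_inr_image.2 hB)
    rwa [hu s B hB] at h

theorem measurable_ctl (Z : ProcessTriple Ω E 𝒰) : Measurable Z.ctl := by
  refine Measure.measurable_of_measurable_coe _ fun S hS => ?_
  have hU : ∀ ω, Z.ctl ω S = ⨆ n : ℕ, (Z.ctl ω).restrict (Set.Iic (n : ℝ≥0) ×ˢ Set.univ) S := by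
    intro ω
    have hU : S = ⋃ n : ℕ, S ∩ Set.Iic (n : ℝ≥0) ×ˢ Set.univ := by
      rw [← Set.inter_iUnion, Set.inter_eq_left.2]
      intro x _
      obtain ⟨n, hn⟩ := exists_nat_ge x.1
      exact Set.mem_iUnion.2 ⟨n, hn, trivial⟩
    have hmono : Monotone fun n : ℕ => S ∩ (Set.Iic (n : ℝ≥0) ×ˢ Set.univ) :=
      fun a b hab => Set.inter_subset_inter_right _
        (Set.prod_mono (Set.Iic_subset_Iic.2 (by exact_mod_cast hab)) le_rfl)
    conv_lhs => rw [hU]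
    rw [hmono.measure_iUnion]
    simp_rw [Measure.restrict_apply hS]
  simp_rw [hU]
  refine Measurable.iSup fun n => ?_
  refine (Measure.measurable_coe hS).comp (measurable_measure_of_Iic_prod (fun ω => ?_)
    fun t B hB => ?_)
  · exact ⟨by rw [Measure.restrict_apply_univ]; exact Z.ctl_Iic_lt_top ω _⟩
  · simp_rw [Measure.restrict_apply (measurableSet_Iic.prod hB), Set.prod_inter_prod,
      Set.Iic_inter_Iic, Set.inter_univ]
    exact (Z.measurable_ctl_filtration le_rfl hB).mono (Z.filtration.le _) le_rfl

theorem ae_ctl_iff (Z : ProcessTriple Ω E 𝒰) (ω : Ω) {q : ℝ≥0 × (Unit ⊕ 𝒰) → Prop}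
    (hq : MeasurableSet {p | q p}) : (∀ᵐ p ∂(Z.ctl ω), q p) ↔
      (∀ᵐ s ∂(Z.dlam ω), q (inlTime s)) ∧ ∀ᵐ p ∂(Z.Lam ω), q (inrTime p) := by
  rw [ctl, ae_add_measure_iff, ae_map_iff measurable_inlTime.aemeasurable hq,
    ae_map_iff measurable_inrTime.aemeasurable hq]

/-- The process with state `Y` and control measure `N`. -/
def ofControl (Y : ℝ≥0 → Ω → E) (N : Ω → Measure (ℝ≥0 × (Unit ⊕ 𝒰)))
    (hY : ∀ t, Measurable (Y t)) (hc : ∀ ω, IsCadlag fun t => Y t ω) (hN : Measurable N)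
    (hf : ∀ ω t, N ω (Set.Iic t ×ˢ Set.univ) < ∞) : ProcessTriple Ω E 𝒰 where
  Y := Y
  lam t ω := (N ω (inlTime '' Set.Iic t)).toNNReal
  Lam ω := (N ω).comap inrTime
  measurable_Y := hY
  cadlag_Y := hc
  measurable_lam t := by
    rw [inlTime_image]
    refine Measurable.ennreal_toNNReal ((Measure.measurable_coe ?_).comp hN)
    refine measurableSet_Iic.prod ?_
    rw [← Set.image_singleton]
    exact measurableSet_inl_image.2 (measurableSet_singleton _)
  mono_lam ω s t hst := by
    refine ENNReal.toNNReal_mono ?_ (measure_mono (Set.image_mono (Set.Iic_subset_Iic.2 hst)))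
    rw [inlTime_image]
    exact ((measure_mono (Set.prod_mono le_rfl (Set.subset_univ _))).trans_lt (hf ω t)).ne
  rightCont_lam ω t := by
    have hfin : ∀ s, N ω (inlTime '' Set.Iic s) ≠ ∞ := fun s => by
      rw [inlTime_image]
      exact ((measure_mono (Set.prod_mono le_rfl (Set.subset_univ _))).trans_lt (hf ω s)).ne
    have h1 : MeasurableSet ({Sum.inl ()} : Set (Unit ⊕ 𝒰)) := by
      rw [← Set.image_singleton]
      exact measurableSet_inl_image.2 (measurableSet_singleton _)
    refine continuousWithinAt_Ioi_iff_Ici.1 ?_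
    refine (ENNReal.tendsto_toNNReal (hfin t)).comp ?_
    -- Right continuity of `λ₀` is continuity from above of the measure along `[0, s]` as `s`
    -- decreases to `t`.
    have h := tendsto_measure_biInter_gt (μ := N ω) (s := fun s => inlTime '' Set.Iic s) (a := t)
      (fun s _ => by
        rw [inlTime_image]
        exact (measurableSet_Iic.prod h1).nullMeasurableSet)
      (fun i j _ hij => Set.image_mono (Set.Iic_subset_Iic.2 hij)) ⟨t + 1, by simp, hfin _⟩
    have hI : inlTime (𝒰 := 𝒰) '' Set.Iic t = ⋂ r, ⋂ (_ : r > t), inlTime '' Set.Iic r := by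
      ext p
      simp only [inlTime_image, Set.mem_iInter, Set.mem_prod, Set.mem_Iic]
      constructor
      · exact fun hp r hr => ⟨hp.1.trans hr.le, hp.2⟩
      · exact fun hp => ⟨le_of_forall_gt_imp_ge_of_dense fun r hr => (hp r hr).1,
          (hp (t + 1) (by simp)).2⟩
    rw [← hI] at h
    exact h
  measurable_Lam := by
    refine Measure.measurable_of_measurable_coe _ fun B hB => ?_
    simp_rw [measurableEmbedding_inrTime.comap_apply]
    exact (Measure.measurable_coe (measurableEmbedding_inrTime.measurableSet_image.2 hB)).comp hN
  finite_Lam ω t := by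
    rw [measurableEmbedding_inrTime.comap_apply]
    refine (measure_mono ?_).trans_lt (hf ω t)
    rw [inrTime_image_prod]
    exact Set.prod_mono le_rfl (Set.subset_univ _)

/-- No information is lost in splitting a control measure into `λ₀` and `Λ₁`, so a new triple may be
specified by its state and its control measure alone. -/
theorem ctl_ofControl (Y : ℝ≥0 → Ω → E) (N : Ω → Measure (ℝ≥0 × (Unit ⊕ 𝒰)))
    (hY : ∀ t, Measurable (Y t)) (hc : ∀ ω, IsCadlag fun t => Y t ω) (hN : Measurable N)
    (hf : ∀ ω t, N ω (Set.Iic t ×ˢ Set.univ) < ∞) : (ofControl Y N hY hc hN hf).ctl = N := by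
  funext ω
  refine measure_ext_Iic_prod (fun t => (ctl_Iic_lt_top _ ω t).ne) fun t B hB => ?_
  rw [ctl_Iic_prod _ _ _ hB, upTo_apply _ _ (measurable_inr hB)]
  have hfin : ∀ s, N ω (inlTime '' Set.Iic s) ≠ ∞ := fun s => by
    rw [inlTime_image]
    exact ((measure_mono (Set.prod_mono le_rfl (Set.subset_univ _))).trans_lt (hf ω s)).ne
  have h1 : MeasurableSet ({Sum.inl ()} : Set (Unit ⊕ 𝒰)) := by
    rw [← Set.image_singleton]
    exact measurableSet_inl_image.2 (measurableSet_singleton _)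
  simp only [ofControl]
  rw [ENNReal.coe_toNNReal (hfin t), measurableEmbedding_inrTime.comap_apply, inrTime_image_prod,
    inlTime_image]
  by_cases h : Sum.inl () ∈ B
  · rw [Set.indicator_of_mem h, Pi.one_apply, mul_one,
      ← measure_union _ (measurableSet_Iic.prod (measurableSet_inr_image.2 (measurable_inr hB))),
      ← Set.prod_union]
    · congr 2
      ext x
      rcases x with ⟨⟩ | x <;> simp [h]
    · rw [Set.disjoint_left]
      rintro ⟨a, b⟩ ⟨_, h2⟩ ⟨_, h3⟩
      obtain ⟨c, _, h4⟩ := h3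
      simp only [Set.mem_singleton_iff] at h2
      simp [h2] at h4
  · rw [Set.indicator_of_notMem h, mul_zero, zero_add]
    congr 2
    ext x
    rcases x with ⟨⟩ | x <;> simp [h]

end ProcessTriple

theorem measurableSet_singleton_inl {𝒰 : Type v} [MeasurableSpace 𝒰] :
    MeasurableSet ({Sum.inl ()} : Set (Unit ⊕ 𝒰)) := by
  rw [← Set.image_singleton]
  exact measurableSet_inl_image.2 (measurableSet_singleton _)

/-! ### The closed constraint on state and control, and continuous versions of `(Af, Bf)`. -/

namespace ControlledData

variable {E : Type u} {𝒰 : Type v} [MetricSpace E] [MetricSpace 𝒰]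

/-- The closed set of pairs of a state and an admissible control, the control being `Sum.inl ()`
in `closure E₀`. -/
def constraint (D : ControlledData E 𝒰) : Set (E × (Unit ⊕ 𝒰)) :=
  {p | Sum.elim (fun _ => p.1 ∈ closure D.E₀) (fun c => (p.1, c) ∈ D.Ξ) p.2}

/-- Closedness is the reason the constraint survives weak limits; it uses `closure E₀` for the first
kind of control and the closed set `Ξ` for the second. -/
theorem isClosed_constraint (D : ControlledData E 𝒰) : IsClosed D.constraint := by
  have h : IsClosed ((Homeomorph.prodSumDistrib (X := E) (Y := Unit) (Z := 𝒰)).symm ⁻¹'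
      D.constraint) := by
    refine isClosed_sum_iff.2 ⟨?_, ?_⟩
    · exact isClosed_closure.preimage (continuous_fst (X := E) (Y := Unit))
    · exact D.isClosed_Ξ
  exact (Homeomorph.isClosed_preimage _).1 h

/-- The function on `E × (Unit ⊕ 𝒰)` given by `g` for the control `Sum.inl ()` and by `h`
(extended by zero) on `𝒰`. -/
def genFun (D : ControlledData E 𝒰) (g : C(E, ℝ)) (h : C(D.Ξ, ℝ)) (p : E × (Unit ⊕ 𝒰)) : ℝ :=
  Sum.elim (fun _ => g p.1) (fun c => extendZero h (p.1, c)) p.2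

/-- `G` is a continuous version of `(Af, Bf)`. -/
def IsGen (D : ControlledData E 𝒰) (f : C(E, ℝ)) (G : C(E × (Unit ⊕ 𝒰), ℝ)) : Prop :=
  ∃ g h, (f, g) ∈ D.A ∧ (f, h) ∈ D.B ∧ ∀ p ∈ D.constraint, G p = D.genFun g h p

/-- Tietze extension of `Bf` from `Ξ`. The extension by zero need not be continuous and so is
unsuited to weak convergence, but control measures of solutions only see the constraint set, where
the two agree. -/
theorem exists_isGen (D : ControlledData E 𝒰) {f g : C(E, ℝ)} {h : C(D.Ξ, ℝ)}
    (hA : (f, g) ∈ D.A) (hB : (f, h) ∈ D.B) :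
    ∃ G : C(E × (Unit ⊕ 𝒰), ℝ), D.IsGen f G ∧ ∀ p ∈ D.constraint, G p = D.genFun g h p := by
  obtain ⟨H, hH⟩ := ContinuousMap.exists_restrict_eq D.isClosed_Ξ h
  let G : C(E × (Unit ⊕ 𝒰), ℝ) :=
    ⟨fun p => Sum.elim (fun _ => g p.1) (fun c => H (p.1, c)) p.2, by
      refine continuous_prod_sum ?_ ?_
      · exact g.continuous.comp continuous_fst
      · exact H.continuous⟩
  have hG : ∀ p ∈ D.constraint, G p = D.genFun g h p := by
    rintro ⟨x, c | c⟩ hp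
    · rfl
    · have h1 : extendZero h (x, c) = h ⟨(x, c), hp⟩ :=
        Subtype.val_injective.extend_apply h 0 ⟨(x, c), hp⟩
      change H (x, c) = extendZero h (x, c)
      rw [h1, ← hH]
      rfl
  exact ⟨G, ⟨g, h, hA, hB, hG⟩, hG⟩

variable [CompactSpace E] [CompactSpace 𝒰]

theorem exists_bound_genFun (D : ControlledData E 𝒰) (g : C(E, ℝ)) (h : C(D.Ξ, ℝ)) :
    ∃ C, ∀ p, |D.genFun g h p| ≤ C := by
  have : CompactSpace D.Ξ := isCompact_iff_compactSpace.1 D.isClosed_Ξ.isCompact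
  refine ⟨max ‖g‖ ‖h‖, ?_⟩
  rintro ⟨x, c | c⟩
  · exact (g.norm_coe_le_norm x).trans (le_max_left _ _)
  · change |extendZero h (x, c)| ≤ _
    by_cases hp : (x, c) ∈ D.Ξ
    · have h1 : extendZero h (x, c) = h ⟨(x, c), hp⟩ :=
        Subtype.val_injective.extend_apply h 0 ⟨(x, c), hp⟩
      rw [h1]
      exact (h.norm_coe_le_norm _).trans (le_max_right _ _)
    · have h1 : extendZero h (x, c) = 0 :=
        Function.extend_apply' _ _ _ (by rintro ⟨a, ha⟩; exact hp (ha ▸ a.2))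
      rw [h1, abs_zero]
      exact (norm_nonneg g).trans (le_max_left _ _)

variable [MeasurableSpace E] [BorelSpace E] [MeasurableSpace 𝒰] [BorelSpace 𝒰]

theorem measurable_genFun (D : ControlledData E 𝒰) (g : C(E, ℝ)) (h : C(D.Ξ, ℝ)) :
    Measurable (D.genFun g h) := by
  refine measurable_prod_sum ?_ ?_
  · exact g.continuous.measurable.comp measurable_fst
  · change Measurable (extendZero h)
    exact (MeasurableEmbedding.subtype_coe D.isClosed_Ξ.measurableSet).measurable_extend
      h.continuous.measurable measurable_const

end ControlledData

/-! ### Drift integrals against the control measure. -/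

namespace ProcessTriple

variable {Ω : Type*} [mΩ : MeasurableSpace Ω] {E : Type u} {𝒰 : Type v}
  [MetricSpace E] [MeasurableSpace E] [MeasurableSpace 𝒰]

theorem setIntegral_ctl (Z : ProcessTriple Ω E 𝒰) (ω : Ω) (t : ℝ≥0)
    {F : ℝ≥0 × (Unit ⊕ 𝒰) → ℝ} (hF : Measurable F) {C : ℝ} (hC : ∀ p, |F p| ≤ C) :
    ∫ p in Set.Iic t ×ˢ Set.univ, F p ∂(Z.ctl ω) =
      (∫ s in Set.Iic t, F (inlTime s) ∂(Z.dlam ω)) +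
        ∫ p in Set.Iic t ×ˢ Set.univ, F (inrTime p) ∂(Z.Lam ω) := by
  have hS : MeasurableSet (Set.Iic t ×ˢ (Set.univ : Set (Unit ⊕ 𝒰))) :=
    measurableSet_Iic.prod MeasurableSet.univ
  have h1 : inlTime ⁻¹' (Set.Iic t ×ˢ (Set.univ : Set (Unit ⊕ 𝒰))) = Set.Iic t := by
    ext; simp [inlTime]
  have h2 : inrTime ⁻¹' (Set.Iic t ×ˢ (Set.univ : Set (Unit ⊕ 𝒰))) = Set.Iic t ×ˢ Set.univ := by
    ext; simp [inrTime]
  have f1 : IsFiniteMeasure ((Z.dlam ω).restrict (Set.Iic t)) :=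
    ⟨by rw [Measure.restrict_apply_univ, dlam_Iic]; exact ENNReal.coe_lt_top⟩
  have f2 : IsFiniteMeasure ((Z.Lam ω).restrict (Set.Iic t ×ˢ Set.univ)) :=
    ⟨by rw [Measure.restrict_apply_univ]; exact Z.finite_Lam ω t⟩
  rw [ctl, Measure.restrict_add, Measure.restrict_map measurable_inlTime hS,
    Measure.restrict_map measurable_inrTime hS, h1, h2, integral_add_measure,
    integral_map measurable_inlTime.aemeasurable hF.aestronglyMeasurable,
    integral_map measurable_inrTime.aemeasurable hF.aestronglyMeasurable]
  · have : IsFiniteMeasure (((Z.dlam ω).restrict (Set.Iic t)).map (inlTime (𝒰 := 𝒰))) :=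
      inferInstance
    exact Integrable.of_bound hF.aestronglyMeasurable C (Eventually.of_forall hC)
  · exact Integrable.of_bound hF.aestronglyMeasurable C (Eventually.of_forall hC)

/-- `∫_{[0,t] × (Unit ⊕ 𝒰)} H(Y(s), c)` with respect to the control measure. -/
def drift (Z : ProcessTriple Ω E 𝒰) (H : E × (Unit ⊕ 𝒰) → ℝ) (t : ℝ≥0) (ω : Ω) : ℝ :=
  ∫ p in Set.Iic t ×ˢ Set.univ, H (Z.Y p.1 ω, p.2) ∂(Z.ctl ω)

variable [BorelSpace E]

theorem measurable_path (Z : ProcessTriple Ω E 𝒰) (ω : Ω) : Measurable fun t => Z.Y t ω :=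
  measurable_path_of_rightCont (Z.cadlag_Y ω).1

theorem measurable_Y_ctl (Z : ProcessTriple Ω E 𝒰) (ω : Ω) :
    Measurable fun p : ℝ≥0 × (Unit ⊕ 𝒰) => (Z.Y p.1 ω, p.2) :=
  ((Z.measurable_path ω).comp measurable_fst).prodMk measurable_snd

theorem stronglyMeasurable_drift (Z : ProcessTriple Ω E 𝒰) {H : E × (Unit ⊕ 𝒰) → ℝ}
    (hH : Measurable H) (t : ℝ≥0) : StronglyMeasurable[Z.filtration t] (Z.drift H t) :=
  stronglyMeasurable_integral_Iic (Z.filtration t) t (fun _ hs => Z.measurable_Y_filtration hs)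
    (fun ω s => (Z.cadlag_Y ω).1 s) (fun _ hs _ hB => Z.measurable_ctl_filtration hs hB)
    (fun ω => Z.ctl_Iic_lt_top ω t) hH


theorem drift_sub (Z : ProcessTriple Ω E 𝒰) {H : E × (Unit ⊕ 𝒰) → ℝ}
    (hH : Measurable H) {C : ℝ} (hC : ∀ p, |H p| ≤ C) {s t : ℝ≥0} (hst : s ≤ t) (ω : Ω) :
    Z.drift H t ω - Z.drift H s ω =
      ∫ p in Set.Ioc s t ×ˢ Set.univ, H (Z.Y p.1 ω, p.2) ∂(Z.ctl ω) := by
  have hI : IntegrableOn (fun p : ℝ≥0 × (Unit ⊕ 𝒰) => H (Z.Y p.1 ω, p.2))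
      (Set.Iic t ×ˢ Set.univ) (Z.ctl ω) := by
    have : IsFiniteMeasure ((Z.ctl ω).restrict (Set.Iic t ×ˢ Set.univ)) :=
      ⟨by rw [Measure.restrict_apply_univ]; exact Z.ctl_Iic_lt_top ω t⟩
    exact Integrable.of_bound (hH.comp (Z.measurable_Y_ctl ω)).aestronglyMeasurable C
      (Eventually.of_forall fun p => hC _)
  have hU : (Set.Iic t ×ˢ Set.univ : Set (ℝ≥0 × (Unit ⊕ 𝒰))) =
      Set.Iic s ×ˢ Set.univ ∪ Set.Ioc s t ×ˢ Set.univ := by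
    rw [← Set.union_prod, Set.Iic_union_Ioc_eq_Iic hst]
  rw [drift, drift, hU, setIntegral_union]
  · ring
  · rw [Set.disjoint_left]
    rintro p hp hp'
    exact absurd hp'.1.1 (not_lt.2 hp.1)
  · exact measurableSet_Ioc.prod MeasurableSet.univ
  · exact hI.mono_set (hU ▸ Set.subset_union_left)
  · exact hI.mono_set (hU ▸ Set.subset_union_right)

end ProcessTriple

/-! ### Solutions expressed through the control measure. -/

section Characterization

variable {Ω : Type*} [mΩ : MeasurableSpace Ω] {E : Type u} {𝒰 : Type v}
  [MetricSpace E] [CompactSpace E] [MeasurableSpace E] [BorelSpace E]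
  [MetricSpace 𝒰] [CompactSpace 𝒰] [MeasurableSpace 𝒰] [BorelSpace 𝒰]

theorem measurableSet_constraint (D : ControlledData E 𝒰) : MeasurableSet D.constraint :=
  D.isClosed_constraint.measurableSet

/-- The martingale of the controlled martingale problem, in terms of the control measure. -/
theorem drift_genFun (D : ControlledData E 𝒰) (Z : ProcessTriple Ω E 𝒰) (g : C(E, ℝ))
    (h : C(D.Ξ, ℝ)) (t : ℝ≥0) (ω : Ω) : Z.drift (D.genFun g h) t ω =
      (∫ s in Set.Iic t, g (Z.Y s ω) ∂(Z.dlam ω))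
      + ∫ p in Set.Iic t ×ˢ Set.univ, extendZero h (Z.Y p.1 ω, p.2) ∂(Z.Lam ω) := by
  obtain ⟨C, hC⟩ := D.exists_bound_genFun g h
  rw [ProcessTriple.drift, Z.setIntegral_ctl ω t
    (F := fun p => D.genFun g h (Z.Y p.1 ω, p.2))
    ((D.measurable_genFun g h).comp (Z.measurable_Y_ctl ω)) (fun p => hC _)]
  rfl

/-- As the masses are finite, equality on `[0, n] × X` for all `n` says that the complement of `S`
is null in each window, hence null. -/
theorem forall_Iic_ae_iff {X : Type*} [MeasurableSpace X] {μ : Measure (ℝ≥0 × X)}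
    (hμ : ∀ t : ℝ≥0, μ (Set.Iic t ×ˢ Set.univ) ≠ ∞) {S : Set (ℝ≥0 × X)} (hS : MeasurableSet S) :
    (∀ t : ℝ≥0, μ (Set.Iic t ×ˢ Set.univ) = μ (S ∩ Set.Iic t ×ˢ Set.univ)) ↔
      ∀ᵐ p ∂μ, p ∈ S := by
  have hm : ∀ t : ℝ≥0, MeasurableSet (Set.Iic t ×ˢ (Set.univ : Set X)) := fun t =>
    measurableSet_Iic.prod MeasurableSet.univ
  constructor
  · intro h
    have h1 : ∀ n : ℕ, μ (Set.Iic (n : ℝ≥0) ×ˢ Set.univ \ S) = 0 := fun n => by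
      have h2 := measure_sdiff_add_inter (μ := μ) (Set.Iic (n : ℝ≥0) ×ˢ (Set.univ : Set X)) hS
      rw [Set.inter_comm, ← h n] at h2
      exact (ENNReal.add_left_inj (hμ n)).1 (h2.trans (zero_add _).symm)
    have h3 := measure_iUnion_null h1
    refine measure_mono_null (fun p hp => ?_) h3
    obtain ⟨n, hn⟩ := exists_nat_ge p.1
    exact Set.mem_iUnion.2 ⟨n, ⟨hn, trivial⟩, hp⟩
  · intro h t
    refine measure_congr ?_
    filter_upwards [h] with p hp
    exact propext ⟨fun h => ⟨hp, h⟩, fun h => h.2⟩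

theorem forall_Iic_ae_iff_time {μ : Measure ℝ≥0}
    (hμ : ∀ t : ℝ≥0, μ (Set.Iic t) ≠ ∞) {S : Set ℝ≥0} (hS : MeasurableSet S) :
    (∀ t : ℝ≥0, μ (Set.Iic t) = μ (S ∩ Set.Iic t)) ↔ ∀ᵐ p ∂μ, p ∈ S := by
  constructor
  · intro h
    have h1 : ∀ n : ℕ, μ (Set.Iic (n : ℝ≥0) \ S) = 0 := fun n => by
      have h2 := measure_sdiff_add_inter (μ := μ) (Set.Iic (n : ℝ≥0)) hS
      rw [Set.inter_comm, ← h n] at h2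
      exact (ENNReal.add_left_inj (hμ n)).1 (h2.trans (zero_add _).symm)
    refine measure_mono_null (fun p hp => ?_) (measure_iUnion_null h1)
    obtain ⟨n, hn⟩ := exists_nat_ge p
    exact Set.mem_iUnion.2 ⟨n, hn, hp⟩
  · intro h t
    refine measure_congr ?_
    filter_upwards [h] with p hp
    exact propext ⟨fun h => ⟨hp, h⟩, fun h => h.2⟩

/-- The two support identities become one almost-everywhere constraint, and `λ₀(t) + λ₁(t) = t`
becomes a Lebesgue time marginal. In this form the definition is easy to restart and to pass to
limits. -/
theorem isControlledSolution_iff (D : ControlledData E 𝒰) (P : Measure Ω)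
    (Z : ProcessTriple Ω E 𝒰) : IsControlledSolution D P Z ↔
      (∀ᵐ ω ∂P, ∀ t : ℝ≥0, Z.ctl ω (Set.Iic t ×ˢ Set.univ) = t) ∧
      (∀ᵐ ω ∂P, ∀ᵐ p ∂(Z.ctl ω), (Z.Y p.1 ω, p.2) ∈ D.constraint) ∧
      ∀ (f g : C(E, ℝ)) (h : C(D.Ξ, ℝ)), (f, g) ∈ D.A → (f, h) ∈ D.B →
        Martingale (fun t ω => f (Z.Y t ω) - f (Z.Y 0 ω) - Z.drift (D.genFun g h) t ω)
          Z.filtration P := by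
  have h0 : ∀ ω, (∀ᵐ p ∂(Z.ctl ω), (Z.Y p.1 ω, p.2) ∈ D.constraint) ↔
      (∀ t : ℝ≥0, (Z.lam t ω : ℝ≥0∞) =
        ∫⁻ s in Set.Iic t, (closure D.E₀).indicator 1 (Z.Y s ω) ∂(Z.dlam ω)) ∧
      ∀ t : ℝ≥0, Z.Lam ω (Set.Iic t ×ˢ Set.univ) =
        ∫⁻ p in Set.Iic t ×ˢ Set.univ, D.Ξ.indicator 1 (Z.Y p.1 ω, p.2) ∂(Z.Lam ω) := by
    intro ω
    have hY := Z.measurable_path ω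
    have hS1 : MeasurableSet ((fun s => Z.Y s ω) ⁻¹' closure D.E₀) :=
      hY isClosed_closure.measurableSet
    have hS2 : MeasurableSet ((fun p : ℝ≥0 × 𝒰 => (Z.Y p.1 ω, p.2)) ⁻¹' D.Ξ) :=
      ((hY.comp measurable_fst).prodMk measurable_snd) D.isClosed_Ξ.measurableSet
    rw [Z.ae_ctl_iff ω (q := fun p => (Z.Y p.1 ω, p.2) ∈ D.constraint)
      ((Z.measurable_Y_ctl ω) (measurableSet_constraint D))]
    refine and_congr ?_ ?_
    · rw [show (∀ᵐ s ∂(Z.dlam ω), (Z.Y (inlTime (𝒰 := 𝒰) s).1 ω, (inlTime (𝒰 := 𝒰) s).2)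
        ∈ D.constraint) ↔ ∀ᵐ s ∂(Z.dlam ω), s ∈ (fun s => Z.Y s ω) ⁻¹' closure D.E₀ from Iff.rfl,
        ← forall_Iic_ae_iff_time (fun t => by rw [Z.dlam_Iic]; exact ENNReal.coe_ne_top) hS1]
      refine forall_congr' fun t => ?_
      rw [Z.dlam_Iic, show (fun s => (closure D.E₀).indicator (1 : E → ℝ≥0∞) (Z.Y s ω)) =
        ((fun s => Z.Y s ω) ⁻¹' closure D.E₀).indicator 1 from rfl, lintegral_indicator_one hS1,
        Measure.restrict_apply hS1]
    · rw [show (∀ᵐ p ∂(Z.Lam ω), (Z.Y (inrTime p).1 ω, (inrTime p).2) ∈ D.constraint) ↔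
        ∀ᵐ p ∂(Z.Lam ω), p ∈ (fun p : ℝ≥0 × 𝒰 => (Z.Y p.1 ω, p.2)) ⁻¹' D.Ξ from Iff.rfl,
        ← forall_Iic_ae_iff (fun t => (Z.finite_Lam ω t).ne) hS2]
      refine forall_congr' fun t => ?_
      rw [show (fun p : ℝ≥0 × 𝒰 => D.Ξ.indicator (1 : E × 𝒰 → ℝ≥0∞) (Z.Y p.1 ω, p.2)) =
        ((fun p : ℝ≥0 × 𝒰 => (Z.Y p.1 ω, p.2)) ⁻¹' D.Ξ).indicator 1 from rfl,
        lintegral_indicator_one hS2, Measure.restrict_apply hS2]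
  have hM : ∀ (f g : C(E, ℝ)) (h : C(D.Ξ, ℝ)),
      (fun t ω => f (Z.Y t ω) - f (Z.Y 0 ω) - Z.drift (D.genFun g h) t ω) =
      (fun t ω => f (Z.Y t ω) - f (Z.Y 0 ω)
      - (∫ s in Set.Iic t, g (Z.Y s ω) ∂(Z.dlam ω))
      - ∫ p in Set.Iic t ×ˢ Set.univ, extendZero h (Z.Y p.1 ω, p.2) ∂(Z.Lam ω)) := by
    intro f g h
    funext t ω
    rw [drift_genFun]
    ring
  constructor
  · intro h
    refine ⟨?_, ?_, fun f g h' hA hB => ?_⟩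
    · filter_upwards [h.lam_add] with ω hω t
      rw [Z.ctl_Iic_univ, hω]
    · filter_upwards [h.support_lam, h.support_Lam] with ω h1 h2
      exact (h0 ω).2 ⟨h1, h2⟩
    · rw [hM]
      exact h.martingale f g h' hA hB
  · rintro ⟨h1, h2, h3⟩
    refine ⟨?_, ?_, ?_, fun f g h' hA hB => ?_⟩
    · filter_upwards [h2] with ω hω
      exact ((h0 ω).1 hω).1
    · filter_upwards [h2] with ω hω
      exact ((h0 ω).1 hω).2
    · filter_upwards [h1] with ω hω t
      rw [← Z.ctl_Iic_univ, hω]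
    · rw [← hM]
      exact h3 f g h' hA hB

end Characterization

/-! ### Restarting a triple at a later time. -/

section Shift

variable {Ω : Type*} [mΩ : MeasurableSpace Ω] {E : Type u} {𝒰 : Type v}
  [MetricSpace E] [MeasurableSpace E] [BorelSpace E] [MeasurableSpace 𝒰]

theorem IsCadlag.shift {y : ℝ≥0 → E} (hy : IsCadlag y) (s : ℝ≥0) :
    IsCadlag fun t => y (s + t) := by
  refine ⟨fun t => ?_, fun t ht => ?_⟩
  · refine ContinuousWithinAt.comp (t := Set.Ici (s + t)) (hy.1 (s + t)) (by fun_prop) ?_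
    intro r hr
    exact add_le_add_right (α := ℝ≥0) hr s
  · obtain ⟨z, hz⟩ := hy.2 (s + t) (ht.trans_le (by simp))
    refine ⟨z, hz.comp (tendsto_nhdsWithin_iff.2 ⟨?_, ?_⟩)⟩
    · exact (Continuous.tendsto (by fun_prop) t).mono_left nhdsWithin_le_nhds
    · filter_upwards [self_mem_nhdsWithin] with r hr
      exact (add_lt_add_iff_left s).2 hr

/-- Restriction of a measure on `[0, ∞) × V` to `(s, ∞) × V`, shifted to start at time `0`. -/
def shiftMeasure {V : Type*} [MeasurableSpace V] (s : ℝ≥0) (N : Measure (ℝ≥0 × V)) :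
    Measure (ℝ≥0 × V) :=
  (N.restrict (Set.Ioi s ×ˢ Set.univ)).map fun p => (p.1 - s, p.2)

theorem measurable_sub_time {V : Type*} [MeasurableSpace V] (s : ℝ≥0) :
    Measurable fun p : ℝ≥0 × V => (p.1 - s, p.2) :=
  (measurable_fst.sub_const s).prodMk measurable_snd

theorem measurable_shiftMeasure {V : Type*} [MeasurableSpace V] (s : ℝ≥0) :
    Measurable (shiftMeasure (V := V) s) := by
  refine (Measure.measurable_map _ (measurable_sub_time s)).comp
    (Measure.measurable_of_measurable_coe _ fun S hS => ?_)
  simp only [Measure.restrict_apply hS]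
  exact Measure.measurable_coe (hS.inter (measurableSet_Ioi.prod MeasurableSet.univ))

theorem sub_time_preimage {V : Type*} (s t : ℝ≥0) (B : Set V) :
    (fun p : ℝ≥0 × V => (p.1 - s, p.2)) ⁻¹' (Set.Iic t ×ˢ B) ∩ Set.Ioi s ×ˢ Set.univ =
      Set.Ioc s (s + t) ×ˢ B := by
  ext p
  simp only [Set.mem_inter_iff, Set.mem_preimage, Set.mem_prod, Set.mem_Iic, Set.mem_Ioi,
    Set.mem_univ, and_true, Set.mem_Ioc, tsub_le_iff_left]
  tauto

theorem shiftMeasure_Iic_prod {V : Type*} [MeasurableSpace V] (s t : ℝ≥0)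
    (N : Measure (ℝ≥0 × V)) {B : Set V} (hB : MeasurableSet B) :
    shiftMeasure s N (Set.Iic t ×ˢ B) = N (Set.Ioc s (s + t) ×ˢ B) := by
  have hm : MeasurableSet (Set.Iic t ×ˢ B) := measurableSet_Iic.prod hB
  rw [shiftMeasure, Measure.map_apply (measurable_sub_time s) hm,
    Measure.restrict_apply (measurable_sub_time s hm), sub_time_preimage]

theorem measure_Ioc_prod {V : Type*} [MeasurableSpace V] {N : Measure (ℝ≥0 × V)} {s t : ℝ≥0}
    (hst : s ≤ t) {B : Set V} (hB : MeasurableSet B)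
    (hf : N (Set.Iic s ×ˢ B) ≠ ∞) :
    N (Set.Ioc s t ×ˢ B) = N (Set.Iic t ×ˢ B) - N (Set.Iic s ×ˢ B) := by
  rw [← measure_sdiff (Set.prod_mono (Set.Iic_subset_Iic.2 hst) le_rfl)
    (measurableSet_Iic.prod hB).nullMeasurableSet hf]
  congr 1
  ext p
  simp only [Set.mem_prod, Set.mem_Ioc, Set.mem_sdiff, Set.mem_Iic, not_and]
  constructor
  · exact fun h => ⟨⟨h.1.2, h.2⟩, fun h' => absurd h' (not_le.2 h.1.1)⟩
  · exact fun h => ⟨⟨lt_of_not_ge fun h' => h.2 h' h.1.2, h.1.1⟩, h.1.2⟩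

namespace ProcessTriple

/-- The process restarted at time `s`. -/
def shift (Z : ProcessTriple Ω E 𝒰) (s : ℝ≥0) : ProcessTriple Ω E 𝒰 :=
  ofControl (fun t => Z.Y (s + t)) (fun ω => shiftMeasure s (Z.ctl ω))
    (fun t => Z.measurable_Y _) (fun ω => (Z.cadlag_Y ω).shift s)
    ((measurable_shiftMeasure s).comp Z.measurable_ctl) (fun ω t => by
      rw [shiftMeasure_Iic_prod _ _ _ MeasurableSet.univ]
      exact (measure_mono (Set.prod_mono Set.Ioc_subset_Iic_self le_rfl)).trans_lt
        (Z.ctl_Iic_lt_top ω (s + t)))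

theorem ctl_shift (Z : ProcessTriple Ω E 𝒰) (s : ℝ≥0) (ω : Ω) :
    (Z.shift s).ctl ω = shiftMeasure s (Z.ctl ω) := by
  rw [shift, ctl_ofControl]

theorem Y_shift (Z : ProcessTriple Ω E 𝒰) (s t : ℝ≥0) : (Z.shift s).Y t = Z.Y (s + t) := rfl

theorem ctl_Iic_prod_ne_top (Z : ProcessTriple Ω E 𝒰) (ω : Ω) (t : ℝ≥0) (B : Set (Unit ⊕ 𝒰)) :
    Z.ctl ω (Set.Iic t ×ˢ B) ≠ ∞ :=
  ((measure_mono (Set.prod_mono le_rfl (Set.subset_univ _))).trans_lt (Z.ctl_Iic_lt_top ω t)).ne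

theorem lam_shift (Z : ProcessTriple Ω E 𝒰) (s t : ℝ≥0) (ω : Ω) :
    Z.lam (s + t) ω = Z.lam s ω + (Z.shift s).lam t ω := by
  have h1 : Z.lam s ω ≤ Z.lam (s + t) ω := Z.mono_lam ω (by simp)
  have h2 : ((Z.shift s).lam t ω : ℝ≥0∞) = Z.lam (s + t) ω - Z.lam s ω := by
    rw [coe_lam_eq, ctl_shift, shiftMeasure_Iic_prod _ _ _ measurableSet_singleton_inl,
      measure_Ioc_prod (by simp) measurableSet_singleton_inl (Z.ctl_Iic_prod_ne_top ω s _),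
      ← coe_lam_eq, ← coe_lam_eq]
  rw [← ENNReal.coe_sub, ENNReal.coe_inj] at h2
  rw [h2, add_tsub_cancel_of_le h1]

/-- The restarted control measure of `[0, r] × B` is a difference of two values of the original one,
both known at time `s + r`. Martingale increments can therefore be tested against events of the
restarted filtration. -/
theorem filtration_shift_le (Z : ProcessTriple Ω E 𝒰) (s t : ℝ≥0) :
    (Z.shift s).filtration t ≤ Z.filtration (s + t) := by
  refine (Z.shift s).filtration_le_of t _ (fun r hr => ?_) fun r hr B hB => ?_
  · exact Z.measurable_Y_filtration (add_le_add_right hr s)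
  · have h : (fun ω => (Z.shift s).ctl ω (Set.Iic r ×ˢ B)) =
        fun ω => Z.ctl ω (Set.Iic (s + r) ×ˢ B) - Z.ctl ω (Set.Iic s ×ˢ B) := by
      funext ω
      rw [ctl_shift, shiftMeasure_Iic_prod _ _ _ hB,
        measure_Ioc_prod (by simp) hB (Z.ctl_Iic_prod_ne_top ω s _)]
    rw [h]
    exact (Z.measurable_ctl_filtration (add_le_add_right hr s) hB).sub
      (Z.measurable_ctl_filtration (by simp) hB)

theorem drift_shift (Z : ProcessTriple Ω E 𝒰) {H : E × (Unit ⊕ 𝒰) → ℝ}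
    (hH : Measurable H) {C : ℝ} (hC : ∀ p, |H p| ≤ C) (s t : ℝ≥0) (ω : Ω) :
    (Z.shift s).drift H t ω = Z.drift H (s + t) ω - Z.drift H s ω := by
  rw [Z.drift_sub hH hC (by simp), drift, ctl_shift, shiftMeasure]
  have hm : MeasurableSet (Set.Iic t ×ˢ (Set.univ : Set (Unit ⊕ 𝒰))) :=
    measurableSet_Iic.prod MeasurableSet.univ
  rw [Measure.restrict_map (measurable_sub_time s) hm, Measure.restrict_restrict
    (measurable_sub_time s hm), sub_time_preimage]
  refine (integral_map (measurable_sub_time s).aemeasurable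
    (hH.comp ((Z.shift s).measurable_Y_ctl ω)).aestronglyMeasurable).trans ?_
  refine setIntegral_congr_fun (measurableSet_Ioc.prod MeasurableSet.univ) fun p hp => ?_
  simp only [Y_shift, Function.comp_apply]
  rw [add_tsub_cancel_of_le hp.1.1.le]

end ProcessTriple

end Shift

/-! ### Restarted solutions, strict monotonicity of `λ₀`, and iteration of the uniform bound. -/

section ShiftSolution

variable {Ω : Type*} [mΩ : MeasurableSpace Ω] {E : Type u} {𝒰 : Type v}
  [MetricSpace E] [CompactSpace E] [MeasurableSpace E] [BorelSpace E]
  [MetricSpace 𝒰] [CompactSpace 𝒰] [MeasurableSpace 𝒰] [BorelSpace 𝒰]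

theorem ContinuousMap.integrable_comp_of_compact {X : Type*} [TopologicalSpace X] [CompactSpace X]
    [MeasurableSpace X] [BorelSpace X] (f : C(X, ℝ)) {P : Measure Ω} [IsFiniteMeasure P]
    {Y : Ω → X} (hY : Measurable Y) : Integrable (fun ω => f (Y ω)) P :=
  Integrable.of_bound (f.continuous.measurable.comp hY).aestronglyMeasurable ‖f‖
    (Eventually.of_forall fun _ => f.norm_coe_le_norm _)

/-- Restarting a solution at time `s` under a measure with an `ℱ s`-measurable bounded density
gives a solution. -/
theorem isControlledSolution_shift {D : ControlledData E 𝒰} {P : Measure Ω}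
    [IsProbabilityMeasure P] {Z : ProcessTriple Ω E 𝒰} (hZ : IsControlledSolution D P Z) (s : ℝ≥0)
    {ρ : Ω → ℝ≥0} (hρ : Measurable[Z.filtration s] ρ) {c : ℝ≥0} (hc : ∀ ω, ρ ω ≤ c) :
    IsControlledSolution D (P.withDensity fun ω => ρ ω) (Z.shift s) := by
  have hρ' : Measurable ρ := hρ.mono (Z.filtration.le s) le_rfl
  obtain ⟨h1, h2, h3⟩ := (isControlledSolution_iff D P Z).1 hZ
  have hac : P.withDensity (fun ω => (ρ ω : ℝ≥0∞)) ≪ P := withDensity_absolutelyContinuous _ _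
  have hfin : IsFiniteMeasure (P.withDensity fun ω => (ρ ω : ℝ≥0∞)) := by
    refine isFiniteMeasure_withDensity (ne_of_lt ?_)
    calc ∫⁻ ω, (ρ ω : ℝ≥0∞) ∂P ≤ ∫⁻ _, (c : ℝ≥0∞) ∂P :=
          lintegral_mono fun ω => ENNReal.coe_le_coe.2 (hc ω)
      _ < ∞ := by simp
  refine (isControlledSolution_iff D _ _).2 ⟨?_, ?_, fun f g h hA hB => ?_⟩
  · filter_upwards [hac.ae_le h1] with ω hω t
    rw [ProcessTriple.ctl_shift, shiftMeasure_Iic_prod _ _ _ MeasurableSet.univ,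
      measure_Ioc_prod (by simp) MeasurableSet.univ (Z.ctl_Iic_lt_top ω s).ne, hω, hω]
    push_cast
    exact ENNReal.add_sub_cancel_left ENNReal.coe_ne_top
  · filter_upwards [hac.ae_le h2] with ω hω
    rw [ProcessTriple.ctl_shift, shiftMeasure, ae_map_iff (measurable_sub_time s).aemeasurable
      (((Z.shift s).measurable_Y_ctl ω) (measurableSet_constraint D)),
      ae_restrict_iff' (measurableSet_Ioi.prod MeasurableSet.univ)]
    filter_upwards [hω] with p hp hp'
    have h : s + (p.1 - s) = p.1 := add_tsub_cancel_of_le (le_of_lt hp'.1)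
    rw [ProcessTriple.Y_shift, h]
    exact hp
  · obtain ⟨C, hC⟩ := D.exists_bound_genFun g h
    have hM := h3 f g h hA hB
    have hG := D.measurable_genFun g h
    -- The martingale of the restarted process is the increment from `s` to `s + t` of the original
    -- martingale.
    have hIncr : ∀ t ω, f ((Z.shift s).Y t ω) - f ((Z.shift s).Y 0 ω)
        - (Z.shift s).drift (D.genFun g h) t ω =
        (f (Z.Y (s + t) ω) - f (Z.Y 0 ω) - Z.drift (D.genFun g h) (s + t) ω) -
        (f (Z.Y s ω) - f (Z.Y 0 ω) - Z.drift (D.genFun g h) s ω) := fun t ω => by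
      rw [Z.drift_shift hG hC, ProcessTriple.Y_shift, ProcessTriple.Y_shift, add_zero]
      ring
    refine martingale_of_setIntegral_sub_eq_zero (fun t => ?_) (fun t => ?_)
      fun r t hrt A hA' => ?_
    · refine StronglyMeasurable.sub (StronglyMeasurable.sub ?_ ?_)
        ((Z.shift s).stronglyMeasurable_drift hG t)
      · exact (f.continuous.measurable.comp
          ((Z.shift s).measurable_Y_filtration le_rfl)).stronglyMeasurable
      · exact (f.continuous.measurable.comp
          ((Z.shift s).measurable_Y_filtration (zero_le))).stronglyMeasurable
    · simp_rw [hIncr]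
      rw [integrable_withDensity_iff_integrable_smul hρ']
      simp_rw [NNReal.smul_def, smul_eq_mul]
      refine ((hM.integrable (s + t)).sub (hM.integrable s)).bdd_mul (c := c)
        hρ'.coe_nnreal_real.aestronglyMeasurable (Eventually.of_forall fun ω => ?_)
      simpa using hc ω
    · have hA2 : MeasurableSet[Z.filtration (s + r)] A := Z.filtration_shift_le s r A hA'
      have hA3 : MeasurableSet A := Z.filtration.le _ A hA2
      -- The density is already known at time `s`, so multiplying it by the indicator of `A` gives a
      -- bounded function of the past, orthogonal to the increment over `(s + r, s + t]`.
      have hF : StronglyMeasurable[Z.filtration (s + r)]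
          (A.indicator fun ω => (ρ ω : ℝ)) := by
        refine StronglyMeasurable.indicator (Measurable.stronglyMeasurable ?_) hA2
        exact (hρ.mono (Z.filtration.mono (by simp)) le_rfl).coe_nnreal_real
      have key := integral_sub_mul_eq_zero_of_martingale hM (s := s + r) (t := s + t)
        (add_le_add_right hrt s) hF (C := c) (fun ω => by
          by_cases hω : ω ∈ A
          · rw [Set.indicator_of_mem hω]
            simpa using hc ω
          · rw [Set.indicator_of_notMem hω]
            simp)
      rw [setIntegral_withDensity_eq_setIntegral_smul hρ' _ hA3, ← integral_indicator hA3, ← key]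
      refine integral_congr_ae (Eventually.of_forall fun ω => ?_)
      by_cases hω : ω ∈ A
      · simp only [Set.indicator_of_mem hω, hIncr, NNReal.smul_def, smul_eq_mul]
        ring
      · simp [Set.indicator_of_notMem hω]

theorem isControlledSolution_shift_self {D : ControlledData E 𝒰} {P : Measure Ω}
    [IsProbabilityMeasure P] {Z : ProcessTriple Ω E 𝒰} (hZ : IsControlledSolution D P Z)
    (s : ℝ≥0) : IsControlledSolution D P (Z.shift s) := by
  have := isControlledSolution_shift hZ s (ρ := fun _ => 1) measurable_const (c := 1)
    (fun _ => le_rfl)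
  simpa using this

/-- Almost surely, the process restarted at any rational `q` has positive `λ₀` at all positive
times. Given `a < b`, a rational `q` between them makes `λ₀` increase strictly on `[q, b]`. -/
theorem strictMono_lam_of_pos {D : ControlledData E 𝒰}
    (hpos : ForEachSolution D fun P Z => ∀ᵐ ω ∂P, ∀ t : ℝ≥0, 0 < t → 0 < Z.lam t ω) :
    ForEachSolution D fun P Z => ∀ᵐ ω ∂P, StrictMono (fun t => Z.lam t ω) := by
  intro Ω _ P _ Z hZ
  have h : ∀ᵐ ω ∂P, ∀ q : ℚ≥0, ∀ t : ℝ≥0, 0 < t → 0 < (Z.shift q).lam t ω :=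
    ae_all_iff.2 fun q => hpos Ω P (Z.shift q) (isControlledSolution_shift_self hZ q)
  filter_upwards [h] with ω hω a b hab
  obtain ⟨q, hq1, hq2⟩ : ∃ q : ℚ≥0, a < (q : ℝ≥0) ∧ (q : ℝ≥0) < b := by
    obtain ⟨n, hn⟩ := ((tendsto_gridSucc a).eventually (Ioo_mem_nhdsGT hab)).exists
    exact ⟨_, hn.1, hn.2⟩
  have h1 : Z.lam a ω ≤ Z.lam q ω := Z.mono_lam ω hq1.le
  have h2 := Z.lam_shift q (b - q) ω
  rw [add_tsub_cancel_of_le hq2.le] at h2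
  have h3 := hω q (b - q) (tsub_pos_of_lt hq2)
  show Z.lam a ω < Z.lam b ω
  rw [h2]
  exact h1.trans_lt (lt_add_of_pos_right _ h3)

/-- A uniform bound on `𝔼[exp (-λ₀(1))]` iterates. -/
theorem integral_exp_lam_le {D : ControlledData E 𝒰} {ρ : ℝ}
    (hρ : ForEachSolution D fun P Z => ∫ ω, Real.exp (-(Z.lam 1 ω : ℝ)) ∂P ≤ ρ) (n : ℕ) :
    ForEachSolution D fun P Z => ∫ ω, Real.exp (-(Z.lam n ω : ℝ)) ∂P ≤ ρ ^ n := by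
  intro Ω _ P _ Z hZ
  have hm : ∀ t, Measurable fun ω => Real.exp (-(Z.lam t ω : ℝ)) := fun t =>
    ((Z.measurable_lam t).coe_nnreal_real.neg).exp
  have hle : ∀ t ω, Real.exp (-(Z.lam t ω : ℝ)) ≤ 1 := fun t ω => by
    rw [Real.exp_le_one_iff]
    simp
  have hI : ∀ t, Integrable (fun ω => Real.exp (-(Z.lam t ω : ℝ))) P := fun t =>
    Integrable.of_bound (hm t).aestronglyMeasurable 1 (Eventually.of_forall fun ω => by
      rw [Real.norm_eq_abs, Real.abs_exp]
      exact hle t ω)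
  have hρ0 : 0 ≤ ρ := (integral_nonneg fun ω => (Real.exp_pos _).le).trans (hρ Ω P Z hZ)
  induction n with
  | zero =>
    calc ∫ ω, Real.exp (-(Z.lam ((0 : ℕ) : ℝ≥0) ω : ℝ)) ∂P ≤ ∫ _, (1 : ℝ) ∂P :=
          integral_mono (hI _) (integrable_const _) fun ω => hle _ ω
      _ = ρ ^ 0 := by simp
  | succ n ih =>
    set c : ℝ := ∫ ω, Real.exp (-(Z.lam (n : ℝ≥0) ω : ℝ)) ∂P with hc
    have hc0 : 0 < c := integral_exp_pos (hI n)
    -- With this `ℱ n`-measurable probability density the process restarted at `n` is a solution, so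
    -- the bound applies to it. By additivity of `λ₀` the bound then reads `𝔼[exp (-λ₀(n + 1))] / c
    -- ≤ ρ`.
    let d : Ω → ℝ≥0 := fun ω => (Real.exp (-(Z.lam (n : ℝ≥0) ω : ℝ)) / c).toNNReal
    have hd : ∀ ω, (d ω : ℝ) = Real.exp (-(Z.lam (n : ℝ≥0) ω : ℝ)) / c := fun ω =>
      Real.coe_toNNReal _ (by positivity)
    have hdm : Measurable[Z.filtration n] d :=
      ((((Z.measurable_lam_filtration le_rfl).coe_nnreal_real.neg).exp).div_const c).real_toNNReal
    have hdm' : Measurable d := hdm.mono (Z.filtration.le _) le_rfl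
    have hdb : ∀ ω, d ω ≤ (1 / c).toNNReal := fun ω =>
      Real.toNNReal_le_toNNReal (by gcongr; exact hle n ω)
    have hsol := isControlledSolution_shift hZ n hdm hdb
    have hprob : IsProbabilityMeasure (P.withDensity fun ω => (d ω : ℝ≥0∞)) := by
      refine ⟨?_⟩
      rw [withDensity_apply _ MeasurableSet.univ, Measure.restrict_univ,
        lintegral_coe_eq_integral d (by simp_rw [hd]; exact (hI n).div_const c)]
      simp_rw [hd]
      rw [integral_div, ← hc, div_self hc0.ne', ENNReal.ofReal_one]
    have h1 : ∫ ω, Real.exp (-((Z.shift n).lam 1 ω : ℝ)) ∂(P.withDensity fun ω => (d ω : ℝ≥0∞)) ≤ ρ :=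
      hρ Ω _ (Z.shift n) hsol
    rw [integral_withDensity_eq_integral_smul hdm'] at h1
    have h2 : ∫ ω, d ω • Real.exp (-((Z.shift n).lam 1 ω : ℝ)) ∂P =
        (∫ ω, Real.exp (-(Z.lam ((n + 1 : ℕ) : ℝ≥0) ω : ℝ)) ∂P) / c := by
      rw [← integral_div]
      refine integral_congr_ae (Eventually.of_forall fun ω => ?_)
      simp only [NNReal.smul_def, smul_eq_mul, hd]
      rw [Nat.cast_succ, Z.lam_shift, NNReal.coe_add, neg_add, Real.exp_add]
      ring
    rw [h2, div_le_iff₀ hc0] at h1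
    calc _ ≤ ρ * c := h1
      _ ≤ ρ * ρ ^ n := by gcongr
      _ = ρ ^ (n + 1) := by ring

end ShiftSolution

/-! ### Exit times under a change of time. -/

section TimeChange

theorem invTime_top (l : ℝ≥0 → ℝ≥0) : invTime l ∞ = ∞ := by
  simp [invTime]

/-- An order isomorphism carries left neighbourhoods to left neighbourhoods. Nothing is assumed
about existence of the limit: the default cases in the definition of `Function.leftLim` correspond
as well. -/
theorem leftLim_comp_orderIso {α β : Type*} [LinearOrder α] [TopologicalSpace β] (y : α → β)
    (e : α ≃o α) (t : α) :
    Function.leftLim (fun s => y (e s)) t = Function.leftLim y (e t) := by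
  -- `Function.leftLim` is defined with the order topology on the domain.
  let _ : TopologicalSpace α := Preorder.topology α
  have : OrderTopology α := ⟨rfl⟩
  have hmap : map e (𝓝[<] t) = 𝓝[<] (e t) := by
    have h := e.toHomeomorph.isEmbedding.map_nhdsWithin_eq (Set.Iio t) t
    have h2 : e '' Set.Iio t = Set.Iio (e t) := OrderIso.image_Iio e t
    rw [← h2]
    exact h
  have hT : ∀ z, Tendsto (fun s => y (e s)) (𝓝[<] t) (𝓝 z) ↔ Tendsto y (𝓝[<] (e t)) (𝓝 z) :=
    fun z => by rw [← hmap, tendsto_map'_iff]; rfl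
  have hbot : 𝓝[<] t = ⊥ ↔ 𝓝[<] (e t) = ⊥ := by rw [← hmap, map_eq_bot_iff]
  have hlim : map (fun s => y (e s)) (𝓝[<] t) = map y (𝓝[<] (e t)) := by
    rw [← hmap, map_map]
    rfl
  unfold Function.leftLim
  simp only [limUnder, hlim]
  have hiff := or_congr hbot (not_congr (exists_congr hT))
  by_cases h : 𝓝[<] t = ⊥ ∨ ¬∃ z, Tendsto (fun s => y (e s)) (𝓝[<] t) (𝓝 z)
  · rw [if_pos h, if_pos (hiff.1 h)]
  · rw [if_neg h, if_neg (fun h' => h (hiff.2 h'))]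

/-- Here `l` is an order isomorphism of `[0, ∞)` and `invTime l` is its inverse, extended by `∞ ↦
∞`. Order isomorphisms commute with infima, so both sides are the same infimum, reindexed. -/
theorem invTime_exitTime {E : Type u} [TopologicalSpace E] {l : ℝ≥0 → ℝ≥0} (hs : StrictMono l)
    (hc : Continuous l) (h0 : l 0 = 0) (htop : Tendsto l atTop atTop) (y : ℝ≥0 → E) (U : Set E) :
    invTime l (exitTime U fun t => valueAt y (invTime l t)) = exitTime U y := by
  have hsurj : Function.Surjective l := fun b =>
    mem_range_of_exists_le_of_exists_ge hc ⟨0, by simp [h0]⟩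
      (htop.eventually_ge_atTop b).exists
  let e₀ : ℝ≥0 ≃o ℝ≥0 := hs.orderIsoOfSurjective l hsurj
  let e : ℝ≥0 ≃o ℝ≥0 := e₀.symm
  have he : ∀ t s, t < l s ↔ e t < s := fun t s => by
    have h : e₀ (e t) < e₀ s ↔ e t < s := e₀.lt_iff_lt
    rwa [show e₀ (e t) = t from e₀.apply_symm_apply t] at h
  have hinv : ∀ t : ℝ≥0, invTime l t = e t := fun t => by
    refine le_antisymm (le_of_forall_gt_imp_ge_of_dense fun a ha => ?_)
      (le_iInf₂ fun s hst => ?_)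
    · obtain ⟨r, hr1, hr2⟩ := ENNReal.lt_iff_exists_nnreal_btwn.1 ha
      refine (iInf₂_le r ?_).trans hr2.le
      exact ENNReal.coe_lt_coe.2 ((he t r).2 (ENNReal.coe_lt_coe.1 hr1))
    · exact ENNReal.coe_le_coe.2 ((he t s).1 (ENNReal.coe_lt_coe.1 hst)).le
  let e' : ℝ≥0∞ ≃o ℝ≥0∞ := e.withTopCongr
  have hinv' : ∀ t, invTime l t = e' t := fun t => by
    induction t using ENNReal.recTopCoe with
    | top => rw [invTime_top]; rfl
    | coe t => rw [hinv]; rfl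
  have hX : (fun t : ℝ≥0 => valueAt y (invTime l t)) = fun t => y (e t) := by
    funext t
    simp [hinv, valueAt]
  rw [hX, hinv', exitTime, exitTime, OrderIso.map_iInf]
  simp_rw [OrderIso.map_iInf]
  rw [← e.toEquiv.iInf_comp (g := fun t => ⨅ _ : y t ∉ U ∨ Function.leftLim y t ∉ U, (t : ℝ≥0∞))]
  refine iInf_congr fun t => ?_
  rw [leftLim_comp_orderIso]
  rfl

end TimeChange

/-! ### From the uniform bound to the localization condition. -/

section Localization

variable {E : Type u} {𝒰 : Type v}
  [MetricSpace E] [CompactSpace E] [MeasurableSpace E] [BorelSpace E]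
  [MetricSpace 𝒰] [CompactSpace 𝒰] [MeasurableSpace 𝒰] [BorelSpace 𝒰]

/-- Two nondecreasing functions with sum `t` are both 1-Lipschitz. -/
theorem continuous_lam_of_lam_add {Ω : Type*} [MeasurableSpace Ω] {Z : ProcessTriple Ω E 𝒰} {ω : Ω}
    (h : ∀ t : ℝ≥0, (Z.lam t ω : ℝ≥0∞) + Z.Lam ω (Set.Iic t ×ˢ Set.univ) = t) :
    Continuous fun t => Z.lam t ω := by
  have hle : ∀ s t, s ≤ t → Z.lam t ω ≤ Z.lam s ω + (t - s) := fun s t hst => by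
    have h1 : (Z.lam t ω : ℝ≥0∞) + Z.Lam ω (Set.Iic s ×ˢ Set.univ) ≤ t := by
      rw [← h t]
      gcongr
    have h2 : (t : ℝ≥0∞) = s + (t - s : ℝ≥0) := by
      rw [← ENNReal.coe_add, add_tsub_cancel_of_le hst]
    rw [h2, ← h s, add_right_comm] at h1
    have h3 := (ENNReal.add_le_add_iff_right (Z.finite_Lam ω s).ne).1 h1
    exact_mod_cast h3
  have hL : LipschitzWith 1 fun t => Z.lam t ω := by
    refine LipschitzWith.of_dist_le_mul fun a b => ?_
    wlog hab : a ≤ b generalizing a b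
    · rw [dist_comm, dist_comm a]
      exact this b a (le_of_not_ge hab)
    have h1 := hle a b hab
    have h2 : Z.lam a ω ≤ Z.lam b ω := Z.mono_lam ω hab
    rw [NNReal.dist_eq, NNReal.dist_eq, abs_sub_comm, abs_sub_comm (a : ℝ),
      abs_of_nonneg (sub_nonneg.2 (NNReal.coe_le_coe.2 h2)),
      abs_of_nonneg (sub_nonneg.2 (NNReal.coe_le_coe.2 hab))]
    have h3 : (Z.lam b ω : ℝ) ≤ Z.lam a ω + (b - a) := by
      rw [← NNReal.coe_sub hab]
      exact_mod_cast h1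
    simp only [NNReal.coe_one, one_mul]
    linarith
  exact hL.continuous

theorem lam_zero_of_lam_add {Ω : Type*} [MeasurableSpace Ω] {Z : ProcessTriple Ω E 𝒰} {ω : Ω}
    (h : ∀ t : ℝ≥0, (Z.lam t ω : ℝ≥0∞) + Z.Lam ω (Set.Iic t ×ˢ Set.univ) = t) :
    Z.lam 0 ω = 0 := by
  have := h 0
  simp only [ENNReal.coe_zero, add_eq_zero, ENNReal.coe_eq_zero] at this
  exact this.1

/-- Markov's inequality for `exp (-λ₀(n))` at level `exp (-a)`. -/
theorem measure_lam_le {D : ControlledData E 𝒰} {ρ : ℝ}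
    (hρ : ForEachSolution D fun P Z => ∫ ω, Real.exp (-(Z.lam 1 ω : ℝ)) ∂P ≤ ρ)
    (n : ℕ) (a : ℝ) :
    ForEachSolution D fun P Z =>
      P {ω | (Z.lam n ω : ℝ) ≤ a} ≤ ENNReal.ofReal (Real.exp a * ρ ^ n) := by
  intro Ω _ P _ Z hZ
  have hm : Measurable fun ω => Real.exp (-(Z.lam n ω : ℝ)) :=
    ((Z.measurable_lam n).coe_nnreal_real.neg).exp
  have hI : Integrable (fun ω => Real.exp (-(Z.lam n ω : ℝ))) P :=
    Integrable.of_bound hm.aestronglyMeasurable 1 (Eventually.of_forall fun ω => by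
      rw [Real.norm_eq_abs, Real.abs_exp, Real.exp_le_one_iff]
      simp)
  have h1 : ∫ ω, Real.exp (-(Z.lam n ω : ℝ)) ∂P ≤ ρ ^ n := integral_exp_lam_le hρ n Ω P Z hZ
  have h2 := mul_meas_ge_le_integral_of_nonneg (μ := P)
    (f := fun ω => Real.exp (-(Z.lam n ω : ℝ)))
    (Eventually.of_forall fun ω => (Real.exp_pos _).le) hI (Real.exp (-a))
  have h3 : {ω | (Z.lam n ω : ℝ) ≤ a} = {ω | Real.exp (-a) ≤ Real.exp (-(Z.lam n ω : ℝ))} := by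
    ext ω
    simp
  rw [h3, ENNReal.le_ofReal_iff_toReal_le (measure_ne_top _ _)
    (mul_nonneg (Real.exp_pos _).le ((integral_nonneg fun ω => (Real.exp_pos _).le).trans h1))]
  change P.real _ ≤ _
  have h4 : P.real {ω | Real.exp (-a) ≤ Real.exp (-(Z.lam n ω : ℝ))} =
      Real.exp a * (Real.exp (-a) * P.real {ω | Real.exp (-a) ≤ Real.exp (-(Z.lam n ω : ℝ))}) := by
    rw [← mul_assoc, ← Real.exp_add]
    simp
  rw [h4]
  gcongr
  exact h2.trans h1

theorem tendsto_lam_of_bound {D : ControlledData E 𝒰} {ρ : ℝ} (hρ1 : ρ < 1)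
    (hρ : ForEachSolution D fun P Z => ∫ ω, Real.exp (-(Z.lam 1 ω : ℝ)) ∂P ≤ ρ) :
    ForEachSolution D fun P Z => ∀ᵐ ω ∂P, Tendsto (fun t => Z.lam t ω) atTop atTop := by
  intro Ω _ P _ Z hZ
  have hρ0 : 0 ≤ ρ := (integral_nonneg fun ω => (Real.exp_pos _).le).trans (hρ Ω P Z hZ)
  have h : ∀ᵐ ω ∂P, ∀ k : ℕ, ∃ n : ℕ, (k : ℝ) < Z.lam n ω := by
    refine ae_all_iff.2 fun k => ?_
    have h1 : ∀ n : ℕ, P {ω | ¬∃ n : ℕ, (k : ℝ) < Z.lam n ω} ≤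
        ENNReal.ofReal (Real.exp k * ρ ^ n) := fun n =>
      (measure_mono fun ω (hω : ¬∃ n : ℕ, (k : ℝ) < Z.lam n ω) =>
        not_lt.1 fun h => hω ⟨n, h⟩).trans
        (measure_lam_le hρ n k Ω P Z hZ)
    have h2 : Tendsto (fun n : ℕ => ENNReal.ofReal (Real.exp k * ρ ^ n)) atTop (𝓝 0) := by
      rw [← ENNReal.ofReal_zero, ← mul_zero (Real.exp k)]
      exact ENNReal.tendsto_ofReal ((tendsto_pow_atTop_nhds_zero_of_lt_one hρ0 hρ1).const_mul _)
    exact le_antisymm (ge_of_tendsto' h2 h1) (zero_le)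
  filter_upwards [h] with ω hω
  refine tendsto_atTop_atTop_of_monotone (Z.mono_lam ω) fun b => ?_
  obtain ⟨k, hk⟩ := exists_nat_ge b
  obtain ⟨n, hn⟩ := hω k
  exact ⟨n, hk.trans (by exact_mod_cast hn.le)⟩

/-- `λ₀⁻¹(a)` is at most the number of integers `n ≥ 0` with `λ₀(n) ≤ a`. The expectation of this
count is dominated by a geometric series. -/
theorem lintegral_invLam_lt_top {D : ControlledData E 𝒰} {ρ : ℝ} (hρ1 : ρ < 1)
    (hρ : ForEachSolution D fun P Z => ∫ ω, Real.exp (-(Z.lam 1 ω : ℝ)) ∂P ≤ ρ) (a : ℝ≥0) :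
    ForEachSolution D fun P Z => ∫⁻ ω, Z.invLam a ω ∂P < ∞ := by
  intro Ω _ P _ Z hZ
  have hρ0 : 0 ≤ ρ := (integral_nonneg fun ω => (Real.exp_pos _).le).trans (hρ Ω P Z hZ)
  have hm : ∀ n : ℕ, MeasurableSet {ω | (Z.lam n ω : ℝ) ≤ a} := fun n =>
    measurableSet_le (Z.measurable_lam n).coe_nnreal_real measurable_const
  have h1 : ∀ ω, Z.invLam a ω ≤ ∑' n : ℕ, {ω | (Z.lam n ω : ℝ) ≤ a}.indicator 1 ω := fun ω => by
    by_contra! hlt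
    set S := ∑' n : ℕ, {ω | (Z.lam n ω : ℝ) ≤ a}.indicator (1 : Ω → ℝ≥0∞) ω with hS
    have hSt : S ≠ ∞ := hlt.ne_top
    obtain ⟨r, hr⟩ : ∃ r : ℝ≥0, (r : ℝ≥0∞) = S := ⟨S.toNNReal, ENNReal.coe_toNNReal hSt⟩
    -- If `λ₀⁻¹(a)` exceeded the count `S = r`, all integers `n ≤ ⌊r⌋` would be counted, giving `S ≥
    -- ⌊r⌋ + 1 > r`.
    have h2 : ∀ n ∈ Finset.range (⌊r⌋₊ + 1),
        {ω | (Z.lam n ω : ℝ) ≤ a}.indicator (1 : Ω → ℝ≥0∞) ω = 1 := fun n hn => by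
      refine Set.indicator_of_mem ?_ _
      rw [Set.mem_ofPred_eq]
      by_contra! h
      have h3 : Z.invLam a ω ≤ ((n : ℝ≥0) : ℝ≥0∞) :=
        iInf₂_le (n : ℝ≥0) (ENNReal.coe_lt_coe.2 (by exact_mod_cast h))
      have h4 : ((n : ℝ≥0) : ℝ≥0∞) ≤ S := by
        rw [← hr, ENNReal.coe_le_coe]
        exact (Nat.cast_le.2 (Nat.lt_succ_iff.1 (Finset.mem_range.1 hn))).trans
          (Nat.floor_le (zero_le))
      exact absurd (hlt.trans_le (h3.trans h4)) (lt_irrefl _)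
    have h5 := ENNReal.sum_le_tsum (f := fun n : ℕ =>
      {ω | (Z.lam n ω : ℝ) ≤ a}.indicator (1 : Ω → ℝ≥0∞) ω) (Finset.range (⌊r⌋₊ + 1))
    rw [Finset.sum_congr rfl h2, ← hS, ← hr] at h5
    simp only [Finset.sum_const, Finset.card_range, nsmul_eq_mul, mul_one] at h5
    have h6 : ((⌊r⌋₊ + 1 : ℕ) : ℝ≥0) ≤ r := by exact_mod_cast h5
    push_cast at h6
    exact absurd (h6.trans_lt (Nat.lt_floor_add_one r)) (lt_irrefl _)
  have hs : Summable fun n : ℕ => Real.exp a * ρ ^ n :=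
    (summable_geometric_of_lt_one hρ0 hρ1).mul_left _
  calc ∫⁻ ω, Z.invLam a ω ∂P
      ≤ ∫⁻ ω, ∑' n : ℕ, {ω | (Z.lam n ω : ℝ) ≤ a}.indicator 1 ω ∂P := lintegral_mono h1
    _ = ∑' n : ℕ, P {ω | (Z.lam n ω : ℝ) ≤ a} := by
      rw [lintegral_tsum fun n => (measurable_one.indicator (hm n)).aemeasurable]
      simp_rw [fun n => lintegral_indicator_one (μ := P) (hm n)]
    _ ≤ ∑' n : ℕ, ENNReal.ofReal (Real.exp a * ρ ^ n) :=
      ENNReal.tsum_le_tsum fun n => measure_lam_le hρ n a Ω P Z hZ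
    _ = ENNReal.ofReal (∑' n : ℕ, Real.exp a * ρ ^ n) :=
      (ENNReal.ofReal_tsum_of_nonneg (fun n => by positivity) hs).symm
    _ < ∞ := ENNReal.ofReal_lt_top

theorem localizationCondition_of_bound {D : ControlledData E 𝒰} (hex : HasSolutions D) {ρ : ℝ}
    (hρ1 : ρ < 1)
    (hρ : ForEachSolution D fun P Z => ∫ ω, Real.exp (-(Z.lam 1 ω : ℝ)) ∂P ≤ ρ)
    (hmono : ForEachSolution D fun P Z => ∀ᵐ ω ∂P, StrictMono (fun t => Z.lam t ω)) (U : Set E) :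
    LocalizationCondition D U where
  hasSolutions := hex
  tendsto_lam := tendsto_lam_of_bound hρ1 hρ
  exists_stopping := fun Ω _ P _ Z hZ => by
    -- Deterministic times suffice, because `λ₀⁻¹` has finite mean at every fixed level.
    refine ⟨fun n _ => (n : ℝ≥0), fun n => isStoppingTime_const _ (n : ℝ≥0), ?_, fun n => ?_⟩
    · refine Eventually.of_forall fun ω => ?_
      simpa using ENNReal.tendsto_nat_nhds_top
    · exact lintegral_invLam_lt_top hρ1 hρ n Ω P Z hZ
  exit_eq := fun Ω _ P _ Z hZ => by
    filter_upwards [hmono Ω P Z hZ, tendsto_lam_of_bound hρ1 hρ Ω P Z hZ, hZ.lam_add]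
      with ω h1 h2 h3
    exact invTime_exitTime h1 (continuous_lam_of_lam_add h3) (lam_zero_of_lam_add h3) h2 _ U

end Localization

/-! ### Lebesgue measure on `[0, ∞)` and an equivalent probability measure. -/

section TimeWeight

/-- Lebesgue measure on `[0, ∞)`. -/
def leb : Measure ℝ≥0 := pathMeasure id monotone_id fun _ => continuousWithinAt_id

theorem leb_Iic (t : ℝ≥0) : leb (Set.Iic t) = t := pathMeasure_Iic _ _ _ t

theorem leb_Ioc {s t : ℝ≥0} (h : s ≤ t) : leb (Set.Ioc s t) = (t - s : ℝ≥0) := by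
  have h1 : Set.Ioc s t = Set.Iic t \ Set.Iic s := by
    ext x
    simp [and_comm]
  rw [h1, measure_sdiff (Set.Iic_subset_Iic.2 h) measurableSet_Iic.nullMeasurableSet
    (by rw [leb_Iic]; exact ENNReal.coe_ne_top), leb_Iic, leb_Iic, ENNReal.coe_sub]

instance : SigmaFinite leb := by
  refine ⟨⟨⟨fun n : ℕ => Set.Iic (n : ℝ≥0), fun _ => trivial, fun n => ?_, ?_⟩⟩⟩
  · rw [leb_Iic]
    exact ENNReal.coe_lt_top
  · refine Set.eq_univ_of_forall fun x => ?_
    obtain ⟨n, hn⟩ := exists_nat_ge x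
    exact Set.mem_iUnion.2 ⟨n, hn⟩

/-- Strict positivity makes the weighting reversible: measures with Lebesgue time marginal
correspond to probability measures with one fixed time marginal, without loss of information. -/
theorem exists_timeWeight : ∃ w : ℝ≥0 → ℝ≥0, (∀ s, 0 < w s) ∧ Measurable w ∧
    ∫⁻ s, w s ∂leb = 1 := by
  obtain ⟨g, hg, hgm, hgi⟩ := exists_pos_lintegral_lt_of_sigmaFinite leb one_ne_zero
  have h0 : ∫⁻ s, g s ∂leb ≠ 0 := by
    rw [Ne, lintegral_eq_zero_iff hgm.coe_nnreal_ennreal]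
    intro h
    have h1 : leb Set.univ = 0 := by
      refine measure_mono_null (fun s _ => ?_) h
      simpa using (hg s).ne'
    have h2 : leb (Set.Iic 1) = 0 := measure_mono_null (Set.subset_univ _) h1
    rw [leb_Iic] at h2
    simp at h2
  set c := (∫⁻ s, g s ∂leb).toNNReal with hc
  have hcc : (c : ℝ≥0∞) = ∫⁻ s, g s ∂leb := ENNReal.coe_toNNReal hgi.ne_top
  have hc0 : c ≠ 0 := fun h => h0 (by rw [← hcc, h, ENNReal.coe_zero])
  refine ⟨fun s => g s * c⁻¹, fun s => mul_pos (hg s) (by positivity), hgm.mul_const _, ?_⟩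
  simp_rw [ENNReal.coe_mul]
  rw [lintegral_mul_const _ hgm.coe_nnreal_ennreal, ← hcc, ← ENNReal.coe_mul, mul_inv_cancel₀ hc0,
    ENNReal.coe_one]

/-- A strictly positive probability density on `[0, ∞)`. -/
def timeWeight : ℝ≥0 → ℝ≥0 := exists_timeWeight.choose

theorem timeWeight_pos (s : ℝ≥0) : 0 < timeWeight s := exists_timeWeight.choose_spec.1 s

theorem measurable_timeWeight : Measurable timeWeight := exists_timeWeight.choose_spec.2.1

theorem lintegral_timeWeight : ∫⁻ s, timeWeight s ∂leb = 1 := exists_timeWeight.choose_spec.2.2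

/-- The probability measure on `[0, ∞)` with density `timeWeight`. -/
def timeLaw : Measure ℝ≥0 := leb.withDensity fun s => timeWeight s

instance : IsProbabilityMeasure timeLaw := by
  refine ⟨?_⟩
  rw [timeLaw, withDensity_apply _ MeasurableSet.univ, Measure.restrict_univ, lintegral_timeWeight]

theorem withDensity_timeWeight_inv_cancel {K : Type*} [MeasurableSpace K]
    (N : Measure (ℝ≥0 × K)) :
    (N.withDensity fun p => (timeWeight p.1 : ℝ≥0∞)).withDensity
      (fun p => (timeWeight p.1 : ℝ≥0∞)⁻¹) = N := by
  have hm : Measurable fun p : ℝ≥0 × K => (timeWeight p.1 : ℝ≥0∞) :=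
    (measurable_timeWeight.comp measurable_fst).coe_nnreal_ennreal
  refine (withDensity_mul N hm hm.inv).symm.trans ?_
  convert withDensity_one using 2
  funext p
  exact ENNReal.mul_inv_cancel (ENNReal.coe_ne_zero.2 (timeWeight_pos p.1).ne') ENNReal.coe_ne_top

theorem map_fst_withDensity {K : Type*} [MeasurableSpace K] (N : Measure (ℝ≥0 × K))
    {g : ℝ≥0 → ℝ≥0∞} (hg : Measurable g) :
    (N.withDensity fun p => g p.1).map Prod.fst = (N.map Prod.fst).withDensity g := by
  ext S hS
  rw [Measure.map_apply measurable_fst hS, withDensity_apply _ (measurable_fst hS),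
    withDensity_apply _ hS, setLIntegral_map hS hg measurable_fst]

theorem withDensity_inv_timeLaw :
    timeLaw.withDensity (fun s => (timeWeight s : ℝ≥0∞)⁻¹) = leb := by
  have hm : Measurable fun p : ℝ≥0 => (timeWeight p : ℝ≥0∞) :=
    measurable_timeWeight.coe_nnreal_ennreal
  refine (withDensity_mul leb hm hm.inv).symm.trans ?_
  convert withDensity_one using 2
  funext p
  exact ENNReal.mul_inv_cancel (ENNReal.coe_ne_zero.2 (timeWeight_pos p).ne') ENNReal.coe_ne_top

end TimeWeight

/-! ### The Borel σ-algebra of the weak topology. -/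

section BorelProbability

theorem ProbabilityMeasure.topology_eq_iInf {X : Type*} [TopologicalSpace X] [MeasurableSpace X]
    [OpensMeasurableSpace X] : (inferInstance : TopologicalSpace (ProbabilityMeasure X)) =
      ⨅ f : BoundedContinuousFunction X ℝ≥0, TopologicalSpace.induced
        (fun μ : ProbabilityMeasure X => ∫⁻ x, f x ∂(μ : Measure X)) inferInstance := by
  refine le_antisymm (le_iInf fun f => continuous_iff_le_induced.1
    (ProbabilityMeasure.continuous_lintegral_boundedContinuousFunction f)) ?_
  rw [← continuous_id_iff_le]
  refine (@ProbabilityMeasure.continuous_iff_forall_continuous_lintegral X _ _ _ _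
    (⨅ f : BoundedContinuousFunction X ℝ≥0, TopologicalSpace.induced
        (fun μ : ProbabilityMeasure X => ∫⁻ x, f x ∂(μ : Measure X)) inferInstance) id).2 fun f => ?_
  exact continuous_iff_le_induced.2 (iInf_le _ f)

/-- Integrals of bounded continuous functions determine the evaluations on Borel sets, which gives
one inclusion. Preimages of open sets under these integrals form a subbasis, and second countability
lets a subbasis generate the Borel σ-algebra, which gives the other. -/
theorem borelSpace_of_isInducing_probabilityMeasure {T X : Type*} [TopologicalSpace T]
    [SecondCountableTopology T] [TopologicalSpace X] [MeasurableSpace X] [BorelSpace X]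
    [HasOuterApproxClosed X] {j : T → ProbabilityMeasure X} (hj : IsInducing j) :
    @BorelSpace T _ (MeasurableSpace.comap j inferInstance) := by
  refine @BorelSpace.mk T _ (MeasurableSpace.comap j inferInstance) (le_antisymm ?_ ?_)
  · rw [← measurable_iff_comap_le]
    let _ : MeasurableSpace T := borel T
    have : BorelSpace T := ⟨rfl⟩
    refine Measurable.subtype_mk ?_
    refine measurable_measure_of_lintegral (μ := fun ω => (j ω : Measure X))
      (fun ω => by have := (j ω).2; infer_instance) fun g => ?_
    exact ((ProbabilityMeasure.continuous_lintegral_boundedContinuousFunction g).comp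
      hj.continuous).measurable
  · have ht : (inferInstance : TopologicalSpace T) = TopologicalSpace.generateFrom
        (⋃ f : BoundedContinuousFunction X ℝ≥0, {s | IsOpen[TopologicalSpace.induced
          (fun t => ∫⁻ x, f x ∂(j t : Measure X)) inferInstance] s}) := by
      refine Eq.trans ?_ (generateFrom_iUnion_isOpen
        (fun f : BoundedContinuousFunction X ℝ≥0 => TopologicalSpace.induced
          (fun t => ∫⁻ x, f x ∂(j t : Measure X)) inferInstance)).symm
      refine hj.eq_induced.trans ?_
      refine (congrArg (TopologicalSpace.induced j) ProbabilityMeasure.topology_eq_iInf).trans ?_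
      rw [induced_iInf]
      simp_rw [induced_compose]
      rfl
    rw [borel_eq_generateFrom_of_subbasis ht]
    refine MeasurableSpace.generateFrom_le fun s hs => ?_
    obtain ⟨f, hf⟩ := Set.mem_iUnion.1 hs
    obtain ⟨O, hO, rfl⟩ := isOpen_induced_iff.1 hf
    have h1 : Measurable fun μ : ProbabilityMeasure X => ∫⁻ x, f x ∂(μ : Measure X) :=
      (Measure.measurable_lintegral f.continuous.measurable.coe_nnreal_ennreal).comp
        measurable_subtype_coe
    exact ⟨_, h1 hO.measurableSet, rfl⟩

end BorelProbability

/-! ### The compact metrizable space of occupation measures. -/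

section OccMeasure
open TopologicalSpace

variable {K : Type w} [TopologicalSpace K] [MeasurableSpace K]

variable (K) in
/-- Probability measures on `[0, ∞) × K` with time marginal `timeLaw`. -/
def OccMeasure : Type w :=
  {m : ProbabilityMeasure (ℝ≥0 × K) // (m : Measure (ℝ≥0 × K)).map Prod.fst = timeLaw}

namespace OccMeasure

/-- The underlying element of `ProbabilityMeasure`. -/
def toProb (m : OccMeasure K) : ProbabilityMeasure (ℝ≥0 × K) := m.1

theorem range_toProb : Set.range (toProb (K := K)) =
    {m : ProbabilityMeasure (ℝ≥0 × K) | (m : Measure (ℝ≥0 × K)).map Prod.fst = timeLaw} :=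
  Subtype.range_val

/-- The underlying probability measure. -/
def toMeasure (m : OccMeasure K) : Measure (ℝ≥0 × K) := (m.1 : Measure (ℝ≥0 × K))

instance (m : OccMeasure K) : IsProbabilityMeasure m.toMeasure :=
  inferInstanceAs (IsProbabilityMeasure (m.1 : Measure (ℝ≥0 × K)))

theorem map_fst (m : OccMeasure K) : m.toMeasure.map Prod.fst = timeLaw := m.2

instance : MeasurableSpace (OccMeasure K) := MeasurableSpace.comap toProb inferInstance

theorem measurable_toMeasure : Measurable (toMeasure (K := K)) :=
  measurable_subtype_coe.comp (comap_measurable toProb)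

/-- The measure on `[0, ∞) × K`, with Lebesgue time marginal, whose product with `timeWeight` is
`m`. -/
def occ (m : OccMeasure K) : Measure (ℝ≥0 × K) :=
  m.toMeasure.withDensity fun p => (timeWeight p.1 : ℝ≥0∞)⁻¹

theorem occ_map_fst (m : OccMeasure K) : m.occ.map Prod.fst = leb := by
  rw [occ, map_fst_withDensity _ (g := fun s => (timeWeight s : ℝ≥0∞)⁻¹)
    measurable_timeWeight.coe_nnreal_ennreal.inv, map_fst, withDensity_inv_timeLaw]

theorem occ_prod_univ (m : OccMeasure K) {S : Set ℝ≥0} (hS : MeasurableSet S) :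
    m.occ (S ×ˢ Set.univ) = leb S := by
  rw [← occ_map_fst m, Measure.map_apply measurable_fst hS]
  congr 1
  ext p
  simp

theorem occ_Iic_univ (m : OccMeasure K) (t : ℝ≥0) : m.occ (Set.Iic t ×ˢ Set.univ) = t := by
  rw [occ_prod_univ m measurableSet_Iic, leb_Iic]

theorem measurable_occ : Measurable (occ (K := K)) := by
  refine Measure.measurable_of_measurable_coe _ fun S hS => ?_
  simp_rw [occ, withDensity_apply _ hS, ← lintegral_indicator hS]
  refine (Measure.measurable_lintegral ?_).comp measurable_toMeasure
  exact ((measurable_timeWeight.comp measurable_fst).coe_nnreal_ennreal.inv).indicator hS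

/-- The element of `OccMeasure K` given by a measure with Lebesgue time marginal. -/
def ofMeasure (N : Measure (ℝ≥0 × K)) (hN : N.map Prod.fst = leb) : OccMeasure K :=
  ⟨⟨N.withDensity fun p => timeWeight p.1, by
    have h := map_fst_withDensity N measurable_timeWeight.coe_nnreal_ennreal
    rw [hN] at h
    refine ⟨?_⟩
    have h2 := DFunLike.congr_fun h Set.univ
    rw [Measure.map_apply measurable_fst MeasurableSet.univ, Set.preimage_univ] at h2
    rw [h2]
    exact measure_univ (μ := timeLaw)⟩, by
    have h := map_fst_withDensity N measurable_timeWeight.coe_nnreal_ennreal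
    rw [hN] at h
    exact h⟩

theorem occ_ofMeasure (N : Measure (ℝ≥0 × K)) (hN : N.map Prod.fst = leb) :
    (ofMeasure N hN).occ = N :=
  withDensity_timeWeight_inv_cancel N

/-- The integral over `[0, t] × K` of a function on `K`. -/
def upToIntegral (t : ℝ≥0) (φ : K → ℝ) (m : OccMeasure K) : ℝ :=
  ∫ p in Set.Iic t ×ˢ Set.univ, φ p.2 ∂m.occ

variable [BorelSpace K] [T2Space K] [SecondCountableTopology K]

instance : TopologicalSpace (OccMeasure K) :=
  inferInstanceAs (TopologicalSpace
    {m : ProbabilityMeasure (ℝ≥0 × K) // (m : Measure (ℝ≥0 × K)).map Prod.fst = timeLaw})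

theorem isEmbedding_toProb : IsEmbedding (toProb (K := K)) :=
  IsEmbedding.subtypeVal

variable [CompactSpace K]

instance : MetrizableSpace (OccMeasure K) := (isEmbedding_toProb (K := K)).metrizableSpace

/-- Prokhorov's theorem: all members share the time marginal `timeLaw` and `K` is compact, so the
sets `[0, n] × K` give uniform tightness. The marginal condition is closed because projection is
weakly continuous. -/
theorem isCompact_range_toProb :
    IsCompact (Set.range (toProb (K := K))) := by
  have hu : Tendsto (fun n : ℕ => (timeLaw (Set.Iic (n : ℝ≥0))ᶜ).toNNReal) atTop (𝓝 0) := by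
    have h : Tendsto (fun n : ℕ => timeLaw (Set.Iic (n : ℝ≥0))ᶜ) atTop
        (𝓝 (timeLaw (⋂ n : ℕ, (Set.Iic (n : ℝ≥0))ᶜ))) := by
      refine tendsto_measure_iInter_atTop (fun n => measurableSet_Iic.compl.nullMeasurableSet) ?_
        ⟨0, measure_ne_top _ _⟩
      exact fun i j hij => Set.compl_subset_compl.2 (Set.Iic_subset_Iic.2 (by exact_mod_cast hij))
    have h0 : (⋂ n : ℕ, (Set.Iic (n : ℝ≥0))ᶜ) = ∅ := by
      refine Set.eq_empty_of_forall_notMem fun x hx => ?_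
      obtain ⟨n, hn⟩ := exists_nat_ge x
      exact Set.mem_iInter.1 hx n hn
    rw [h0, measure_empty] at h
    exact (ENNReal.tendsto_toNNReal ENNReal.zero_ne_top).comp h
  have hc := isCompact_setOfPred_probabilityMeasure_mass_eq_compl_isCompact_le
    (E := ℝ≥0 × K) (K := fun n : ℕ => Set.Iic (n : ℝ≥0) ×ˢ Set.univ) hu
    (fun n => by
      have : Set.Iic (n : ℝ≥0) = Set.Icc 0 (n : ℝ≥0) := by ext; simp
      rw [this]
      exact isCompact_Icc.prod isCompact_univ) (Or.inl inferInstance)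
  refine hc.of_isClosed_subset ?_ ?_
  · have : Set.range (toProb (K := K)) =
        (fun m => m.map (f := Prod.fst) continuous_fst.measurable.aemeasurable) ⁻¹'
          {(⟨timeLaw, inferInstance⟩ : ProbabilityMeasure ℝ≥0)} := by
      rw [range_toProb]
      ext m
      rw [Set.mem_ofPred_eq]
      exact ⟨fun h => Subtype.ext h, fun h => congrArg Subtype.val h⟩
    rw [this]
    exact isClosed_singleton.preimage (ProbabilityMeasure.continuous_map continuous_fst)
  · rintro _ ⟨m, rfl⟩ n
    refine ENNReal.toNNReal_mono (measure_ne_top _ _) (le_of_eq ?_)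
    rw [← map_fst m, Measure.map_apply measurable_fst measurableSet_Iic.compl]
    change toMeasure m _ = toMeasure m _
    congr 1
    ext p
    simp

instance : CompactSpace (OccMeasure K) :=
  ⟨(isEmbedding_toProb (K := K)).isCompact_iff.2 (by
    rw [Set.image_univ]
    exact isCompact_range_toProb)⟩

instance : SecondCountableTopology (OccMeasure K) := by
  let _ : MetricSpace (OccMeasure K) := metrizableSpaceMetric (OccMeasure K)
  infer_instance

instance : BorelSpace (OccMeasure K) :=
  borelSpace_of_isInducing_probabilityMeasure (isEmbedding_toProb (K := K)).isInducing

theorem continuous_integral_boundedContinuous (g : BoundedContinuousFunction (ℝ≥0 × K) ℝ) :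
    Continuous fun m : OccMeasure K => ∫ p, g p ∂m.toMeasure :=
  (ProbabilityMeasure.continuous_integral_boundedContinuousFunction g).comp
    (isEmbedding_toProb (K := K)).continuous

theorem upToIntegral_eq (t : ℝ≥0) (φ : K → ℝ) (m : OccMeasure K) :
    upToIntegral t φ m = ∫ p : ℝ≥0 × K,
      (Set.Iic t).indicator (fun s => ((timeWeight s)⁻¹ : ℝ)) p.1 * φ p.2 ∂m.toMeasure := by
  have hm : Measurable fun p : ℝ≥0 × K => (timeWeight p.1)⁻¹ :=
    (measurable_timeWeight.comp measurable_fst).inv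
  have h : m.occ = m.toMeasure.withDensity fun p => ((timeWeight p.1)⁻¹ : ℝ≥0) := by
    rw [occ]
    congr 1
    funext p
    rw [ENNReal.coe_inv (timeWeight_pos p.1).ne']
  rw [upToIntegral, h, ← integral_indicator (measurableSet_Iic.prod MeasurableSet.univ),
    integral_withDensity_eq_integral_smul hm]
  congr 1
  funext p
  by_cases hp : p.1 ≤ t
  · rw [Set.indicator_of_mem (by exact ⟨hp, trivial⟩), Set.indicator_of_mem (by exact hp)]
    rw [NNReal.smul_def, smul_eq_mul, NNReal.coe_inv]
  · rw [Set.indicator_of_notMem (fun h => hp h.1), Set.indicator_of_notMem (by exact hp)]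
    simp

theorem integrable_indicator_inv (t : ℝ≥0) :
    Integrable ((Set.Iic t).indicator (fun s => ((timeWeight s)⁻¹ : ℝ))) timeLaw := by
  have hm : Measurable fun s => ((timeWeight s)⁻¹ : ℝ) := measurable_timeWeight.coe_nnreal_real.inv
  refine ⟨(hm.indicator measurableSet_Iic).aestronglyMeasurable, ?_⟩
  have h : ∀ s, ‖(Set.Iic t).indicator (fun s => ((timeWeight s)⁻¹ : ℝ)) s‖ₑ =
      (Set.Iic t).indicator (fun s => ((timeWeight s : ℝ≥0∞)⁻¹)) s := by
    intro s
    rw [enorm_indicator_eq_indicator_enorm]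
    congr 1
    funext s
    rw [← NNReal.coe_inv, ← ENNReal.coe_inv (timeWeight_pos s).ne']
    exact NNReal.enorm_eq _
  rw [HasFiniteIntegral]
  simp_rw [h]
  rw [lintegral_indicator measurableSet_Iic, ← withDensity_apply _ measurableSet_Iic,
    withDensity_inv_timeLaw, leb_Iic]
  exact ENNReal.coe_lt_top

/-- The integrand contains the indicator of `[0, t]` divided by the weight, which need be neither
continuous nor bounded in time. It is integrable for the common marginal `timeLaw`, so a bounded
continuous `g` approximates it in `L¹` with an error that does not depend on `m`, and uniform limits
of continuous functions are continuous. -/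
theorem continuous_upToIntegral (t : ℝ≥0) {φ : K → ℝ} (hφ : Continuous φ) :
    Continuous (upToIntegral t φ) := by
  obtain ⟨C, hC⟩ : ∃ C, ∀ k, ‖φ k‖ ≤ C := by
    obtain ⟨C, hC⟩ := (isCompact_univ (X := K)).exists_bound_of_continuousOn hφ.continuousOn
    exact ⟨C, fun k => hC k trivial⟩
  have hC' : ∀ k, ‖φ k‖ ≤ max C 1 := fun k => (hC k).trans (le_max_left _ _)
  have hC0 : 0 < max C 1 := lt_max_of_lt_right one_pos
  set ψ := (Set.Iic t).indicator (fun s => ((timeWeight s)⁻¹ : ℝ)) with hψ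
  refine continuous_of_uniform_approx_of_continuous fun u hu => ?_
  obtain ⟨ε, hε, hεu⟩ := Metric.mem_uniformity_dist.1 hu
  obtain ⟨g, hg, hgi⟩ := (integrable_indicator_inv t).exists_boundedContinuous_integral_sub_le
    (ε := ε / 2 / max C 1) (by positivity)
  set φb : BoundedContinuousFunction K ℝ := BoundedContinuousFunction.mkOfCompact ⟨φ, hφ⟩
  set G : BoundedContinuousFunction (ℝ≥0 × K) ℝ :=
    (g.compContinuous ⟨Prod.fst, continuous_fst⟩) * (φb.compContinuous ⟨Prod.snd, continuous_snd⟩)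
  refine ⟨_, continuous_integral_boundedContinuous G, fun m => hεu ?_⟩
  have hψi : Integrable (fun p : ℝ≥0 × K => ψ p.1) m.toMeasure := by
    have := integrable_indicator_inv t
    rw [← m.map_fst] at this
    exact this.comp_measurable measurable_fst
  have hgi0 : Integrable g timeLaw := hgi
  have hgi' : Integrable (fun p : ℝ≥0 × K => g p.1) m.toMeasure := by
    rw [← m.map_fst] at hgi
    exact hgi.comp_measurable measurable_fst
  have hφm : AEStronglyMeasurable (fun p : ℝ≥0 × K => φ p.2) m.toMeasure :=
    (hφ.comp continuous_snd).aestronglyMeasurable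
  have hb : ∀ᵐ p ∂m.toMeasure, ‖φ p.2‖ ≤ max C 1 := ae_of_all _ fun p => hC' _
  have hdiff : ∫ p, ‖ψ p.1 - g p.1‖ ∂m.toMeasure ≤ ε / 2 / max C 1 := by
    rw [← m.map_fst] at hg
    refine le_trans (le_of_eq ?_) hg
    rw [integral_map measurable_fst.aemeasurable]
    have := (integrable_indicator_inv t).sub hgi0
    rw [← m.map_fst] at this
    exact this.norm.aestronglyMeasurable
  rw [Real.dist_eq, upToIntegral_eq, ← Real.norm_eq_abs]
  calc ‖∫ p, ψ p.1 * φ p.2 ∂m.toMeasure - ∫ p, G p ∂m.toMeasure‖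
      = ‖∫ p, (ψ p.1 - g p.1) * φ p.2 ∂m.toMeasure‖ := by
        change ‖_ - ∫ p : ℝ≥0 × K, g p.1 * φ p.2 ∂m.toMeasure‖ = _
        rw [← integral_sub (hψi.mul_bdd hφm hb) (hgi'.mul_bdd hφm hb)]
        congr 1
        refine integral_congr_ae (ae_of_all _ fun p => ?_)
        ring
    _ ≤ ∫ p, ‖ψ p.1 - g p.1‖ * max C 1 ∂m.toMeasure := by
        refine norm_integral_le_of_norm_le ((hψi.sub hgi').norm.mul_const _)
          (ae_of_all _ fun p => ?_)
        rw [norm_mul]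
        exact mul_le_mul_of_nonneg_left (hC' _) (norm_nonneg _)
    _ ≤ ε / 2 / max C 1 * max C 1 := by
        rw [integral_mul_const]
        exact mul_le_mul_of_nonneg_right hdiff hC0.le
    _ < ε := by
        rw [div_mul_cancel₀ _ hC0.ne']
        linarith

end OccMeasure
end OccMeasure

/-! ### Integrals over time windows and their Lipschitz dependence on time. -/

namespace OccMeasure

variable {K : Type w} [TopologicalSpace K] [MeasurableSpace K]

theorem integrableOn_Iic (m : OccMeasure K) (t : ℝ≥0) {F : ℝ≥0 × K → ℝ} (hF : Measurable F) {C : ℝ}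
    (hC : ∀ p, |F p| ≤ C) : IntegrableOn F (Set.Iic t ×ˢ Set.univ) m.occ :=
  Measure.integrableOn_of_bounded (by rw [occ_Iic_univ]; exact ENNReal.coe_ne_top)
    hF.aestronglyMeasurable (M := C) (ae_of_all _ hC)

theorem setIntegral_Iic_sub (m : OccMeasure K) {s t : ℝ≥0} (hst : s ≤ t) {F : ℝ≥0 × K → ℝ}
    (hF : Measurable F) {C : ℝ} (hC : ∀ p, |F p| ≤ C) :
    (∫ p in Set.Iic t ×ˢ Set.univ, F p ∂m.occ) - ∫ p in Set.Iic s ×ˢ Set.univ, F p ∂m.occ =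
      ∫ p in Set.Ioc s t ×ˢ Set.univ, F p ∂m.occ := by
  have hu : Set.Iic t ×ˢ (Set.univ : Set K) = Set.Iic s ×ˢ Set.univ ∪ Set.Ioc s t ×ˢ Set.univ := by
    rw [← Set.union_prod, Set.Iic_union_Ioc_eq_Iic hst]
  have hi := m.integrableOn_Iic t hF hC
  rw [hu] at hi
  rw [hu, setIntegral_union ?_ (measurableSet_Ioc.prod MeasurableSet.univ)
    (hi.mono_set Set.subset_union_left) (hi.mono_set Set.subset_union_right)]
  · ring
  · rw [Set.disjoint_prod]
    exact Or.inl ((Set.Iic_disjoint_Ioc le_rfl))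

theorem occ_Ioc_univ (m : OccMeasure K) {s t : ℝ≥0} (hst : s ≤ t) :
    m.occ (Set.Ioc s t ×ˢ Set.univ) = (t - s : ℝ≥0) := by
  rw [measure_Ioc_prod hst MeasurableSet.univ (by rw [occ_Iic_univ]; exact ENNReal.coe_ne_top),
    occ_Iic_univ, occ_Iic_univ, ENNReal.coe_sub]

theorem abs_setIntegral_Ioc_le (m : OccMeasure K) {s t : ℝ≥0} (hst : s ≤ t) {F : ℝ≥0 × K → ℝ}
    {C : ℝ} (hC : ∀ p, |F p| ≤ C) :
    |∫ p in Set.Ioc s t ×ˢ Set.univ, F p ∂m.occ| ≤ C * (t - s) := by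
  have h := norm_setIntegral_le_of_norm_le_const (μ := m.occ) (s := Set.Ioc s t ×ˢ Set.univ)
    (f := F) (C := C) (by rw [occ_Ioc_univ m hst]; exact ENNReal.coe_lt_top) (fun p _ => hC p)
  rwa [measureReal_def, occ_Ioc_univ m hst, ENNReal.coe_toReal, NNReal.coe_sub hst] at h

theorem upToIntegral_zero (φ : K → ℝ) (m : OccMeasure K) : upToIntegral 0 φ m = 0 := by
  rw [upToIntegral, Measure.restrict_eq_zero.2, integral_zero_measure]
  rw [occ_Iic_univ, ENNReal.coe_zero]

theorem abs_upToIntegral_sub_le (m : OccMeasure K) {s t : ℝ≥0} (hst : s ≤ t) {φ : K → ℝ}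
    (hφ : Measurable φ) {C : ℝ} (hC : ∀ k, |φ k| ≤ C) :
    |upToIntegral t φ m - upToIntegral s φ m| ≤ C * (t - s) := by
  rw [upToIntegral, upToIntegral, m.setIntegral_Iic_sub hst (F := fun p => φ p.2)
    (hφ.comp measurable_snd) (fun p => hC p.2)]
  exact m.abs_setIntegral_Ioc_le hst fun p => hC p.2

theorem abs_upToIntegral_le (m : OccMeasure K) (t : ℝ≥0) {φ : K → ℝ}
    (hφ : Measurable φ) {C : ℝ} (hC : ∀ k, |φ k| ≤ C) : |upToIntegral t φ m| ≤ C * t := by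
  have h := m.abs_upToIntegral_sub_le (zero_le (a := t)) hφ hC
  rwa [upToIntegral_zero, sub_zero, NNReal.coe_zero, sub_zero] at h

theorem continuous_upToIntegral_time (m : OccMeasure K) {φ : K → ℝ}
    (hφ : Measurable φ) {C : ℝ} (hC : ∀ k, |φ k| ≤ C) :
    Continuous fun t => upToIntegral t φ m := by
  have hC0 : 0 ≤ |C| := abs_nonneg _
  have h : LipschitzWith ⟨|C|, hC0⟩ fun t => upToIntegral t φ m := by
    refine LipschitzWith.of_dist_le_mul fun s t => ?_
    rw [Real.dist_eq, NNReal.dist_eq]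
    change _ ≤ |C| * _
    have hC' : ∀ k, |φ k| ≤ |C| := fun k => (hC k).trans (le_abs_self C)
    rcases le_total s t with hst | hst
    · rw [abs_sub_comm, abs_sub_comm (s : ℝ), abs_of_nonneg (sub_nonneg.2 (NNReal.coe_le_coe.2 hst))]
      exact m.abs_upToIntegral_sub_le hst hφ hC'
    · rw [abs_of_nonneg (sub_nonneg.2 (NNReal.coe_le_coe.2 hst))]
      exact m.abs_upToIntegral_sub_le hst hφ hC'
  exact h.continuous

end OccMeasure

/-! ### Relaxed paths, relaxed solutions, and their closedness under weak limits. -/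

section RelaxedPath

variable (E : Type u) (𝒰 : Type v) [MetricSpace E] [MeasurableSpace E]
  [MetricSpace 𝒰] [MeasurableSpace 𝒰]

/-- A path along the rationals together with an occupation measure of state and control. -/
abbrev RelaxedPath : Type (max u v) := (ℚ≥0 → E) × OccMeasure (E × (Unit ⊕ 𝒰))

variable {E 𝒰}

/-- The time-`q` coordinates of a relaxed path. -/
def RelaxedPath.coord (q : ℚ≥0) (i : C(E, ℝ) ⊕ C(E × (Unit ⊕ 𝒰), ℝ)) (s : RelaxedPath E 𝒰) : ℝ :=
  Sum.elim (fun κ => κ (s.1 q)) (fun φ => s.2.upToIntegral q φ) i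

/-- The indicator function of the control `Sum.inl ()`. -/
def inlIndicator : C(E × (Unit ⊕ 𝒰), ℝ) :=
  ⟨fun p => Sum.elim (fun _ => 1) (fun _ => 0) p.2,
    (Continuous.sumElim continuous_const continuous_const).comp continuous_snd⟩

/-- The integral of `(κ(x) - κ(y q'))²` over the times in `(q, q']`, expanded so that its continuity
is evident. -/
def RelaxedPath.gap (κ : C(E, ℝ)) (q q' : ℚ≥0) (s : RelaxedPath E 𝒰) : ℝ :=
  (s.2.upToIntegral q' (fun p => κ p.1 ^ 2) - s.2.upToIntegral q (fun p => κ p.1 ^ 2))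
    - 2 * κ (s.1 q') * (s.2.upToIntegral q' (fun p => κ p.1) - s.2.upToIntegral q fun p => κ p.1)
    + κ (s.1 q') ^ 2 * ((q' : ℝ) - q)

/-- The martingale increment of a relaxed path, multiplied by a function of the past. -/
def RelaxedPath.testIncrement (f : C(E, ℝ)) (G : C(E × (Unit ⊕ 𝒰), ℝ)) (q q' : ℚ≥0) (r : ℝ≥0 → ℚ≥0)
    (J : Finset (ℝ≥0 × (C(E, ℝ) ⊕ C(E × (Unit ⊕ 𝒰), ℝ))))
    (c : ℝ≥0 × (C(E, ℝ) ⊕ C(E × (Unit ⊕ 𝒰), ℝ)) → ℝ → ℝ) (s : RelaxedPath E 𝒰) : ℝ :=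
  (f (s.1 q') - f (s.1 q) - (s.2.upToIntegral q' G - s.2.upToIntegral q G)) *
    ∏ i ∈ J, c i (RelaxedPath.coord (r i.1) i.2 s)

/-- The laws on the space of relaxed paths that arise from solutions of the controlled martingale
problem, with `δ` controlling the time regularity, and their limits. -/
structure IsRelaxedSolution (D : ControlledData E 𝒰) (δ : C(E, ℝ) → ℝ → ℝ≥0)
    (p : Measure (RelaxedPath E 𝒰)) : Prop where
  integral_testIncrement : ∀ f G, D.IsGen f G → ∀ q q', q ≤ q' → ∀ (r : ℝ≥0 → ℚ≥0) J c,
    (∀ i ∈ J, r i.1 ≤ q) → (∀ i, Continuous (c i)) → (∀ i x, |c i x| ≤ 1) →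
    ∫ s, RelaxedPath.testIncrement f G q q' r J c s ∂p = 0
  integral_constraint : ∀ (t : ℝ≥0) (d : C(E × (Unit ⊕ 𝒰), ℝ)), (∀ k ∈ D.constraint, d k = 0) →
    ∫ s, s.2.upToIntegral t d ∂p = 0
  integral_gap_le : ∀ κ ε, 0 < ε → ∀ q q' : ℚ≥0, q ≤ q' → (q' : ℝ) - q ≤ δ κ ε →
    ∫ s, RelaxedPath.gap κ q q' s ∂p ≤ ε * ((q' : ℝ) - q)

variable [CompactSpace E] [BorelSpace E] [CompactSpace 𝒰] [BorelSpace 𝒰]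

instance : SecondCountableTopology (E × (Unit ⊕ 𝒰)) := inferInstance

instance : CompactSpace (RelaxedPath E 𝒰) := inferInstance

instance : T2Space (RelaxedPath E 𝒰) := inferInstance

instance : BorelSpace (RelaxedPath E 𝒰) := inferInstance

instance : OpensMeasurableSpace (RelaxedPath E 𝒰) := inferInstance

theorem RelaxedPath.continuous_coord (q : ℚ≥0) (i : C(E, ℝ) ⊕ C(E × (Unit ⊕ 𝒰), ℝ)) :
    Continuous (RelaxedPath.coord q i) := by
  rcases i with κ | φ
  · exact κ.continuous.comp ((continuous_apply q).comp continuous_fst)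
  · exact (OccMeasure.continuous_upToIntegral _ φ.continuous).comp continuous_snd

theorem RelaxedPath.continuous_upToIntegral (t : ℝ≥0) {φ : E × (Unit ⊕ 𝒰) → ℝ}
    (hφ : Continuous φ) : Continuous fun s : RelaxedPath E 𝒰 => s.2.upToIntegral t φ :=
  (OccMeasure.continuous_upToIntegral t hφ).comp continuous_snd

theorem RelaxedPath.continuous_eval (κ : C(E, ℝ)) (q : ℚ≥0) :
    Continuous fun s : RelaxedPath E 𝒰 => κ (s.1 q) :=
  κ.continuous.comp ((continuous_apply q).comp continuous_fst)

theorem RelaxedPath.continuous_gap (κ : C(E, ℝ)) (q q' : ℚ≥0) :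
    Continuous (RelaxedPath.gap (𝒰 := 𝒰) κ q q') := by
  have h1 : Continuous fun p : E × (Unit ⊕ 𝒰) => κ p.1 := κ.continuous.comp continuous_fst
  have h2 := h1.pow 2
  exact (((continuous_upToIntegral _ h2).sub (continuous_upToIntegral _ h2)).sub
    ((continuous_const.mul (continuous_eval κ q')).mul
      ((continuous_upToIntegral _ h1).sub (continuous_upToIntegral _ h1)))).add
    (((continuous_eval κ q').pow 2).mul continuous_const)

theorem RelaxedPath.continuous_testIncrement (f : C(E, ℝ)) (G : C(E × (Unit ⊕ 𝒰), ℝ)) (q q' : ℚ≥0)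
    (r : ℝ≥0 → ℚ≥0) (J : Finset (ℝ≥0 × (C(E, ℝ) ⊕ C(E × (Unit ⊕ 𝒰), ℝ))))
    {c : ℝ≥0 × (C(E, ℝ) ⊕ C(E × (Unit ⊕ 𝒰), ℝ)) → ℝ → ℝ} (hc : ∀ i, Continuous (c i)) :
    Continuous (RelaxedPath.testIncrement f G q q' r J c) :=
  (((continuous_eval f q').sub (continuous_eval f q)).sub
    ((continuous_upToIntegral _ G.continuous).sub (continuous_upToIntegral _ G.continuous))).mul
    (continuous_finsetProd J fun i _ => (hc i).comp (continuous_coord _ _))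

theorem tendsto_integral_of_continuous {X ι : Type*} [TopologicalSpace X] [CompactSpace X]
    [MeasurableSpace X] [OpensMeasurableSpace X] {l : Filter ι} {p : ι → ProbabilityMeasure X}
    {q : ProbabilityMeasure X} (h : Tendsto p l (𝓝 q)) {F : X → ℝ} (hF : Continuous F) :
    Tendsto (fun i => ∫ x, F x ∂(p i : Measure X)) l (𝓝 (∫ x, F x ∂(q : Measure X))) :=
  (ProbabilityMeasure.tendsto_iff_forall_integral_tendsto.1 h)
    (BoundedContinuousFunction.mkOfCompact ⟨F, hF⟩)

/-- Each condition is an equality or a weak inequality for the integral of a fixed continuous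
function on a compact space. The modulus `δ` must be common to all the laws. -/
theorem isRelaxedSolution_of_tendsto {D : ControlledData E 𝒰} {δ : C(E, ℝ) → ℝ → ℝ≥0} {ι : Type*}
    {l : Filter ι} [l.NeBot] {p : ι → ProbabilityMeasure (RelaxedPath E 𝒰)}
    {q : ProbabilityMeasure (RelaxedPath E 𝒰)} (h : Tendsto p l (𝓝 q))
    (hp : ∀ i, IsRelaxedSolution D δ (p i : Measure (RelaxedPath E 𝒰))) :
    IsRelaxedSolution D δ (q : Measure (RelaxedPath E 𝒰)) where
  integral_testIncrement f G hG a b hab r J c hr hc hc1 := by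
    refine tendsto_nhds_unique (tendsto_integral_of_continuous h
      (RelaxedPath.continuous_testIncrement f G a b r J hc)) ?_
    simp_rw [fun i => (hp i).integral_testIncrement f G hG a b hab r J c hr hc hc1]
    exact tendsto_const_nhds
  integral_constraint t d hd := by
    refine tendsto_nhds_unique (tendsto_integral_of_continuous h
      (RelaxedPath.continuous_upToIntegral t d.continuous)) ?_
    simp_rw [fun i => (hp i).integral_constraint t d hd]
    exact tendsto_const_nhds
  integral_gap_le κ ε hε a b hab hδ :=
    le_of_tendsto (tendsto_integral_of_continuous h (RelaxedPath.continuous_gap κ a b))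
      (Eventually.of_forall fun i => (hp i).integral_gap_le κ ε hε a b hab hδ)

/-- A limit point of relaxed solutions for which the integrals of a function tend to its upper
bound. -/
theorem exists_isRelaxedSolution_integral_ge {D : ControlledData E 𝒰} {δ : C(E, ℝ) → ℝ → ℝ≥0}
    {F : RelaxedPath E 𝒰 → ℝ} (hF : Continuous F) {a : ℝ}
    (h : ∀ b < a, ∃ p : ProbabilityMeasure (RelaxedPath E 𝒰),
      IsRelaxedSolution D δ (p : Measure (RelaxedPath E 𝒰)) ∧
        b ≤ ∫ s, F s ∂(p : Measure (RelaxedPath E 𝒰))) :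
    ∃ p : ProbabilityMeasure (RelaxedPath E 𝒰),
      IsRelaxedSolution D δ (p : Measure (RelaxedPath E 𝒰)) ∧
        a ≤ ∫ s, F s ∂(p : Measure (RelaxedPath E 𝒰)) := by
  have h' : ∀ n : ℕ, a - 1 / ((n : ℝ) + 1) < a := fun n => sub_lt_self _ (by positivity)
  choose p hp hpF using fun n => h _ (h' n)
  -- An ultrafilter limit replaces the extraction of a subsequence.
  obtain ⟨q, -, hq⟩ := isCompact_univ.ultrafilter_le_nhds ((hyperfilter ℕ).map p) (by simp)
  have hq' : Tendsto p (hyperfilter ℕ) (𝓝 q) := hq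
  refine ⟨q, isRelaxedSolution_of_tendsto hq' hp, ?_⟩
  have h1 : Tendsto (fun n : ℕ => a - 1 / ((n : ℝ) + 1)) atTop (𝓝 (a - 0)) :=
    tendsto_const_nhds.sub tendsto_one_div_add_atTop_nhds_zero_nat
  rw [sub_zero] at h1
  exact le_of_tendsto_of_tendsto' (h1.mono_left Nat.hyperfilter_le_atTop)
    (tendsto_integral_of_continuous hq' hF) hpF

end RelaxedPath

/-! ### A mean-square modulus of continuity, uniform over all solutions. -/

section Moments

variable {Ω : Type w} [mΩ : MeasurableSpace Ω] {E : Type u} {𝒰 : Type v} [MetricSpace E]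
  [MeasurableSpace E] [CompactSpace E] [BorelSpace E] [MetricSpace 𝒰] [MeasurableSpace 𝒰]
  [CompactSpace 𝒰] [BorelSpace 𝒰] {D : ControlledData E 𝒰}

theorem ProcessTriple.abs_drift_sub_le (Z : ProcessTriple Ω E 𝒰) {H : E × (Unit ⊕ 𝒰) → ℝ}
    (hH : Measurable H) {C : ℝ} (hC : ∀ p, |H p| ≤ C) {s t : ℝ≥0} (hst : s ≤ t) {ω : Ω}
    (hω : ∀ t : ℝ≥0, Z.ctl ω (Set.Iic t ×ˢ Set.univ) = t) :
    |Z.drift H t ω - Z.drift H s ω| ≤ C * (t - s) := by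
  have h1 : Z.ctl ω (Set.Ioc s t ×ˢ Set.univ) = (t - s : ℝ≥0) := by
    rw [measure_Ioc_prod hst MeasurableSet.univ (by rw [hω]; exact ENNReal.coe_ne_top),
      hω, hω, ENNReal.coe_sub]
  rw [Z.drift_sub hH hC hst]
  have h := norm_setIntegral_le_of_norm_le_const (μ := Z.ctl ω) (s := Set.Ioc s t ×ˢ Set.univ)
    (f := fun p => H (Z.Y p.1 ω, p.2)) (C := C) (by rw [h1]; exact ENNReal.coe_lt_top)
    (fun p _ => hC _)
  rwa [measureReal_def, h1, ENNReal.coe_toReal, NNReal.coe_sub hst] at h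

/-- Along solutions, the conditional increments of `f(Y)` are Lipschitz in time. -/
theorem exists_abs_integral_sub_mul_le {f : C(E, ℝ)} (hA : ∃ g, (f, g) ∈ D.A)
    (hB : ∃ h, (f, h) ∈ D.B) : ∃ C : ℝ, 0 ≤ C ∧ ∀ (Ω : Type w) [MeasurableSpace Ω] (P : Measure Ω)
      [IsProbabilityMeasure P] (Z : ProcessTriple Ω E 𝒰), IsControlledSolution D P Z →
      ∀ s t : ℝ≥0, s ≤ t → ∀ (F : Ω → ℝ) (b : ℝ), StronglyMeasurable[Z.filtration s] F →
      (∀ ω, |F ω| ≤ b) → |∫ ω, (f (Z.Y t ω) - f (Z.Y s ω)) * F ω ∂P| ≤ C * (t - s) * b := by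
  obtain ⟨g, hg⟩ := hA
  obtain ⟨h, hh⟩ := hB
  obtain ⟨C, hC⟩ := D.exists_bound_genFun g h
  refine ⟨|C|, abs_nonneg C, fun Ω _ P _ Z hZ s t hst F b hF hFb => ?_⟩
  have hC' : ∀ p, |D.genFun g h p| ≤ |C| := fun p => (hC p).trans (le_abs_self C)
  obtain ⟨h1, -, h3⟩ := (isControlledSolution_iff D P Z).1 hZ
  have hm := integral_sub_mul_eq_zero_of_martingale (h3 f g h hg hh) hst hF hFb
  have hFm : AEStronglyMeasurable F P := (hF.mono (Z.filtration.le s)).aestronglyMeasurable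
  have hd : ∀ r, StronglyMeasurable (Z.drift (D.genFun g h) r) := fun r =>
    (Z.stronglyMeasurable_drift (D.measurable_genFun g h) r).mono (Z.filtration.le r)
  have hb : ∀ᵐ ω ∂P, |(Z.drift (D.genFun g h) t ω - Z.drift (D.genFun g h) s ω) * F ω| ≤
      |C| * (t - s) * b := by
    filter_upwards [h1] with ω hω
    rw [abs_mul]
    exact mul_le_mul (Z.abs_drift_sub_le (D.measurable_genFun g h) hC' hst hω) (hFb ω)
      (abs_nonneg _) (mul_nonneg (abs_nonneg _) (sub_nonneg.2 (NNReal.coe_le_coe.2 hst)))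
  have hi1 : Integrable (fun ω => (f (Z.Y t ω) - f (Z.Y s ω)) * F ω) P :=
    ((f.integrable_comp_of_compact (Z.measurable_Y t)).sub
      (f.integrable_comp_of_compact (Z.measurable_Y s))).mul_bdd (c := b) hFm (ae_of_all _ hFb)
  have hi2 : Integrable (fun ω => (Z.drift (D.genFun g h) t ω - Z.drift (D.genFun g h) s ω) * F ω)
      P := Integrable.of_bound
    (((hd t).sub (hd s)).aestronglyMeasurable.mul hFm) _ hb
  have he : ∫ ω, (f (Z.Y t ω) - f (Z.Y s ω)) * F ω ∂P =
      ∫ ω, (Z.drift (D.genFun g h) t ω - Z.drift (D.genFun g h) s ω) * F ω ∂P := by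
    rw [← sub_eq_zero, ← integral_sub hi1 hi2, ← hm]
    congr 1
    funext ω
    ring
  rw [he]
  have := norm_integral_le_of_norm_le_const (μ := P)
    (f := fun ω => (Z.drift (D.genFun g h) t ω - Z.drift (D.genFun g h) s ω) * F ω) hb
  simpa using this

/-- With subscripts for times, `(κ_s - κ_t)² = (κ²_t - κ²_s) - 2 κ_s (κ_t - κ_s)`. Replace `κ²` and
`κ` by nearby elements `f` and `f'` of the dense domain: the expected increments of `f`, and those
of `f'` weighted by `κ_s`, are Lipschitz in time, with constants that depend only on the data and
not on the solution. -/
theorem exists_integral_sq_sub_le (D : ControlledData E 𝒰) (κ : C(E, ℝ)) {ε : ℝ} (hε : 0 < ε) :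
    ∃ δ : ℝ≥0, 0 < δ ∧ ∀ (Ω : Type w) [MeasurableSpace Ω] (P : Measure Ω)
      [IsProbabilityMeasure P] (Z : ProcessTriple Ω E 𝒰), IsControlledSolution D P Z →
      ∀ s t : ℝ≥0, s ≤ t → (t : ℝ) - s ≤ δ →
      ∫ ω, (κ (Z.Y s ω) - κ (Z.Y t ω)) ^ 2 ∂P ≤ ε := by
  set b : ℝ := ‖κ‖
  have hb0 : 0 ≤ b := norm_nonneg _
  have hb : ∀ x, |κ x| ≤ b := fun x => κ.norm_coe_le_norm x
  -- Error budget: replacing `κ²` costs `2 · ε / 8`, and replacing `κ` in the doubled cross term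
  -- costs at most another `ε / 4`. The remaining `ε / 2` is left to the time increment; the `+ 1`
  -- in denominators avoids division by zero.
  obtain ⟨f, ⟨hfA, hfB⟩, hf⟩ := D.dense_domain.exists_dist_lt (κ ^ 2) (ε := ε / 8) (by positivity)
  obtain ⟨f', ⟨hfA', hfB'⟩, hf'⟩ := D.dense_domain.exists_dist_lt κ (ε := ε / (16 * (b + 1)))
    (by positivity)
  have hf1 : ∀ x, |κ x ^ 2 - f x| ≤ ε / 8 := fun x =>
    (ContinuousMap.dist_apply_le_dist (f := κ ^ 2) (g := f) x).trans hf.le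
  have hf2 : ∀ x, |κ x - f' x| ≤ ε / (16 * (b + 1)) := fun x =>
    (ContinuousMap.dist_apply_le_dist (f := κ) (g := f') x).trans hf'.le
  obtain ⟨C, hC0, hC⟩ := exists_abs_integral_sub_mul_le.{u, v, w} hfA hfB
  obtain ⟨C', hC0', hC'⟩ := exists_abs_integral_sub_mul_le.{u, v, w} hfA' hfB'
  have hδ : 0 < ε / 2 / (C + 2 * (C' * b) + 1) := by positivity
  refine ⟨⟨_, hδ.le⟩, hδ, fun Ω _ P _ Z hZ s t hst hts => ?_⟩
  change (t : ℝ) - s ≤ ε / 2 / (C + 2 * (C' * b) + 1) at hts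
  have h1 := hC Ω P Z hZ s t hst (fun _ => 1) 1 stronglyMeasurable_const (by simp)
  have hκm : StronglyMeasurable[Z.filtration s] fun ω => κ (Z.Y s ω) :=
    (κ.continuous.measurable.comp (Z.measurable_Y_filtration le_rfl)).stronglyMeasurable
  have h2 := hC' Ω P Z hZ s t hst (fun ω => κ (Z.Y s ω)) b hκm (fun ω => hb _)
  have hi1 : Integrable (fun ω => (f (Z.Y t ω) - f (Z.Y s ω)) * (1 : ℝ)) P :=
    ((f.integrable_comp_of_compact (Z.measurable_Y t)).sub
      (f.integrable_comp_of_compact (Z.measurable_Y s))).mul_const _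
  have hi2 : Integrable (fun ω => (f' (Z.Y t ω) - f' (Z.Y s ω)) * κ (Z.Y s ω)) P :=
    ((f'.integrable_comp_of_compact (Z.measurable_Y t)).sub
      (f'.integrable_comp_of_compact (Z.measurable_Y s))).mul_bdd (c := b)
      (hκm.mono (Z.filtration.le s)).aestronglyMeasurable (ae_of_all _ fun ω => hb _)
  have hpt : ∀ ω, (κ (Z.Y s ω) - κ (Z.Y t ω)) ^ 2 ≤ (f (Z.Y t ω) - f (Z.Y s ω)) * 1
      - 2 * ((f' (Z.Y t ω) - f' (Z.Y s ω)) * κ (Z.Y s ω)) + ε / 2 := by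
    intro ω
    have e1 := abs_le.1 (hf1 (Z.Y t ω))
    have e2 := abs_le.1 (hf1 (Z.Y s ω))
    have e5 : |((κ (Z.Y t ω) - f' (Z.Y t ω)) - (κ (Z.Y s ω) - f' (Z.Y s ω))) * κ (Z.Y s ω)| ≤
        2 * (ε / (16 * (b + 1))) * b := by
      rw [abs_mul]
      refine mul_le_mul ((abs_sub _ _).trans ?_) (hb _) (abs_nonneg _) (by positivity)
      linarith [hf2 (Z.Y t ω), hf2 (Z.Y s ω)]
    have e6 : 2 * (ε / (16 * (b + 1))) * b ≤ ε / 8 := by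
      rw [show 2 * (ε / (16 * (b + 1))) * b = (ε / 8) * (b / (b + 1)) by field_simp; ring]
      exact mul_le_of_le_one_right (by positivity) ((div_le_one (by positivity)).2 (by linarith))
    have e7 := abs_le.1 (e5.trans e6)
    nlinarith
  have hi3 : Integrable (fun ω => (f (Z.Y t ω) - f (Z.Y s ω)) * 1
      - 2 * ((f' (Z.Y t ω) - f' (Z.Y s ω)) * κ (Z.Y s ω))) P := hi1.sub (hi2.const_mul 2)
  calc ∫ ω, (κ (Z.Y s ω) - κ (Z.Y t ω)) ^ 2 ∂P
      ≤ ∫ ω, ((f (Z.Y t ω) - f (Z.Y s ω)) * 1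
        - 2 * ((f' (Z.Y t ω) - f' (Z.Y s ω)) * κ (Z.Y s ω)) + ε / 2) ∂P := by
        refine integral_mono_of_nonneg (ae_of_all _ fun ω => sq_nonneg _)
          (hi3.add (integrable_const _)) (ae_of_all _ hpt)
    _ = (∫ ω, (f (Z.Y t ω) - f (Z.Y s ω)) * 1 ∂P)
        - 2 * (∫ ω, (f' (Z.Y t ω) - f' (Z.Y s ω)) * κ (Z.Y s ω) ∂P) + ε / 2 := by
        rw [integral_add hi3 (integrable_const _), integral_sub hi1 (hi2.const_mul 2),
          integral_const_mul, integral_const, probReal_univ, one_smul]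
    _ ≤ (C + 2 * (C' * b)) * (t - s) + ε / 2 := by
        have a1 := abs_le.1 h1
        have a2 := abs_le.1 h2
        nlinarith
    _ ≤ ε / 2 + ε / 2 := by
        have hts0 : 0 ≤ (t : ℝ) - s := sub_nonneg.2 (NNReal.coe_le_coe.2 hst)
        have := (le_div_iff₀ (by positivity : 0 < C + 2 * (C' * b) + 1)).1 hts
        nlinarith
    _ = ε := by ring

end Moments

/-! ### The relaxed path of a solution. -/

section OfSolution

variable {E : Type u} {𝒰 : Type v} [MetricSpace E] [MeasurableSpace E] [CompactSpace E]
  [BorelSpace E] [MetricSpace 𝒰] [MeasurableSpace 𝒰] [CompactSpace 𝒰] [BorelSpace 𝒰]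

theorem RelaxedPath.gap_eq (κ : C(E, ℝ)) {q q' : ℚ≥0} (h : q ≤ q') (s : RelaxedPath E 𝒰) :
    RelaxedPath.gap κ q q' s = ∫ p in Set.Ioc (q : ℝ≥0) q' ×ˢ Set.univ,
      (κ p.2.1 - κ (s.1 q')) ^ 2 ∂s.2.occ := by
  have hq : (q : ℝ≥0) ≤ q' := by exact_mod_cast h
  have hκ : Measurable fun p : ℝ≥0 × (E × (Unit ⊕ 𝒰)) => κ p.2.1 :=
    κ.continuous.measurable.comp (measurable_fst.comp measurable_snd)
  have hb : ∀ p : ℝ≥0 × (E × (Unit ⊕ 𝒰)), |κ p.2.1| ≤ ‖κ‖ := fun p => κ.norm_coe_le_norm _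
  have hb2 : ∀ p : ℝ≥0 × (E × (Unit ⊕ 𝒰)), |κ p.2.1 ^ 2| ≤ ‖κ‖ ^ 2 := fun p => by
    rw [abs_pow]
    exact pow_le_pow_left₀ (abs_nonneg _) (hb p) 2
  have h1 : s.2.upToIntegral q' (fun p => κ p.1) - s.2.upToIntegral q (fun p => κ p.1) = _ :=
    s.2.setIntegral_Iic_sub hq hκ hb
  have h2 : s.2.upToIntegral q' (fun p => κ p.1 ^ 2) - s.2.upToIntegral q (fun p => κ p.1 ^ 2)
    = _ := s.2.setIntegral_Iic_sub hq (hκ.pow_const 2) hb2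
  have hfin : s.2.occ (Set.Ioc (q : ℝ≥0) q' ×ˢ Set.univ) ≠ ∞ := by
    rw [s.2.occ_Ioc_univ hq]
    exact ENNReal.coe_ne_top
  have i1 : IntegrableOn (fun p : ℝ≥0 × (E × (Unit ⊕ 𝒰)) => κ p.2.1)
      (Set.Ioc (q : ℝ≥0) q' ×ˢ Set.univ) s.2.occ :=
    Measure.integrableOn_of_bounded hfin hκ.aestronglyMeasurable (ae_of_all _ hb)
  have i2 : IntegrableOn (fun p : ℝ≥0 × (E × (Unit ⊕ 𝒰)) => κ p.2.1 ^ 2)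
      (Set.Ioc (q : ℝ≥0) q' ×ˢ Set.univ) s.2.occ :=
    Measure.integrableOn_of_bounded hfin (hκ.pow_const 2).aestronglyMeasurable (ae_of_all _ hb2)
  have i3 : IntegrableOn (fun _ : ℝ≥0 × (E × (Unit ⊕ 𝒰)) => κ (s.1 q') ^ 2)
      (Set.Ioc (q : ℝ≥0) q' ×ˢ Set.univ) s.2.occ := integrableOn_const hfin
  have h3 : ∫ _ in Set.Ioc (q : ℝ≥0) q' ×ˢ Set.univ, κ (s.1 q') ^ 2 ∂s.2.occ =
      κ (s.1 q') ^ 2 * ((q' : ℝ) - q) := by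
    rw [setIntegral_const, measureReal_def, s.2.occ_Ioc_univ hq, ENNReal.coe_toReal,
      NNReal.coe_sub hq, smul_eq_mul, mul_comm]
    rfl
  have i4 : IntegrableOn (fun p : ℝ≥0 × (E × (Unit ⊕ 𝒰)) => κ p.2.1 ^ 2 - 2 * κ (s.1 q') * κ p.2.1)
      (Set.Ioc (q : ℝ≥0) q' ×ˢ Set.univ) s.2.occ := i2.sub (i1.const_mul _)
  rw [gap, h1, h2, ← h3, ← integral_const_mul, ← integral_sub i2 (i1.const_mul _),
    ← integral_add i4 i3]
  congr 1
  funext p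
  ring

variable {Ω : Type w} [mΩ : MeasurableSpace Ω]

/-- The graph of a path over a time-control pair. -/
def stateControl (Y : ℝ≥0 → Ω → E) (ω : Ω) (p : ℝ≥0 × (Unit ⊕ 𝒰)) : ℝ≥0 × (E × (Unit ⊕ 𝒰)) :=
  (p.1, (Y p.1 ω, p.2))

theorem measurable_stateControl (Z : ProcessTriple Ω E 𝒰) (ω : Ω) :
    Measurable (stateControl (𝒰 := 𝒰) Z.Y ω) :=
  measurable_fst.prodMk (Z.measurable_Y_ctl ω)

/-- The occupation measure of state and control. -/
def ProcessTriple.occupation (Z : ProcessTriple Ω E 𝒰) (N : Ω → Measure (ℝ≥0 × (Unit ⊕ 𝒰)))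
    (hN : ∀ ω, (N ω).map Prod.fst = leb) (ω : Ω) : OccMeasure (E × (Unit ⊕ 𝒰)) :=
  OccMeasure.ofMeasure ((N ω).map (stateControl Z.Y ω)) (by
    rw [Measure.map_map measurable_fst (measurable_stateControl Z ω)]
    exact hN ω)

theorem ProcessTriple.measurable_occupation (Z : ProcessTriple Ω E 𝒰)
    {N : Ω → Measure (ℝ≥0 × (Unit ⊕ 𝒰))} (hN : ∀ ω, (N ω).map Prod.fst = leb)
    (hNm : Measurable N) : Measurable (Z.occupation N hN) := by
  have hw : Measurable fun p : ℝ≥0 × (Unit ⊕ 𝒰) => (timeWeight p.1 : ℝ≥0∞) :=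
    (measurable_timeWeight.comp measurable_fst).coe_nnreal_ennreal
  have hQm : Measurable fun ω => (N ω).withDensity fun p => (timeWeight p.1 : ℝ≥0∞) := by
    refine Measure.measurable_of_measurable_coe _ fun S hS => ?_
    simp_rw [withDensity_apply _ hS, ← lintegral_indicator hS]
    exact (Measure.measurable_lintegral (hw.indicator hS)).comp hNm
  -- The weighted control measures are finite, so they form an s-finite kernel and its measure of
  -- the `ω`-sections of a measurable set is measurable in `ω`.
  let Q : ProbabilityTheory.Kernel Ω (ℝ≥0 × (Unit ⊕ 𝒰)) := ⟨_, hQm⟩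
  have hQ : ProbabilityTheory.IsSFiniteKernel Q := by
    refine isSFiniteKernel_of_isFiniteMeasure _ fun ω => ?_
    have h := map_fst_withDensity (N ω) measurable_timeWeight.coe_nnreal_ennreal
    rw [hN ω] at h
    refine ⟨?_⟩
    have h2 := DFunLike.congr_fun h Set.univ
    rw [Measure.map_apply measurable_fst MeasurableSet.univ, Set.preimage_univ] at h2
    exact h2.trans_lt (measure_lt_top timeLaw _)
  refine measurable_comap_iff.2 (Measurable.subtype_mk ?_)
  refine Measure.measurable_of_measurable_coe _ fun S hS => ?_
  have hj : Measurable fun p : Ω × (ℝ≥0 × (Unit ⊕ 𝒰)) => stateControl Z.Y p.1 p.2 := by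
    have hY := measurable_uncurry_of_rightCont Z.measurable_Y (fun ω => (Z.cadlag_Y ω).1)
    exact measurable_snd.fst.prodMk
      ((hY.comp (measurable_snd.fst.prodMk measurable_fst)).prodMk measurable_snd.snd)
  have he : ∀ ω, ((N ω).map (stateControl Z.Y ω)).withDensity
      (fun p => (timeWeight p.1 : ℝ≥0∞)) S = Q ω (Prod.mk ω ⁻¹'
        ((fun p : Ω × (ℝ≥0 × (Unit ⊕ 𝒰)) => stateControl Z.Y p.1 p.2) ⁻¹' S)) := by
    intro ω
    have hm := measurable_stateControl Z ω
    change _ = ((N ω).withDensity fun p => (timeWeight p.1 : ℝ≥0∞)) (stateControl Z.Y ω ⁻¹' S)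
    rw [withDensity_apply _ hS, withDensity_apply _ (hm hS), setLIntegral_map hS
      (f := fun p : ℝ≥0 × (E × (Unit ⊕ 𝒰)) => (timeWeight p.1 : ℝ≥0∞))
      (measurable_timeWeight.comp measurable_fst).coe_nnreal_ennreal hm]
    rfl
  have := ProbabilityTheory.Kernel.measurable_kernel_prodMk_left (κ := Q) (hj hS)
  simp_rw [← he] at this
  exact this

theorem ProcessTriple.setIntegral_occupation (Z : ProcessTriple Ω E 𝒰)
    {N : Ω → Measure (ℝ≥0 × (Unit ⊕ 𝒰))} (hN : ∀ ω, (N ω).map Prod.fst = leb) (ω : Ω)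
    {S : Set ℝ≥0} (hS : MeasurableSet S) {F : ℝ≥0 × (E × (Unit ⊕ 𝒰)) → ℝ} (hF : Measurable F) :
    ∫ p in S ×ˢ Set.univ, F p ∂(Z.occupation N hN ω).occ =
      ∫ p in S ×ˢ Set.univ, F (p.1, (Z.Y p.1 ω, p.2)) ∂(N ω) := by
  rw [occupation, OccMeasure.occ_ofMeasure, setIntegral_map (hS.prod MeasurableSet.univ)
    hF.aestronglyMeasurable (measurable_stateControl Z ω).aemeasurable]
  congr 2

/-- The relaxed path of a triple of processes. -/
def ProcessTriple.relaxed (Z : ProcessTriple Ω E 𝒰) (N : Ω → Measure (ℝ≥0 × (Unit ⊕ 𝒰)))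
    (hN : ∀ ω, (N ω).map Prod.fst = leb) (ω : Ω) : RelaxedPath E 𝒰 :=
  (fun q : ℚ≥0 => Z.Y q ω, Z.occupation N hN ω)

theorem ProcessTriple.measurable_relaxed (Z : ProcessTriple Ω E 𝒰)
    {N : Ω → Measure (ℝ≥0 × (Unit ⊕ 𝒰))} (hN : ∀ ω, (N ω).map Prod.fst = leb)
    (hNm : Measurable N) : Measurable (Z.relaxed N hN) :=
  (measurable_pi_lambda _ fun q : ℚ≥0 => Z.measurable_Y q).prodMk (Z.measurable_occupation hN hNm)

/-- `OccMeasure` demands a Lebesgue time marginal for every `ω`, whereas a solution has it only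
almost surely. On an exceptional null set the control measure is replaced by Lebesgue measure
carried by the control `Sum.inl ()`. -/
theorem exists_control_modification {D : ControlledData E 𝒰} {P : Measure Ω}
    {Z : ProcessTriple Ω E 𝒰} (hZ : IsControlledSolution D P Z) :
    ∃ N : Ω → Measure (ℝ≥0 × (Unit ⊕ 𝒰)), Measurable N ∧ (∀ ω, (N ω).map Prod.fst = leb) ∧
      ∀ᵐ ω ∂P, N ω = Z.ctl ω := by
  classical
  obtain ⟨G, hG, hGm, hGc⟩ := ((isControlledSolution_iff D P Z).1 hZ).1.exists_measurable_mem
  have hinl : Measurable fun s : ℝ≥0 => ((s, Sum.inl ()) : ℝ≥0 × (Unit ⊕ 𝒰)) :=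
    measurable_id.prodMk measurable_const
  refine ⟨fun ω => if ω ∈ G then Z.ctl ω else leb.map fun s => (s, Sum.inl ()),
    Measurable.ite hGm Z.measurable_ctl measurable_const, fun ω => ?_, ?_⟩
  · dsimp only
    by_cases hω : ω ∈ G
    · rw [if_pos hω]
      have h1 : ∀ t : ℝ≥0, (Z.ctl ω).map Prod.fst (Set.Iic t) = t := fun t => by
        rw [Measure.map_apply measurable_fst measurableSet_Iic, ← hGc ω hω t]
        congr 1
        ext p
        simp
      exact measure_ext_Iic (fun t => by rw [h1]; exact ENNReal.coe_ne_top)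
        fun t => by rw [h1, leb_Iic]
    · rw [if_neg hω, Measure.map_map measurable_fst hinl]
      exact Measure.map_id
  · filter_upwards [hG] with ω hω
    exact if_pos hω

theorem ProcessTriple.upToIntegral_occupation (Z : ProcessTriple Ω E 𝒰)
    {N : Ω → Measure (ℝ≥0 × (Unit ⊕ 𝒰))} (hN : ∀ ω, (N ω).map Prod.fst = leb) {ω : Ω}
    (hω : N ω = Z.ctl ω) {φ : E × (Unit ⊕ 𝒰) → ℝ} (hφ : Measurable φ) (t : ℝ≥0) :
    (Z.occupation N hN ω).upToIntegral t φ = Z.drift φ t ω := by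
  rw [OccMeasure.upToIntegral, Z.setIntegral_occupation hN ω measurableSet_Iic
    (F := fun p => φ p.2) (hφ.comp measurable_snd), hω]
  rfl

theorem ProcessTriple.drift_congr {D : ControlledData E 𝒰} (Z : ProcessTriple Ω E 𝒰) {ω : Ω}
    (hω : ∀ᵐ p ∂(Z.ctl ω), (Z.Y p.1 ω, p.2) ∈ D.constraint) {φ ψ : E × (Unit ⊕ 𝒰) → ℝ}
    (h : ∀ k ∈ D.constraint, φ k = ψ k) (t : ℝ≥0) : Z.drift φ t ω = Z.drift ψ t ω :=
  integral_congr_ae (ae_restrict_of_ae (hω.mono fun _ hp => h _ hp))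

theorem ProcessTriple.integral_relaxed {P : Measure Ω} (Z : ProcessTriple Ω E 𝒰)
    {N : Ω → Measure (ℝ≥0 × (Unit ⊕ 𝒰))} (hN : ∀ ω, (N ω).map Prod.fst = leb) (hNm : Measurable N)
    {F : RelaxedPath E 𝒰 → ℝ} (hF : Continuous F) :
    ∫ s, F s ∂(P.map (Z.relaxed N hN)) = ∫ ω, F (Z.relaxed N hN ω) ∂P :=
  integral_map (Z.measurable_relaxed hN hNm).aemeasurable hF.measurable.aestronglyMeasurable

theorem ProcessTriple.stronglyMeasurable_coord (Z : ProcessTriple Ω E 𝒰) {r : ℚ≥0} {t : ℝ≥0}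
    (hr : (r : ℝ≥0) ≤ t) (i : C(E, ℝ) ⊕ C(E × (Unit ⊕ 𝒰), ℝ)) :
    StronglyMeasurable[Z.filtration t]
      (Sum.elim (fun κ ω => κ (Z.Y r ω)) (fun φ ω => Z.drift φ r ω) i) := by
  rcases i with κ | φ
  · exact (κ.continuous.measurable.comp (Z.measurable_Y_filtration hr)).stronglyMeasurable
  · exact (Z.stronglyMeasurable_drift φ.continuous.measurable r).mono (Z.filtration.mono hr)

theorem ProcessTriple.coord_relaxed (Z : ProcessTriple Ω E 𝒰)
    {N : Ω → Measure (ℝ≥0 × (Unit ⊕ 𝒰))} (hN : ∀ ω, (N ω).map Prod.fst = leb) {ω : Ω}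
    (hω : N ω = Z.ctl ω) (r : ℚ≥0) (i : C(E, ℝ) ⊕ C(E × (Unit ⊕ 𝒰), ℝ)) :
    RelaxedPath.coord r i (Z.relaxed N hN ω) =
      Sum.elim (fun κ ω => κ (Z.Y r ω)) (fun φ ω => Z.drift φ r ω) i ω := by
  rcases i with κ | φ
  · rfl
  · exact Z.upToIntegral_occupation hN hω φ.continuous.measurable r

/-- The time marginal is Lebesgue measure, so Fubini's theorem turns the expected gap into a time
integral of mean-square increments. -/
theorem integral_gap_relaxed_le {P : Measure Ω} [IsProbabilityMeasure P] (Z : ProcessTriple Ω E 𝒰)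
    {N : Ω → Measure (ℝ≥0 × (Unit ⊕ 𝒰))} (hN : ∀ ω, (N ω).map Prod.fst = leb) (κ : C(E, ℝ)) {ε : ℝ}
    {q q' : ℚ≥0} (hqq : q ≤ q') (h : ∀ s : ℝ≥0, q ≤ s → s ≤ q' →
      ∫ ω, (κ (Z.Y s ω) - κ (Z.Y q' ω)) ^ 2 ∂P ≤ ε) :
    ∫ ω, RelaxedPath.gap κ q q' (Z.relaxed N hN ω) ∂P ≤ ε * ((q' : ℝ) - q) := by
  have hq : (q : ℝ≥0) ≤ q' := by exact_mod_cast hqq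
  have hY : Measurable fun p : Ω × ℝ≥0 => Z.Y p.2 p.1 :=
    (measurable_uncurry_of_rightCont Z.measurable_Y (fun ω => (Z.cadlag_Y ω).1)).comp
      measurable_swap
  have hF : Measurable fun p : Ω × ℝ≥0 => (κ (Z.Y p.2 p.1) - κ (Z.Y q' p.1)) ^ 2 :=
    ((κ.continuous.measurable.comp hY).sub
      (κ.continuous.measurable.comp ((Z.measurable_Y q').comp measurable_fst))).pow_const 2
  have hb : ∀ p : Ω × ℝ≥0, ‖(κ (Z.Y p.2 p.1) - κ (Z.Y q' p.1)) ^ 2‖ ≤ (2 * ‖κ‖) ^ 2 := by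
    intro p
    rw [norm_pow]
    refine pow_le_pow_left₀ (norm_nonneg _) ((norm_sub_le _ _).trans ?_) 2
    linarith [κ.norm_coe_le_norm (Z.Y p.2 p.1), κ.norm_coe_le_norm (Z.Y q' p.1)]
  have hIoc : leb (Set.Ioc (q : ℝ≥0) q') = (q' - q : ℝ≥0) := leb_Ioc hq
  have hfin : IsFiniteMeasure (leb.restrict (Set.Ioc (q : ℝ≥0) q')) :=
    ⟨by rw [Measure.restrict_apply_univ, hIoc]; exact ENNReal.coe_lt_top⟩
  have he : ∀ ω, RelaxedPath.gap κ q q' (Z.relaxed N hN ω) =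
      ∫ s in Set.Ioc (q : ℝ≥0) q', (κ (Z.Y s ω) - κ (Z.Y q' ω)) ^ 2 ∂leb := by
    intro ω
    have hm : Measurable fun s : ℝ≥0 => (κ (Z.Y s ω) - κ (Z.Y q' ω)) ^ 2 :=
      hF.comp (measurable_const.prodMk measurable_id)
    rw [RelaxedPath.gap_eq κ hqq]
    refine (Z.setIntegral_occupation hN ω measurableSet_Ioc
      (F := fun p => (κ p.2.1 - κ (Z.Y q' ω)) ^ 2)
      (((κ.continuous.measurable.comp (measurable_fst.comp measurable_snd)).sub_const
        _).pow_const 2)).trans ?_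
    rw [← hN ω, setIntegral_map measurableSet_Ioc hm.aestronglyMeasurable
      measurable_fst.aemeasurable]
    congr 2
    ext p
    simp
  simp_rw [he]
  rw [integral_integral_swap (Integrable.of_bound hF.aestronglyMeasurable _ (ae_of_all _ hb))]
  calc ∫ s in Set.Ioc (q : ℝ≥0) q', ∫ ω, (κ (Z.Y s ω) - κ (Z.Y q' ω)) ^ 2 ∂P ∂leb
      ≤ ∫ _ in Set.Ioc (q : ℝ≥0) q', ε ∂leb := by
        refine integral_mono_of_nonneg (ae_of_all _ fun s => integral_nonneg fun ω => sq_nonneg _)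
          (integrable_const _) ?_
        exact (ae_restrict_mem measurableSet_Ioc).mono fun s hs => h s hs.1.le hs.2
    _ = ε * ((q' : ℝ) - q) := by
        rw [setIntegral_const, measureReal_def, hIoc, ENNReal.coe_toReal, NNReal.coe_sub hq,
          smul_eq_mul, mul_comm]
        rfl

/-- The law of the relaxed path of a solution is a relaxed solution. -/
theorem isRelaxedSolution_map {D : ControlledData E 𝒰} {P : Measure Ω} [IsProbabilityMeasure P]
    {Z : ProcessTriple Ω E 𝒰} (hZ : IsControlledSolution D P Z)
    {N : Ω → Measure (ℝ≥0 × (Unit ⊕ 𝒰))} (hN : ∀ ω, (N ω).map Prod.fst = leb) (hNm : Measurable N)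
    (hNZ : ∀ᵐ ω ∂P, N ω = Z.ctl ω) {δ : C(E, ℝ) → ℝ → ℝ≥0}
    (hδ : ∀ κ ε, 0 < ε → ∀ s t : ℝ≥0, s ≤ t → (t : ℝ) - s ≤ δ κ ε →
      ∫ ω, (κ (Z.Y s ω) - κ (Z.Y t ω)) ^ 2 ∂P ≤ ε) :
    IsRelaxedSolution D δ (P.map (Z.relaxed N hN)) where
  integral_testIncrement f G hG q q' hq r J c hr hc hc1 := by
    obtain ⟨-, h2, h3⟩ := (isControlledSolution_iff D P Z).1 hZ
    obtain ⟨g, h, hA, hB, hG⟩ := hG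
    rw [Z.integral_relaxed hN hNm (RelaxedPath.continuous_testIncrement f G q q' r J hc)]
    have hq' : (q : ℝ≥0) ≤ q' := by exact_mod_cast hq
    have hFm : StronglyMeasurable[Z.filtration q] fun ω => ∏ i ∈ J,
        c i (Sum.elim (fun κ ω => κ (Z.Y (r i.1) ω)) (fun φ ω => Z.drift φ (r i.1) ω) i.2 ω) :=
      Finset.stronglyMeasurable_fun_prod J fun i hi => (hc i).comp_stronglyMeasurable
        (Z.stronglyMeasurable_coord (by exact_mod_cast hr i hi) i.2)
    have hm := integral_sub_mul_eq_zero_of_martingale (h3 f g h hA hB) hq' hFm (C := 1)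
      (fun ω => by
        rw [Finset.abs_prod]
        exact Finset.prod_le_one (fun i _ => abs_nonneg _) fun i _ => hc1 i _)
    rw [← hm]
    refine integral_congr_ae ?_
    filter_upwards [h2, hNZ] with ω hω hNω
    -- The continuous `G` may replace the generator function because the control measure lives on
    -- the constraint set.
    have hd : ∀ t, (Z.occupation N hN ω).upToIntegral t G = Z.drift (D.genFun g h) t ω := fun t =>
      (Z.upToIntegral_occupation hN hNω G.continuous.measurable t).trans (Z.drift_congr hω hG t)
    rw [RelaxedPath.testIncrement]
    simp_rw [Z.coord_relaxed hN hNω]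
    congr 1
    change f (Z.Y q' ω) - f (Z.Y q ω) - ((Z.occupation N hN ω).upToIntegral q' G -
      (Z.occupation N hN ω).upToIntegral q G) = _
    rw [hd, hd]
    ring
  integral_constraint t d hd := by
    obtain ⟨-, h2, -⟩ := (isControlledSolution_iff D P Z).1 hZ
    rw [Z.integral_relaxed hN hNm (RelaxedPath.continuous_upToIntegral t d.continuous)]
    refine integral_eq_zero_of_ae ?_
    filter_upwards [h2, hNZ] with ω hω hNω
    refine (Z.upToIntegral_occupation hN hNω d.continuous.measurable t).trans ?_
    rw [Z.drift_congr hω (ψ := fun _ => 0) hd]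
    exact integral_zero _ _
  integral_gap_le κ ε hε q q' hq hqδ := by
    rw [Z.integral_relaxed hN hNm (RelaxedPath.continuous_gap κ q q')]
    refine integral_gap_relaxed_le Z hN κ hq fun s hs hs' => ?_
    refine hδ κ ε hε s q' hs' (le_trans ?_ hqδ)
    have h1 : ((q : ℝ≥0) : ℝ) ≤ s := NNReal.coe_le_coe.2 hs
    have h2 : (((q : ℝ≥0) : ℝ)) = q := rfl
    have h3 : (((q' : ℝ≥0) : ℝ)) = q' := rfl
    rw [h3]
    linarith

end OfSolution

/-! ### Upcrossings, one-sided limits along the rationals, and càdlàg regularization. -/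

section RationalLimits

/-- Rational times decreasing strictly to `t`. -/
def rightRat (t : ℝ≥0) : Filter ℚ≥0 := comap (fun q : ℚ≥0 => (q : ℝ≥0)) (𝓝[>] t)

/-- Rational times increasing strictly to `t`. -/
def leftRat (t : ℝ≥0) : Filter ℚ≥0 := comap (fun q : ℚ≥0 => (q : ℝ≥0)) (𝓝[<] t)

theorem tendsto_gridSucc_rightRat (t : ℝ≥0) :
    Tendsto (fun n => gridSucc n t) atTop (rightRat t) :=
  tendsto_comap_iff.2 (tendsto_gridSucc t)

instance (t : ℝ≥0) : (rightRat t).NeBot := (tendsto_gridSucc_rightRat t).neBot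

theorem eventually_rightRat {t s : ℝ≥0} (h : t < s) :
    ∀ᶠ q : ℚ≥0 in rightRat t, t < q ∧ (q : ℝ≥0) < s :=
  preimage_mem_comap (Ioo_mem_nhdsGT h)

theorem eventually_leftRat {t s : ℝ≥0} (h : s < t) :
    ∀ᶠ q : ℚ≥0 in leftRat t, s < q ∧ (q : ℝ≥0) < t :=
  preimage_mem_comap (Ioo_mem_nhdsLT h)

/-- `UpChain a b u N s` : the path `u` has `N` successive upcrossings from below `a` to above `b`
before time `s`. -/
inductive UpChain (a b : ℝ) (u : ℚ≥0 → ℝ) : ℕ → ℚ≥0 → Prop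
  | zero (s : ℚ≥0) : UpChain a b u 0 s
  | succ {N : ℕ} {p q r s : ℚ≥0} : UpChain a b u N p → p < q → u q < a → q ≤ r → b < u r →
      r ≤ s → UpChain a b u (N + 1) s

variable {a b : ℝ} {u : ℚ≥0 → ℝ}

theorem UpChain.mono {N : ℕ} {s s' : ℚ≥0} (h : UpChain a b u N s) (hs : s ≤ s') :
    UpChain a b u N s' := by
  cases h with
  | zero => exact UpChain.zero _
  | succ h hpq hq hqr hr hrs => exact UpChain.succ h hpq hq hqr hr (hrs.trans hs)

theorem exists_upChain_of_frequently_leftRat {t : ℝ≥0} (h1 : ∃ᶠ q in leftRat t, u q < a)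
    (h2 : ∃ᶠ q in leftRat t, b < u q) (N : ℕ) : ∃ r : ℚ≥0, (r : ℝ≥0) < t ∧ UpChain a b u N r := by
  have ht : 0 < t := by
    rcases eq_or_ne t 0 with rfl | h
    · refine absurd h1 ?_
      have : leftRat 0 = ⊥ := by
        have h0 : Set.Iio (0 : ℝ≥0) = ∅ := by ext x; simp
        rw [leftRat, h0, nhdsWithin_empty, comap_bot]
      simp [this]
    · exact pos_iff_ne_zero.2 h
  induction N with
  | zero =>
    obtain ⟨q, -, hq⟩ := (h1.and_eventually (eventually_leftRat ht)).exists
    exact ⟨q, hq.2, UpChain.zero _⟩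
  | succ N ih =>
    obtain ⟨r, hrt, hr⟩ := ih
    obtain ⟨q, hqa, hq⟩ := (h1.and_eventually (eventually_leftRat hrt)).exists
    obtain ⟨q', hqb, hq'⟩ := (h2.and_eventually (eventually_leftRat hq.2)).exists
    exact ⟨q', hq'.2, hr.succ (by exact_mod_cast hq.1) hqa (by exact_mod_cast hq'.1.le) hqb le_rfl⟩

theorem upChain_of_frequently_rightRat {t : ℝ≥0} (h1 : ∃ᶠ q in rightRat t, u q < a)
    (h2 : ∃ᶠ q in rightRat t, b < u q) {T : ℚ≥0} (hT : t < T) (N : ℕ) : UpChain a b u N T := by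
  -- Crossings accumulate at `t` from the right, so they are found in reverse order. The invariant
  -- says that any chain ending before `r` can be prolonged by `N` crossings already located between
  -- `r` and `T`.
  have key : ∃ r : ℚ≥0, t < r ∧ ∀ k p, p < r → UpChain a b u k p → UpChain a b u (k + N) T := by
    induction N with
    | zero => exact ⟨T, hT, fun k p hp h => h.mono hp.le⟩
    | succ N ih =>
      obtain ⟨r, htr, hr⟩ := ih
      obtain ⟨q', hqb, hq'⟩ := (h2.and_eventually (eventually_rightRat htr)).exists
      obtain ⟨q, hqa, hq⟩ := (h1.and_eventually (eventually_rightRat hq'.1)).exists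
      refine ⟨q, hq.1, fun k p hp h => ?_⟩
      rw [← Nat.add_assoc, Nat.add_right_comm]
      exact hr _ _ (by exact_mod_cast hq'.2) (h.succ hp hqa (by exact_mod_cast hq.2.le) hqb le_rfl)
  obtain ⟨r, htr, hr⟩ := key
  have := hr 0 0 (by exact_mod_cast (zero_le (a := t)).trans_lt htr) (UpChain.zero 0)
  rwa [Nat.zero_add] at this

theorem exists_tendsto_of_not_upChain (hb : ∀ T : ℕ, ∃ C, ∀ q ≤ (T : ℚ≥0), |u q| ≤ C)
    (h : ∀ a b : ℚ, a < b → ∀ T : ℕ, ¬ ∀ N, UpChain a b u N T) (t : ℝ≥0) :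
    (∃ x, Tendsto u (rightRat t) (𝓝 x)) ∧ ∃ x, Tendsto u (leftRat t) (𝓝 x) := by
  obtain ⟨T, hT⟩ := exists_nat_gt t
  have hT' : t < ((T : ℚ≥0) : ℝ≥0) := by simpa using hT
  obtain ⟨C, hC⟩ := hb T
  have bdd : ∀ l : Filter ℚ≥0, (∀ᶠ q in l, q ≤ (T : ℚ≥0)) →
      (∀ a b : ℚ, a < b → ¬ ((∃ᶠ q in l, u q < a) ∧ ∃ᶠ q in l, (b : ℝ) < u q)) →
      ∃ x, Tendsto u l (𝓝 x) := by
    intro l hl hab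
    refine tendsto_of_no_upcrossings (s := Set.range ((↑) : ℚ → ℝ)) Rat.denseRange_cast ?_
      ⟨C, ?_⟩ ⟨-C, ?_⟩
    · rintro _ ⟨a, rfl⟩ _ ⟨b, rfl⟩ hlt
      exact hab a b (by exact_mod_cast hlt)
    · exact eventually_map.2 (hl.mono fun q hq => (abs_le.1 (hC q hq)).2)
    · exact eventually_map.2 (hl.mono fun q hq => (abs_le.1 (hC q hq)).1)
  refine ⟨bdd _ ((eventually_rightRat hT').mono fun q hq => by exact_mod_cast hq.2.le) ?_,
    bdd _ ?_ ?_⟩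
  · exact fun a b hab hf => h a b hab T fun N => upChain_of_frequently_rightRat hf.1 hf.2 hT' N
  · have hlt : ∀ᶠ q : ℚ≥0 in leftRat t, (q : ℝ≥0) < t :=
      preimage_mem_comap self_mem_nhdsWithin
    refine hlt.mono fun q hq => ?_
    exact_mod_cast (hq.trans hT').le
  · intro a b hab hf
    refine h a b hab T fun N => ?_
    obtain ⟨r, hr, hc⟩ := exists_upChain_of_frequently_leftRat hf.1 hf.2 N
    exact hc.mono (by exact_mod_cast (hr.trans hT').le)

/-- The denominator of `r` divides `n!`. This is the point of factorial grids: every rational lies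
on all sufficiently fine ones. -/
theorem exists_grid_eq (r : ℚ≥0) {n : ℕ} (h : r.den ≤ n) :
    ∃ k : ℕ, (k : ℚ≥0) / (n.factorial : ℚ≥0) = r := by
  obtain ⟨m, hm⟩ := Nat.dvd_factorial r.den_pos h
  refine ⟨r.num * m, ?_⟩
  have hd : (r.den : ℚ≥0) ≠ 0 := by exact_mod_cast r.den_pos.ne'
  have hn : (n.factorial : ℚ≥0) ≠ 0 := by exact_mod_cast n.factorial_ne_zero
  have hm0 : (m : ℚ≥0) ≠ 0 := by
    rintro h0
    apply hn
    rw [hm, Nat.cast_mul, h0, mul_zero]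
  rw [hm, Nat.cast_mul, Nat.cast_mul, mul_div_mul_right _ _ hm0, NNRat.num_div_den]

/-- A chain involves finitely many rational times, all of them on the grid once `n` is large, so the
discrete upcrossing count sees each of its crossings. -/
theorem UpChain.eventually_le_upcrossingsBefore {Ω : Type*} {M : ℚ≥0 → Ω → ℝ} {ω : Ω} (hab : a < b)
    {N : ℕ} {s : ℚ≥0} (h : UpChain a b (fun q => M q ω) N s) : ∀ᶠ n : ℕ in atTop, ∀ k : ℕ,
      s < (k : ℚ≥0) / (n.factorial : ℚ≥0) →
      N ≤ upcrossingsBefore a b (fun k : ℕ => M ((k : ℚ≥0) / (n.factorial : ℚ≥0))) k ω := by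
  induction h with
  | zero => exact Eventually.of_forall fun n k _ => Nat.zero_le _
  | @succ N p q r s _ hpq hq hqr hr hrs ih =>
    filter_upwards [ih, eventually_ge_atTop q.den, eventually_ge_atTop r.den] with n hn hnq hnr k hk
    obtain ⟨i, hi⟩ := exists_grid_eq q hnq
    obtain ⟨j, hj⟩ := exists_grid_eq r hnr
    have hpos : (0 : ℚ≥0) < (n.factorial : ℚ≥0) := by exact_mod_cast n.factorial_pos
    have hij : i ≤ j := by
      rw [← hi, ← hj, div_le_div_iff_of_pos_right hpos] at hqr
      exact_mod_cast hqr
    have hjk : j + 1 ≤ k := by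
      have := hrs.trans_lt hk
      rw [← hj, div_lt_div_iff_of_pos_right hpos] at this
      exact_mod_cast this
    have h1 := upcrossingsBefore_lt_of_exists_upcrossing (a := a) (b := b) (ω := ω)
      (f := fun k : ℕ => M ((k : ℚ≥0) / (n.factorial : ℚ≥0))) hab (le_refl i) (by rw [hi]; exact hq)
      hij (by rw [hj]; exact hr)
    have h2 := upcrossingsBefore_mono (f := fun k : ℕ => M ((k : ℚ≥0) / (n.factorial : ℚ≥0)))
      hab hjk ω
    exact (hn i (by rw [hi]; exact hpq)).trans_lt (h1.trans_le h2)

/-- A locally bounded martingale along the rationals has limits along rationals at all real times,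
from both sides. -/
theorem ae_exists_tendsto_of_martingale {Ω : Type*} {mΩ : MeasurableSpace Ω} {P : Measure Ω}
    [IsProbabilityMeasure P] {ℱ : Filtration ℚ≥0 mΩ} {M : ℚ≥0 → Ω → ℝ} (hM : Martingale M ℱ P)
    (hb : ∀ T : ℕ, ∃ C, ∀ q ≤ (T : ℚ≥0), ∀ ω, |M q ω| ≤ C) :
    ∀ᵐ ω ∂P, ∀ t : ℝ≥0, (∃ x, Tendsto (fun q => M q ω) (rightRat t) (𝓝 x)) ∧
      ∃ x, Tendsto (fun q => M q ω) (leftRat t) (𝓝 x) := by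
  have key : ∀ᵐ ω ∂P, ∀ (a b : ℚ), a < b → ∀ T : ℕ, ¬ ∀ N, UpChain a b (fun q => M q ω) N T := by
    rw [ae_all_iff]; intro a
    rw [ae_all_iff]; intro b
    by_cases hab' : a < b
    swap
    · exact ae_of_all _ fun ω h => absurd h hab'
    suffices h : ∀ᵐ ω ∂P, ∀ T : ℕ, ¬ ∀ N, UpChain a b (fun q => M q ω) N T from
      h.mono fun ω h _ => h
    rw [ae_all_iff]; intro T
    have hab : (a : ℝ) < b := by exact_mod_cast hab'
    obtain ⟨C, hC⟩ := hb (T + 1)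
    set f : ℕ → ℕ → Ω → ℝ := fun n k => M ((k : ℚ≥0) / (n.factorial : ℚ≥0)) with hf
    have hgm : ∀ n : ℕ, Monotone fun k : ℕ => (k : ℚ≥0) / (n.factorial : ℚ≥0) := fun n i j hij =>
      div_le_div_of_nonneg_right (by exact_mod_cast hij) (by positivity)
    let 𝒢 : ℕ → Filtration ℕ mΩ := fun n => ⟨fun k => ℱ ((k : ℚ≥0) / (n.factorial : ℚ≥0)),
      fun i j hij => ℱ.mono (hgm n hij), fun k => ℱ.le _⟩
    have hmart : ∀ n, Martingale (f n) (𝒢 n) P := fun n =>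
      ⟨fun k => hM.1 _, fun i j hij => hM.2 _ _ (hgm n hij)⟩
    -- The horizon is `T + 1` because the comparison of chains with counts needs a grid time
    -- strictly after `T`.
    set U : ℕ → Ω → ℕ := fun n => upcrossingsBefore a b (f n) ((T + 1) * n.factorial) with hU
    have hUm : ∀ n, Measurable (U n) := fun n => (hmart n).1.measurable_upcrossingsBefore hab
    -- Doob's upcrossing inequality, with a bound independent of the mesh.
    have hbound : ∀ n, ∫⁻ ω, (U n ω : ℝ≥0∞) ∂P ≤ ENNReal.ofReal ((C + |(a : ℝ)|) / (b - a)) := by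
      intro n
      have h1 := (hmart n).submartingale.mul_integral_upcrossingsBefore_le_integral_pos_part
        (a : ℝ) b ((T + 1) * n.factorial)
      have hle : ∀ ω, |M ((((T + 1) * n.factorial : ℕ) : ℚ≥0) / (n.factorial : ℚ≥0)) ω| ≤ C := by
        refine fun ω => hC _ (le_of_eq ?_) ω
        have : (n.factorial : ℚ≥0) ≠ 0 := by exact_mod_cast n.factorial_ne_zero
        push_cast
        field_simp
      have h2 : ∫ ω, (f n ((T + 1) * n.factorial) ω - a)⁺ ∂P ≤ C + |(a : ℝ)| := by
        have h3 : ∀ ω, ‖(f n ((T + 1) * n.factorial) ω - a)⁺‖ ≤ C + |(a : ℝ)| := by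
          intro ω
          rw [Real.norm_eq_abs, abs_of_nonneg (posPart_nonneg _)]
          refine le_trans (sup_le (le_abs_self _) (abs_nonneg _)) ((abs_sub _ _).trans ?_)
          exact add_le_add (hle ω) le_rfl
        have h4 := norm_integral_le_of_norm_le_const (μ := P) (ae_of_all _ h3)
        rw [probReal_univ, mul_one] at h4
        exact (le_abs_self _).trans h4
      have hi : Integrable (fun ω => (U n ω : ℝ)) P := by
        refine Integrable.of_bound (C := ((T + 1) * n.factorial : ℕ))
          (measurable_from_top.comp (hUm n)).aestronglyMeasurable (ae_of_all _ fun ω => ?_)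
        rw [Real.norm_eq_abs, Nat.abs_cast]
        exact Nat.cast_le.2 (upcrossingsBefore_le (f n) ω hab)
      have h5 : ∫ ω, (U n ω : ℝ) ∂P ≤ (C + |(a : ℝ)|) / (b - a) := by
        rw [le_div_iff₀ (sub_pos.2 hab), mul_comm]
        exact h1.trans h2
      calc ∫⁻ ω, (U n ω : ℝ≥0∞) ∂P = ∫⁻ ω, ENNReal.ofReal (U n ω) ∂P := by simp
        _ = ENNReal.ofReal (∫ ω, (U n ω : ℝ) ∂P) :=
          (ofReal_integral_eq_lintegral_ofReal hi (ae_of_all _ fun ω => Nat.cast_nonneg _)).symm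
        _ ≤ _ := ENNReal.ofReal_le_ofReal h5
    have hUm' : ∀ n, Measurable fun ω => (U n ω : ℝ≥0∞) := fun n =>
      measurable_from_top.comp (hUm n)
    -- By Fatou's lemma the `liminf` of the counts is almost surely finite, whereas chains of every
    -- length would make it infinite.
    have hfin : ∫⁻ ω, liminf (fun n => (U n ω : ℝ≥0∞)) atTop ∂P < ∞ := by
      refine (lintegral_liminf_le hUm').trans_lt ?_
      refine lt_of_le_of_lt (liminf_le_of_frequently_le' (Frequently.of_forall hbound)) ?_
      exact ENNReal.ofReal_lt_top
    filter_upwards [ae_lt_top (.liminf hUm') hfin.ne] with ω hω hN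
    refine hω.ne (ENNReal.eq_top_of_forall_nnreal_le fun r => ?_)
    obtain ⟨N, hrN⟩ := exists_nat_ge r
    have hrN' : (r : ℝ≥0∞) ≤ (N : ℝ≥0∞) := by exact_mod_cast hrN
    refine hrN'.trans (le_liminf_of_le (by isBoundedDefault) ?_)
    filter_upwards [(hN N).eventually_le_upcrossingsBefore hab] with n hn
    have h6 := hn ((T + 1) * n.factorial) (by
      have : (n.factorial : ℚ≥0) ≠ 0 := by exact_mod_cast n.factorial_ne_zero
      push_cast
      rw [mul_div_cancel_right₀ _ this]
      exact lt_add_one _)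
    exact_mod_cast h6
  filter_upwards [key] with ω hω t
  refine exists_tendsto_of_not_upChain (fun T => ?_) hω t
  obtain ⟨C, hC⟩ := hb T
  exact ⟨C, fun q hq => hC q hq ω⟩

/-- In a compact space, convergence is detected by a dense set of continuous functions. -/
theorem eq_of_dense_of_forall_eq {X : Type*} [MetricSpace X] [CompactSpace X] {S : Set C(X, ℝ)}
    (hS : Dense S) {x z : X} (hf : ∀ f ∈ S, f x = f z) : x = z := by
  have hall : ∀ f : C(X, ℝ), f x = f z := fun f => by
    have hcl : IsClosed {f : C(X, ℝ) | f x = f z} :=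
      isClosed_eq (continuous_eval_const x) (continuous_eval_const z)
    exact hcl.closure_subset_iff.2 hf (hS f)
  have := hall ⟨fun w => dist w z, continuous_id.dist continuous_const⟩
  simpa using this

/-- Compactness gives a cluster point. All cluster points share the limiting value of each `f` in
the dense set, hence coincide, and a unique cluster point in a compact space is a limit. -/
theorem exists_tendsto_of_dense {X ι : Type*} [MetricSpace X] [CompactSpace X] {l : Filter ι}
    {y : ι → X} {S : Set C(X, ℝ)} (hS : Dense S)
    (h : ∀ f ∈ S, ∃ c, Tendsto (fun i => f (y i)) l (𝓝 c)) [Nonempty X] :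
    ∃ z, Tendsto y l (𝓝 z) := by
  rcases l.eq_or_neBot with rfl | hl
  -- The trivial filter does occur: `leftRat 0` has no times below `0`.
  · exact ⟨Classical.arbitrary X, tendsto_bot⟩
  obtain ⟨z, hz⟩ := exists_clusterPt_of_compactSpace (map y l)
  refine ⟨z, le_nhds_of_unique_clusterPt fun x hx => eq_of_dense_of_forall_eq hS fun f hf => ?_⟩
  obtain ⟨c, hc⟩ := h f hf
  have hcl : ∀ w, ClusterPt w (map y l) → f w = c := fun w hw => by
    have h1 : ClusterPt (f w) (map f (map y l)) := hw.map f.continuous.continuousAt tendsto_map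
    exact eq_of_nhds_neBot (h1.mono hc)
  rw [hcl x hx, hcl z hz]

/-- By regularity closed neighbourhoods suffice. If `y` stays in a closed set along the rationals of
an interval next to `t`, then so do the right limits `R` at the interior real times. -/
theorem isCadlag_of_tendsto_rightRat {X : Type*} [TopologicalSpace X] [T3Space X]
    {y : ℚ≥0 → X} {R : ℝ≥0 → X} (hR : ∀ t, Tendsto y (rightRat t) (𝓝 (R t)))
    (hL : ∀ t, ∃ z, Tendsto y (leftRat t) (𝓝 z)) : IsCadlag R := by
  have mem : ∀ {W : Set X} {s : ℝ≥0}, IsClosed W → (∀ᶠ q in rightRat s, y q ∈ W) → R s ∈ W :=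
    fun hW h => hW.mem_of_tendsto (hR _) h
  constructor
  · intro t
    rw [← continuousWithinAt_Ioi_iff_Ici]
    refine ((closed_nhds_basis (R t)).tendsto_right_iff).2 fun W hW => ?_
    obtain ⟨A, hA, hAW⟩ := mem_comap.1 (hR t hW.1)
    obtain ⟨s, hs, hsA⟩ := mem_nhdsGT_iff_exists_Ioo_subset.1 hA
    filter_upwards [Ioo_mem_nhdsGT hs] with r hr
    refine mem hW.2 ((eventually_rightRat hr.2).mono fun q hq => ?_)
    exact hAW (hsA ⟨hr.1.trans hq.1, hq.2⟩)
  · intro t ht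
    obtain ⟨z, hz⟩ := hL t
    refine ⟨z, ((closed_nhds_basis z).tendsto_right_iff).2 fun W hW => ?_⟩
    obtain ⟨A, hA, hAW⟩ := mem_comap.1 (hz hW.1)
    obtain ⟨s, hs, hsA⟩ := (mem_nhdsLT_iff_exists_Ioo_subset' ht).1 hA
    filter_upwards [Ioo_mem_nhdsLT hs] with r hr
    refine mem hW.2 ((eventually_rightRat hr.2).mono fun q hq => ?_)
    exact hAW (hsA ⟨hr.1.trans hq.1, hq.2⟩)

/-- A process along the rationals with one-sided limits has a càdlàg regularization. -/
theorem exists_cadlag_regularization {Ω X : Type*} {mΩ : MeasurableSpace Ω} {P : Measure Ω}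
    [MetricSpace X] [MeasurableSpace X] [BorelSpace X] {y : ℚ≥0 → Ω → X}
    (hy : ∀ q, Measurable (y q))
    (h : ∀ᵐ ω ∂P, ∀ t : ℝ≥0, (∃ x, Tendsto (fun q => y q ω) (rightRat t) (𝓝 x)) ∧
      ∃ x, Tendsto (fun q => y q ω) (leftRat t) (𝓝 x)) :
    ∃ Y : ℝ≥0 → Ω → X, (∀ t, Measurable (Y t)) ∧ (∀ ω, IsCadlag fun t => Y t ω) ∧
      ∀ᵐ ω ∂P, ∀ t, Tendsto (fun q => y q ω) (rightRat t) (𝓝 (Y t ω)) := by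
  classical
  obtain ⟨G, hG, hGm, hGc⟩ := h.exists_measurable_mem
  -- On the exceptional null set the path is frozen at `y 0`, so that every path is càdlàg.
  let Y : ℝ≥0 → Ω → X := fun t ω =>
    if hω : ω ∈ G then ((hGc ω hω t).1).choose else y 0 ω
  have hYG : ∀ ω ∈ G, ∀ t, Tendsto (fun q => y q ω) (rightRat t) (𝓝 (Y t ω)) := by
    intro ω hω t
    simp only [Y, dif_pos hω]
    exact ((hGc ω hω t).1).choose_spec
  have hYG' : ∀ ω ∉ G, ∀ t, Y t ω = y 0 ω := fun ω hω t => dif_neg hω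
  refine ⟨Y, fun t => ?_, fun ω => ?_, ?_⟩
  · refine measurable_of_tendsto_metrizable (f := fun n ω =>
      if ω ∈ G then y (gridSucc n t) ω else y 0 ω) (fun n => Measurable.ite hGm (hy _) (hy 0)) ?_
    refine tendsto_pi_nhds.2 fun ω => ?_
    by_cases hω : ω ∈ G
    · simp only [if_pos hω]
      exact (hYG ω hω t).comp (tendsto_gridSucc_rightRat t)
    · simp only [if_neg hω, hYG' ω hω]
      exact tendsto_const_nhds
  · by_cases hω : ω ∈ G
    · exact isCadlag_of_tendsto_rightRat (hYG ω hω) fun t => (hGc ω hω t).2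
    · simp only [hYG' ω hω]
      exact ⟨fun t => continuousWithinAt_const, fun t _ => ⟨_, tendsto_const_nhds⟩⟩
  · filter_upwards [hG] with ω hω
    exact hYG ω hω

end RationalLimits

/-! ### Closed sets as zero sets, grid cells, and null times. -/

theorem exists_continuousMap_zero_iff {X : Type*} [MetricSpace X] {C : Set X} (hC : IsClosed C) :
    ∃ d : C(X, ℝ), (∀ x, 0 ≤ d x) ∧ ∀ x, d x = 0 ↔ x ∈ C := by
  rcases C.eq_empty_or_nonempty with rfl | hne
  · exact ⟨1, fun x => zero_le_one, fun x => by simp⟩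
  · exact ⟨⟨fun x => Metric.infDist x C, Metric.continuous_infDist_pt C⟩,
      fun x => Metric.infDist_nonneg, fun x => (hC.mem_iff_infDist_zero hne).symm⟩

theorem measurable_of_continuousMap_comp {Ω X : Type*} {m : MeasurableSpace Ω} [MetricSpace X]
    [MeasurableSpace X] [BorelSpace X] {y : Ω → X}
    (h : ∀ f : C(X, ℝ), Measurable fun ω => f (y ω)) : Measurable y := by
  refine measurable_of_isClosed fun C hC => ?_
  obtain ⟨d, -, hd⟩ := exists_continuousMap_zero_iff hC
  have : y ⁻¹' C = (fun ω => d (y ω)) ⁻¹' {0} := by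
    ext ω
    exact (hd (y ω)).symm
  rw [this]
  exact h d (measurableSet_singleton 0)

theorem gridSucc_eq {n j : ℕ} {t : ℝ≥0} (h1 : (j : ℝ≥0) / (n.factorial : ℝ≥0) ≤ t)
    (h2 : t < ((j + 1 : ℕ) : ℝ≥0) / (n.factorial : ℝ≥0)) :
    gridSucc n t = ((j + 1 : ℕ) : ℚ≥0) / (n.factorial : ℚ≥0) := by
  have h : (0 : ℝ≥0) < n.factorial := by exact_mod_cast n.factorial_pos
  have : ⌊t * (n.factorial : ℝ≥0)⌋₊ = j := by
    rw [Nat.floor_eq_iff (by positivity)]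
    refine ⟨(div_le_iff₀ h).1 h1, ?_⟩
    have := (lt_div_iff₀ h).1 h2
    push_cast at this
    exact this
  rw [gridSucc, this]

theorem leb_singleton (t : ℝ≥0) : leb {t} = 0 := by
  rcases eq_or_ne t 0 with rfl | ht
  · refine measure_mono_null (t := Set.Iic 0) (by simp) ?_
    rw [leb_Iic, ENNReal.coe_zero]
  · refine nonpos_iff_eq_zero.1 (ENNReal.le_of_forall_pos_le_add fun ε hε _ => ?_)
    have hlt : t - ε < t := tsub_lt_self (pos_iff_ne_zero.2 ht) hε
    rw [zero_add]
    calc leb {t} ≤ leb (Set.Ioc (t - ε) t) := measure_mono (by simpa using hlt)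
      _ = (t - (t - ε) : ℝ≥0) := leb_Ioc hlt.le
      _ ≤ ε := ENNReal.coe_le_coe.2 tsub_tsub_le

namespace OccMeasure

variable {K : Type w} [TopologicalSpace K] [MeasurableSpace K]

theorem ae_time_ne (m : OccMeasure K) (t : ℝ≥0) : ∀ᵐ p ∂m.occ, p.1 ≠ t := by
  have h : m.occ ({t} ×ˢ Set.univ) = 0 := by
    rw [m.occ_prod_univ (measurableSet_singleton t), leb_singleton]
  refine measure_mono_null (fun p hp => ?_) h
  simpa using hp

theorem ae_of_forall_setIntegral_eq_zero (m : OccMeasure K) {F : ℝ≥0 × K → ℝ} (hF : Measurable F)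
    {C : ℝ} (hC : ∀ p, |F p| ≤ C) (h0 : ∀ p, 0 ≤ F p)
    (h : ∀ n : ℕ, ∫ p in Set.Iic (n : ℝ≥0) ×ˢ Set.univ, F p ∂m.occ = 0) :
    ∀ᵐ p ∂m.occ, F p = 0 := by
  have h1 : ∀ n : ℕ, ∀ᵐ p ∂m.occ, p ∈ Set.Iic (n : ℝ≥0) ×ˢ (Set.univ : Set K) → F p = 0 := by
    intro n
    rw [← ae_restrict_iff' (measurableSet_Iic.prod MeasurableSet.univ)]
    exact (integral_eq_zero_iff_of_nonneg h0 (m.integrableOn_Iic n hF hC)).1 (h n)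
  filter_upwards [ae_all_iff.2 h1] with p hp
  obtain ⟨n, hn⟩ := exists_nat_ge p.1
  exact hp n ⟨hn, trivial⟩

end OccMeasure

/-! ### Constraint, martingales and càdlàg regularization under a relaxed solution. -/

section Limit

variable {E : Type u} {𝒰 : Type v} [MetricSpace E] [MeasurableSpace E] [CompactSpace E]
  [BorelSpace E] [MetricSpace 𝒰] [MeasurableSpace 𝒰] [CompactSpace 𝒰] [BorelSpace 𝒰]
  {D : ControlledData E 𝒰} {δ : C(E, ℝ) → ℝ → ℝ≥0} {p : Measure (RelaxedPath E 𝒰)}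

theorem Continuous.integrable_relaxedPath [IsFiniteMeasure p] {F : RelaxedPath E 𝒰 → ℝ}
    (hF : Continuous F) : Integrable F p :=
  (⟨F, hF⟩ : C(RelaxedPath E 𝒰, ℝ)).integrable_comp_of_compact measurable_id

/-- The constraint set is the zero set of a nonnegative continuous `d`. The expected integrals of
`d` vanish, so `d` vanishes almost everywhere. -/
theorem IsRelaxedSolution.ae_mem_constraint [IsProbabilityMeasure p]
    (hp : IsRelaxedSolution D δ p) : ∀ᵐ s ∂p, ∀ᵐ k ∂s.2.occ, k.2 ∈ D.constraint := by
  let _ : MetricSpace (E × (Unit ⊕ 𝒰)) := TopologicalSpace.metrizableSpaceMetric _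
  obtain ⟨d, hd0, hd⟩ := exists_continuousMap_zero_iff D.isClosed_constraint
  have hdm : Measurable fun p : ℝ≥0 × (E × (Unit ⊕ 𝒰)) => d p.2 :=
    d.continuous.measurable.comp measurable_snd
  have h1 : ∀ n : ℕ, ∀ᵐ s ∂p, s.2.upToIntegral n d = 0 := fun n =>
    (integral_eq_zero_iff_of_nonneg (fun s => integral_nonneg fun k => hd0 _)
      (RelaxedPath.continuous_upToIntegral n d.continuous).integrable_relaxedPath).1
      (hp.integral_constraint n d fun k hk => (hd k).2 hk)
  filter_upwards [ae_all_iff.2 h1] with s hs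
  filter_upwards [s.2.ae_of_forall_setIntegral_eq_zero hdm (fun k => d.norm_coe_le_norm k.2)
    (fun k => hd0 _) hs] with k hk
  exact (hd _).1 hk

/-- A left inverse of the embedding of the rationals. -/
def toRat : ℝ≥0 → ℚ≥0 := Function.invFun fun q : ℚ≥0 => (q : ℝ≥0)

theorem toRat_coe (q : ℚ≥0) : toRat (q : ℝ≥0) = q :=
  Function.leftInverse_invFun (fun _ _ h => by exact_mod_cast h) q

theorem measurable_biSup_comap {Ω ι : Type*} {ζ : ι → Ω → ℝ} {T : Set ι} {i : ι} (hi : i ∈ T) :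
    Measurable[⨆ i ∈ T, MeasurableSpace.comap (ζ i) inferInstance] (ζ i) :=
  measurable_iff_comap_le.2
    (le_iSup₂ (f := fun i (_ : i ∈ T) => MeasurableSpace.comap (ζ i) inferInstance) i hi)

/-- The natural filtration of the space of relaxed paths, along the rationals. -/
def RelaxedPath.filtration : Filtration ℚ≥0 (inferInstance : MeasurableSpace (RelaxedPath E 𝒰)) where
  seq q := ⨆ i ∈ {i : ℝ≥0 × (C(E, ℝ) ⊕ C(E × (Unit ⊕ 𝒰), ℝ)) | toRat i.1 ≤ q},
    MeasurableSpace.comap (RelaxedPath.coord (toRat i.1) i.2) inferInstance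
  mono' _ _ hq := biSup_mono fun _ hi => le_trans hi hq
  le' _ := iSup₂_le fun _ _ => (RelaxedPath.continuous_coord _ _).measurable.comap_le

theorem RelaxedPath.measurable_coord_filtration {r q : ℚ≥0} (h : r ≤ q)
    (i : C(E, ℝ) ⊕ C(E × (Unit ⊕ 𝒰), ℝ)) :
    Measurable[RelaxedPath.filtration q] (RelaxedPath.coord r i) := by
  have h1 : ((r : ℝ≥0), i) ∈ {i : ℝ≥0 × (C(E, ℝ) ⊕ C(E × (Unit ⊕ 𝒰), ℝ)) | toRat i.1 ≤ q} := by
    rw [Set.mem_ofPred_eq, toRat_coe]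
    exact h
  have h2 := measurable_biSup_comap (ζ := fun i : ℝ≥0 × (C(E, ℝ) ⊕ C(E × (Unit ⊕ 𝒰), ℝ)) =>
    RelaxedPath.coord (toRat i.1) i.2) h1
  simp only [toRat_coe] at h2
  exact h2

theorem IsRelaxedSolution.martingale [IsProbabilityMeasure p] (hp : IsRelaxedSolution D δ p)
    {f : C(E, ℝ)} {G : C(E × (Unit ⊕ 𝒰), ℝ)} (hG : D.IsGen f G) :
    Martingale (fun (q : ℚ≥0) (s : RelaxedPath E 𝒰) => f (s.1 q) - f (s.1 0) - s.2.upToIntegral q G)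
      RelaxedPath.filtration p := by
  have hc : ∀ q : ℚ≥0, Continuous fun s : RelaxedPath E 𝒰 =>
      f (s.1 q) - f (s.1 0) - s.2.upToIntegral q G := fun q =>
    ((RelaxedPath.continuous_eval f q).sub (RelaxedPath.continuous_eval f 0)).sub
      (RelaxedPath.continuous_upToIntegral _ G.continuous)
  refine martingale_of_setIntegral_sub_eq_zero (fun q => ?_) (fun q => (hc q).integrable_relaxedPath)
    fun q q' hq A hA => ?_
  · exact (((RelaxedPath.measurable_coord_filtration le_rfl (Sum.inl f)).sub
      (RelaxedPath.measurable_coord_filtration zero_le (Sum.inl f))).sub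
      (RelaxedPath.measurable_coord_filtration le_rfl (Sum.inr G))).stronglyMeasurable
  · refine setIntegral_eq_zero_of_test
      (ζ := fun i : ℝ≥0 × (C(E, ℝ) ⊕ C(E × (Unit ⊕ 𝒰), ℝ)) => RelaxedPath.coord (toRat i.1) i.2)
      (fun i => (RelaxedPath.continuous_coord _ _).measurable) {i | toRat i.1 ≤ q}
      ((hc q').sub (hc q)).integrable_relaxedPath (fun J hJ c hcc hc1 => ?_) hA
    -- Test coordinates are indexed by real times and rounded by a map `r`: here `toRat`, later the
    -- grid map `gridSucc n`.
    rw [← hp.integral_testIncrement f G hG q q' hq toRat J c (fun i hi => hJ hi) hcc hc1]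
    congr 1
    funext s
    rw [RelaxedPath.testIncrement]
    simp only [Pi.sub_apply]
    ring

theorem tendsto_cast_rightRat (t : ℝ≥0) :
    Tendsto (fun q : ℚ≥0 => (q : ℝ≥0)) (rightRat t) (𝓝 t) :=
  tendsto_comap.mono_right nhdsWithin_le_nhds

theorem tendsto_cast_leftRat (t : ℝ≥0) :
    Tendsto (fun q : ℚ≥0 => (q : ℝ≥0)) (leftRat t) (𝓝 t) :=
  tendsto_comap.mono_right nhdsWithin_le_nhds

/-- The martingale has one-sided limits, and its compensator is Lipschitz in time, so adding it back
preserves them. -/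
theorem IsRelaxedSolution.ae_exists_tendsto_apply [IsProbabilityMeasure p]
    (hp : IsRelaxedSolution D δ p) {f : C(E, ℝ)} {G : C(E × (Unit ⊕ 𝒰), ℝ)} (hG : D.IsGen f G) :
    ∀ᵐ s ∂p, ∀ t : ℝ≥0, (∃ x, Tendsto (fun q => f (s.1 q)) (rightRat t) (𝓝 x)) ∧
      ∃ x, Tendsto (fun q => f (s.1 q)) (leftRat t) (𝓝 x) := by
  have hGC : ∀ k, |G k| ≤ ‖G‖ := G.norm_coe_le_norm
  have hGm := G.continuous.measurable
  have hb : ∀ T : ℕ, ∃ C, ∀ q ≤ (T : ℚ≥0), ∀ s : RelaxedPath E 𝒰,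
      |f (s.1 q) - f (s.1 0) - s.2.upToIntegral q G| ≤ C := by
    refine fun T => ⟨‖f‖ + ‖f‖ + ‖G‖ * T, fun q hq s => ?_⟩
    refine (abs_sub _ _).trans (add_le_add ((abs_sub _ _).trans
      (add_le_add (f.norm_coe_le_norm _) (f.norm_coe_le_norm _))) ?_)
    refine (s.2.abs_upToIntegral_le q hGm hGC).trans
      (mul_le_mul_of_nonneg_left ?_ (norm_nonneg _))
    exact_mod_cast hq
  filter_upwards [ae_exists_tendsto_of_martingale (hp.martingale hG) hb] with s hs t
  have hcont := s.2.continuous_upToIntegral_time hGm hGC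
  have he : ∀ q : ℚ≥0, f (s.1 q) - f (s.1 0) - s.2.upToIntegral q G +
    (f (s.1 0) + s.2.upToIntegral q G) = f (s.1 q) := fun q => by ring
  obtain ⟨⟨x, hx⟩, ⟨x', hx'⟩⟩ := hs t
  constructor
  · have := hx.add ((hcont.tendsto t).comp (tendsto_cast_rightRat t) |>.const_add (f (s.1 0)))
    simp only [Function.comp_apply, he] at this
    exact ⟨_, this⟩
  · have := hx'.add ((hcont.tendsto t).comp (tendsto_cast_leftRat t) |>.const_add (f (s.1 0)))
    simp only [Function.comp_apply, he] at this
    exact ⟨_, this⟩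

/-- Countability permits one exceptional null set for all test functions; it comes from separability
of `C(E)` for compact metric `E`. -/
theorem ControlledData.exists_countable_dense (D : ControlledData E 𝒰) :
    ∃ S : Set C(E, ℝ), S.Countable ∧ Dense S ∧ ∀ f ∈ S, ∃ G, D.IsGen f G := by
  obtain ⟨S, hS, hSc, hSd⟩ := D.dense_domain.exists_countable_dense_subset
  refine ⟨S, hSc, hSd, fun f hf => ?_⟩
  obtain ⟨⟨g, hg⟩, h, hh⟩ := hS hf
  obtain ⟨G, hG, -⟩ := D.exists_isGen hg hh
  exact ⟨G, hG⟩

theorem IsRelaxedSolution.exists_regularization [IsProbabilityMeasure p]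
    (hp : IsRelaxedSolution D δ p) : ∃ Y : ℝ≥0 → RelaxedPath E 𝒰 → E, (∀ t, Measurable (Y t)) ∧
      (∀ s, IsCadlag fun t => Y t s) ∧
      ∀ᵐ s ∂p, ∀ t, Tendsto s.1 (rightRat t) (𝓝 (Y t s)) := by
  obtain ⟨S, hSc, hSd, hS⟩ := D.exists_countable_dense
  refine exists_cadlag_regularization (y := fun q (s : RelaxedPath E 𝒰) => s.1 q)
    (fun q => (measurable_pi_apply q).comp measurable_fst) ?_
  have h : ∀ᵐ s ∂p, ∀ f ∈ S, ∀ t : ℝ≥0, (∃ x, Tendsto (fun q => f (s.1 q)) (rightRat t) (𝓝 x)) ∧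
      ∃ x, Tendsto (fun q => f (s.1 q)) (leftRat t) (𝓝 x) :=
    (ae_ball_iff hSc).2 fun f hf => by
      obtain ⟨G, hG⟩ := hS f hf
      exact hp.ae_exists_tendsto_apply hG
  filter_upwards [h] with s hs t
  have : Nonempty E := ⟨s.1 0⟩
  exact ⟨exists_tendsto_of_dense hSd fun f hf => (hs f hf t).1,
    exists_tendsto_of_dense hSd fun f hf => (hs f hf t).2⟩

end Limit

/-- The marginal on `K` up to time `r` is determined by integrals of continuous functions. The
σ-algebra on `Ω` is arbitrary, so this applies to natural filtrations generated by such integrals.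
-/
theorem OccMeasure.measurable_occ_Iic_prod {K : Type*} {Ω : Type*} [TopologicalSpace K]
    [HasOuterApproxClosed K] [MeasurableSpace K] [BorelSpace K] {m : MeasurableSpace Ω}
    {M : Ω → OccMeasure K} {r : ℝ≥0}
    (h : ∀ φ : C(K, ℝ), Measurable fun ω => (M ω).upToIntegral r φ) {B : Set K}
    (hB : MeasurableSet B) : Measurable fun ω => (M ω).occ (Set.Iic r ×ˢ B) := by
  have hμ : ∀ ω, IsFiniteMeasure (((M ω).occ.restrict (Set.Iic r ×ˢ Set.univ)).map Prod.snd) :=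
    fun ω => by
      have : IsFiniteMeasure ((M ω).occ.restrict (Set.Iic r ×ˢ Set.univ)) :=
        ⟨by rw [Measure.restrict_apply_univ, (M ω).occ_Iic_univ]; exact ENNReal.coe_lt_top⟩
      infer_instance
  have hmeas : Measurable fun ω => ((M ω).occ.restrict (Set.Iic r ×ˢ Set.univ)).map Prod.snd := by
    refine measurable_measure_of_lintegral hμ fun g => ?_
    let φ : C(K, ℝ) := ⟨fun k => (g k : ℝ), NNReal.continuous_coe.comp g.continuous⟩
    have he : ∀ ω, ∫⁻ x, g x ∂(((M ω).occ.restrict (Set.Iic r ×ˢ Set.univ)).map Prod.snd) =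
        ENNReal.ofReal ((M ω).upToIntegral r φ) := by
      intro ω
      rw [lintegral_map g.continuous.measurable.coe_nnreal_ennreal measurable_snd,
        OccMeasure.upToIntegral, ofReal_integral_eq_lintegral_ofReal
          ((M ω).integrableOn_Iic r (F := fun k => φ k.2) (C := nndist 0 g)
          (φ.continuous.measurable.comp measurable_snd) (fun k => ?_))
          (ae_of_all _ fun k => (g k.2).2)]
      · exact lintegral_congr fun k => ENNReal.ofReal_coe_nnreal.symm
      · change |(g k.2 : ℝ)| ≤ _
        rw [NNReal.abs_eq]
        have := BoundedContinuousFunction.NNReal.upper_bound g k.2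
        exact_mod_cast (nndist_comm g 0 ▸ this)
    simp_rw [he]
    exact ENNReal.measurable_ofReal.comp (h φ)
  have hc := (Measure.measurable_coe hB).comp hmeas
  refine (congrArg Measurable ?_).mp hc
  funext ω
  rw [Function.comp_apply, Measure.map_apply measurable_snd hB,
    Measure.restrict_apply (measurable_snd hB)]
  congr 1
  ext k
  simp [and_comm]

/-! ### The occupation measure follows the regularized path. -/

section LimitState

variable {E : Type u} {𝒰 : Type v} [MetricSpace E] [MeasurableSpace E] [CompactSpace E]
  [BorelSpace E] [MetricSpace 𝒰] [MeasurableSpace 𝒰] [CompactSpace 𝒰] [BorelSpace 𝒰]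
  {D : ControlledData E 𝒰} {δ : C(E, ℝ) → ℝ → ℝ≥0} {p : Measure (RelaxedPath E 𝒰)}

/-- The squared distance of `κ(x)` to the value of `κ` at the next grid point of the path. -/
def RelaxedPath.gridGap (κ : C(E, ℝ)) (n : ℕ) (s : RelaxedPath E 𝒰)
    (k : ℝ≥0 × (E × (Unit ⊕ 𝒰))) : ℝ :=
  (κ k.2.1 - κ (s.1 (gridSucc n k.1))) ^ 2

theorem sq_sub_le_of_norm (κ : C(E, ℝ)) (x y : E) : |(κ x - κ y) ^ 2| ≤ (2 * ‖κ‖) ^ 2 := by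
  rw [abs_pow]
  refine pow_le_pow_left₀ (abs_nonneg _) ((abs_sub _ _).trans ?_) 2
  have h1 : |κ x| ≤ ‖κ‖ := κ.norm_coe_le_norm x
  have h2 : |κ y| ≤ ‖κ‖ := κ.norm_coe_le_norm y
  linarith

theorem RelaxedPath.measurable_gridGap (κ : C(E, ℝ)) (n : ℕ) (s : RelaxedPath E 𝒰) :
    Measurable (RelaxedPath.gridGap κ n s) := by
  have h : Measurable fun p : ℝ≥0 × Unit => s.1 (gridSucc n p.1) :=
    measurable_comp_gridSucc (f := fun q (_ : Unit) => s.1 q) (fun q => measurable_const) n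
  have h' : Measurable fun k : ℝ≥0 × (E × (Unit ⊕ 𝒰)) => s.1 (gridSucc n k.1) :=
    h.comp (measurable_fst.prodMk (measurable_const (a := ())))
  exact ((κ.continuous.measurable.comp measurable_snd.fst).sub
    (κ.continuous.measurable.comp h')).pow_const 2

theorem RelaxedPath.setIntegral_gridGap (κ : C(E, ℝ)) (n m : ℕ) (s : RelaxedPath E 𝒰) :
    ∫ k in Set.Iic ((m : ℝ≥0) / (n.factorial : ℝ≥0)) ×ˢ Set.univ, gridGap κ n s k ∂s.2.occ =
      ∑ j ∈ Finset.range m, gap κ ((j : ℚ≥0) / (n.factorial : ℚ≥0))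
        (((j + 1 : ℕ) : ℚ≥0) / (n.factorial : ℚ≥0)) s := by
  induction m with
  | zero =>
    rw [Finset.range_zero, Finset.sum_empty, Nat.cast_zero, zero_div,
      Measure.restrict_eq_zero.2, integral_zero_measure]
    rw [s.2.occ_Iic_univ, ENNReal.coe_zero]
  | succ m ih =>
    have hle : (m : ℝ≥0) / (n.factorial : ℝ≥0) ≤ ((m + 1 : ℕ) : ℝ≥0) / (n.factorial : ℝ≥0) :=
      div_le_div_of_nonneg_right (by exact_mod_cast m.le_succ) zero_le
    have hleq : (m : ℚ≥0) / (n.factorial : ℚ≥0) ≤ ((m + 1 : ℕ) : ℚ≥0) / (n.factorial : ℚ≥0) :=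
      div_le_div_of_nonneg_right (by exact_mod_cast m.le_succ) zero_le
    have h := s.2.setIntegral_Iic_sub hle (measurable_gridGap κ n s)
      (fun k => sq_sub_le_of_norm κ _ _)
    rw [Finset.sum_range_succ, ← ih, ← sub_eq_iff_eq_add', h, gap_eq κ hleq]
    have c1 : (((m : ℚ≥0) / (n.factorial : ℚ≥0) : ℚ≥0) : ℝ≥0) = (m : ℝ≥0) / (n.factorial : ℝ≥0) := by
      push_cast; rfl
    have c2 : ((((m + 1 : ℕ) : ℚ≥0) / (n.factorial : ℚ≥0) : ℚ≥0) : ℝ≥0) =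
        ((m + 1 : ℕ) : ℝ≥0) / (n.factorial : ℝ≥0) := by
      push_cast; rfl
    rw [c1, c2]
    refine setIntegral_congr_ae (measurableSet_Ioc.prod MeasurableSet.univ) ?_
    -- At the right end of the cell `gridSucc` already points to the next grid time; this single
    -- instant is null.
    filter_upwards [s.2.ae_time_ne (((m + 1 : ℕ) : ℝ≥0) / (n.factorial : ℝ≥0))] with k hk hkI
    rw [gridGap, gridSucc_eq hkI.1.1.le (lt_of_le_of_ne hkI.1.2 hk)]

theorem IsRelaxedSolution.integral_gridGap_le [IsProbabilityMeasure p]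
    (hp : IsRelaxedSolution D δ p) (κ : C(E, ℝ)) {ε : ℝ} (hε : 0 < ε) {n : ℕ}
    (hn : 1 / (n.factorial : ℝ) ≤ δ κ ε) (m : ℕ) :
    ∫ s, ∑ j ∈ Finset.range m, RelaxedPath.gap κ ((j : ℚ≥0) / (n.factorial : ℚ≥0))
      (((j + 1 : ℕ) : ℚ≥0) / (n.factorial : ℚ≥0)) s ∂p ≤ ε * (m / n.factorial) := by
  rw [integral_finsetSum _ fun j _ => (RelaxedPath.continuous_gap κ _ _).integrable_relaxedPath]
  have h : ∀ j ∈ Finset.range m, ∫ s, RelaxedPath.gap κ ((j : ℚ≥0) / (n.factorial : ℚ≥0))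
      (((j + 1 : ℕ) : ℚ≥0) / (n.factorial : ℚ≥0)) s ∂p ≤ ε * (1 / n.factorial) := by
    intro j _
    have hd : ((((j + 1 : ℕ) : ℚ≥0) / (n.factorial : ℚ≥0) : ℚ≥0) : ℝ) -
        (((j : ℚ≥0) / (n.factorial : ℚ≥0) : ℚ≥0) : ℝ) = 1 / n.factorial := by
      push_cast
      ring
    have := hp.integral_gap_le κ ε hε ((j : ℚ≥0) / (n.factorial : ℚ≥0))
      (((j + 1 : ℕ) : ℚ≥0) / (n.factorial : ℚ≥0))
      (div_le_div_of_nonneg_right (by exact_mod_cast j.le_succ) zero_le)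
      (by rw [hd]; exact hn)
    rwa [hd] at this
  refine (Finset.sum_le_sum h).trans (le_of_eq ?_)
  rw [Finset.sum_const, Finset.card_range, nsmul_eq_mul]
  ring

/-- A weak limit alone does not tie the state in the occupation measure to the path; the uniform
modulus does. The summed gaps integrate the squared distance from `κ` of the state to `κ` of the
path at the next grid time. As the mesh shrinks this tends to the squared distance to `κ(Y)`, while
its expectation on `[0, T]` is eventually at most `ε T` for each `ε > 0`. -/
theorem IsRelaxedSolution.ae_apply_eq [IsProbabilityMeasure p] (hp : IsRelaxedSolution D δ p)
    (hδ : ∀ κ ε, 0 < ε → 0 < δ κ ε) {Y : ℝ≥0 → RelaxedPath E 𝒰 → E}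
    (hYc : ∀ s, IsCadlag fun t => Y t s)
    (hY : ∀ᵐ s ∂p, ∀ t, Tendsto s.1 (rightRat t) (𝓝 (Y t s))) (κ : C(E, ℝ)) :
    ∀ᵐ s ∂p, ∀ᵐ k ∂s.2.occ, κ k.2.1 = κ (Y k.1 s) := by
  set F : RelaxedPath E 𝒰 → ℝ≥0 × (E × (Unit ⊕ 𝒰)) → ℝ := fun s k => (κ k.2.1 - κ (Y k.1 s)) ^ 2
  have hFm : ∀ s, Measurable (F s) := fun s =>
    ((κ.continuous.measurable.comp measurable_snd.fst).sub (κ.continuous.measurable.comp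
      ((measurable_path_of_rightCont (hYc s).1).comp measurable_fst))).pow_const 2
  have hFb : ∀ s k, |F s k| ≤ (2 * ‖κ‖) ^ 2 := fun s k => sq_sub_le_of_norm κ _ _
  have key : ∀ T : ℕ, ∀ᵐ s ∂p, ∫ k in Set.Iic (T : ℝ≥0) ×ˢ Set.univ, F s k ∂s.2.occ = 0 := by
    intro T
    set I : ℕ → RelaxedPath E 𝒰 → ℝ := fun n s =>
      ∑ j ∈ Finset.range (T * n.factorial), RelaxedPath.gap κ ((j : ℚ≥0) / (n.factorial : ℚ≥0))
        (((j + 1 : ℕ) : ℚ≥0) / (n.factorial : ℚ≥0)) s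
    have hI : ∀ n s, I n s =
        ∫ k in Set.Iic (T : ℝ≥0) ×ˢ Set.univ, RelaxedPath.gridGap κ n s k ∂s.2.occ := by
      intro n s
      have hn : (n.factorial : ℝ≥0) ≠ 0 := by exact_mod_cast n.factorial_ne_zero
      have : (((T * n.factorial : ℕ) : ℝ≥0)) / (n.factorial : ℝ≥0) = T := by
        rw [Nat.cast_mul, mul_div_cancel_right₀ _ hn]
      rw [← this]
      exact (RelaxedPath.setIntegral_gridGap κ n _ s).symm
    have hIc : ∀ n, Continuous (I n) := fun n =>
      continuous_finsetSum _ fun j _ => RelaxedPath.continuous_gap κ _ _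
    have hIb : ∀ n s, ‖I n s‖ ≤ (2 * ‖κ‖) ^ 2 * T := by
      intro n s
      have h := norm_setIntegral_le_of_norm_le_const (μ := s.2.occ)
        (s := Set.Iic (T : ℝ≥0) ×ˢ Set.univ) (f := RelaxedPath.gridGap κ n s) (C := (2 * ‖κ‖) ^ 2)
        (by rw [s.2.occ_Iic_univ]; exact ENNReal.coe_lt_top) (fun k _ => sq_sub_le_of_norm κ _ _)
      rwa [← hI, measureReal_def, s.2.occ_Iic_univ, ENNReal.coe_toReal] at h
    have hlim : ∀ᵐ s ∂p, Tendsto (fun n => I n s) atTop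
        (𝓝 (∫ k in Set.Iic (T : ℝ≥0) ×ˢ Set.univ, F s k ∂s.2.occ)) := by
      filter_upwards [hY] with s hs
      simp_rw [hI]
      have hfin : IsFiniteMeasure (s.2.occ.restrict (Set.Iic (T : ℝ≥0) ×ˢ Set.univ)) :=
        ⟨by rw [Measure.restrict_apply_univ, s.2.occ_Iic_univ]; exact ENNReal.coe_lt_top⟩
      refine tendsto_integral_of_dominated_convergence (fun _ => (2 * ‖κ‖) ^ 2)
        (fun n => (RelaxedPath.measurable_gridGap κ n s).aestronglyMeasurable)
        (integrable_const _) (fun n => ae_of_all _ fun k => sq_sub_le_of_norm κ _ _)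
        (ae_of_all _ fun k => ?_)
      exact ((tendsto_const_nhds.sub ((κ.continuous.tendsto _).comp
        ((hs k.1).comp (tendsto_gridSucc_rightRat k.1)))).pow 2)
    have hFint : Integrable (fun s => ∫ k in Set.Iic (T : ℝ≥0) ×ˢ Set.univ, F s k ∂s.2.occ) p := by
      refine Integrable.of_bound (C := (2 * ‖κ‖) ^ 2 * T) (aestronglyMeasurable_of_tendsto_ae atTop
        (fun n => (hIc n).measurable.aestronglyMeasurable) hlim) ?_
      filter_upwards [hlim] with s hs
      exact le_of_tendsto hs.norm (Eventually.of_forall fun n => hIb n s)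
    have hconv := tendsto_integral_of_dominated_convergence (μ := p) (fun _ => (2 * ‖κ‖) ^ 2 * T)
      (fun n => (hIc n).measurable.aestronglyMeasurable) (integrable_const _)
      (fun n => ae_of_all _ (hIb n)) hlim
    have h0 : ∀ s, 0 ≤ ∫ k in Set.Iic (T : ℝ≥0) ×ˢ Set.univ, F s k ∂s.2.occ := fun s =>
      integral_nonneg fun k => sq_nonneg _
    refine (integral_eq_zero_iff_of_nonneg h0 hFint).1 (le_antisymm ?_ (integral_nonneg h0))
    have hle : ∀ ε : ℝ, 0 < ε →
        ∫ s, ∫ k in Set.Iic (T : ℝ≥0) ×ˢ Set.univ, F s k ∂s.2.occ ∂p ≤ ε * T := by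
      intro ε hε
      refine le_of_tendsto hconv ?_
      have hev : ∀ᶠ n : ℕ in atTop, 1 / (n.factorial : ℝ≥0) < δ κ ε :=
        (tendsto_order.1 tendsto_one_div_factorial).2 _ (hδ κ ε hε)
      filter_upwards [hev] with n hn
      have hn' : 1 / (n.factorial : ℝ) ≤ δ κ ε := by exact_mod_cast hn.le
      refine (hp.integral_gridGap_le κ hε hn' (T * n.factorial)).trans (le_of_eq ?_)
      have : (n.factorial : ℝ) ≠ 0 := by exact_mod_cast n.factorial_ne_zero
      rw [Nat.cast_mul, mul_div_cancel_right₀ _ this]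
    refine le_of_forall_pos_le_add fun ε hε => ?_
    rw [zero_add]
    refine (hle (ε / (T + 1)) (by positivity)).trans ?_
    rw [div_mul_eq_mul_div, div_le_iff₀ (by positivity)]
    nlinarith
  filter_upwards [ae_all_iff.2 key] with s hs
  filter_upwards [s.2.ae_of_forall_setIntegral_eq_zero (hFm s) (hFb s) (fun k => sq_nonneg _) hs]
    with k hk
  exact sub_eq_zero.1 (pow_eq_zero_iff two_ne_zero |>.1 hk)

theorem IsRelaxedSolution.ae_state_eq [IsProbabilityMeasure p] (hp : IsRelaxedSolution D δ p)
    (hδ : ∀ κ ε, 0 < ε → 0 < δ κ ε) {Y : ℝ≥0 → RelaxedPath E 𝒰 → E}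
    (hYc : ∀ s, IsCadlag fun t => Y t s)
    (hY : ∀ᵐ s ∂p, ∀ t, Tendsto s.1 (rightRat t) (𝓝 (Y t s))) :
    ∀ᵐ s ∂p, ∀ᵐ k ∂s.2.occ, k.2.1 = Y k.1 s := by
  obtain ⟨S, hSc, hSd, -⟩ := D.exists_countable_dense
  filter_upwards [(ae_ball_iff hSc).2 fun κ _ => hp.ae_apply_eq hδ hYc hY κ] with s hs
  filter_upwards [(ae_ball_iff hSc).2 hs] with k hk
  exact eq_of_dense_of_forall_eq hSd hk

/-- The limiting processes built from a relaxed solution. -/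
def RelaxedPath.triple (Y : ℝ≥0 → RelaxedPath E 𝒰 → E) (hYm : ∀ t, Measurable (Y t))
    (hYc : ∀ s, IsCadlag fun t => Y t s) : ProcessTriple (RelaxedPath E 𝒰) E 𝒰 :=
  ProcessTriple.ofControl Y (fun s => s.2.occ.map fun k => (k.1, k.2.2)) hYm hYc
    ((Measure.measurable_map _ (measurable_fst.prodMk measurable_snd.snd)).comp
      (OccMeasure.measurable_occ.comp measurable_snd)) (fun s t => by
        rw [Measure.map_apply (measurable_fst.prodMk measurable_snd.snd)
          (measurableSet_Iic.prod MeasurableSet.univ)]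
        have : (fun k : ℝ≥0 × (E × (Unit ⊕ 𝒰)) => (k.1, k.2.2)) ⁻¹' (Set.Iic t ×ˢ Set.univ) =
            Set.Iic t ×ˢ Set.univ := by
          ext k
          simp
        rw [this, OccMeasure.occ_Iic_univ]
        exact ENNReal.coe_lt_top)

section Triple

variable {Y : ℝ≥0 → RelaxedPath E 𝒰 → E} (hYm : ∀ t, Measurable (Y t))
  (hYc : ∀ s, IsCadlag fun t => Y t s)

theorem RelaxedPath.measurable_timeControl :
    Measurable fun k : ℝ≥0 × (E × (Unit ⊕ 𝒰)) => (k.1, k.2.2) :=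
  measurable_fst.prodMk measurable_snd.snd

theorem RelaxedPath.ctl_triple (s : RelaxedPath E 𝒰) :
    (RelaxedPath.triple Y hYm hYc).ctl s = s.2.occ.map fun k => (k.1, k.2.2) := by
  rw [triple, ProcessTriple.ctl_ofControl]

theorem RelaxedPath.ctl_triple_Iic (s : RelaxedPath E 𝒰) (t : ℝ≥0) {B : Set (Unit ⊕ 𝒰)}
    (hB : MeasurableSet B) : (RelaxedPath.triple Y hYm hYc).ctl s (Set.Iic t ×ˢ B) =
      s.2.occ (Set.Iic t ×ˢ (Prod.snd ⁻¹' B)) := by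
  rw [ctl_triple, Measure.map_apply measurable_timeControl (measurableSet_Iic.prod hB)]
  congr 1

/-- Once the state is known to be `Y` and the constraint holds, the drift of the reconstructed
triple is a functional of the occupation measure, and it is continuous when `ψ` is. -/
theorem RelaxedPath.drift_triple {s : RelaxedPath E 𝒰} (hs : ∀ᵐ k ∂s.2.occ, k.2.1 = Y k.1 s)
    (hs' : ∀ᵐ k ∂s.2.occ, k.2 ∈ D.constraint) {φ ψ : E × (Unit ⊕ 𝒰) → ℝ} (hφ : Measurable φ)
    (h : ∀ k ∈ D.constraint, ψ k = φ k) (t : ℝ≥0) :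
    (RelaxedPath.triple Y hYm hYc).drift φ t s = s.2.upToIntegral t ψ := by
  have hm : Measurable fun k : ℝ≥0 × (Unit ⊕ 𝒰) => φ (Y k.1 s, k.2) :=
    hφ.comp (((measurable_path_of_rightCont (hYc s).1).comp measurable_fst).prodMk measurable_snd)
  rw [ProcessTriple.drift, ctl_triple]
  refine (setIntegral_map (measurableSet_Iic.prod MeasurableSet.univ) hm.aestronglyMeasurable
    measurable_timeControl.aemeasurable).trans ?_
  have : (fun k : ℝ≥0 × (E × (Unit ⊕ 𝒰)) => (k.1, k.2.2)) ⁻¹' (Set.Iic t ×ˢ Set.univ) =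
      Set.Iic t ×ˢ Set.univ := by
    ext k
    simp
  rw [this]
  refine integral_congr_ae (ae_restrict_of_ae ?_)
  filter_upwards [hs, hs'] with k hk hk'
  rw [h _ hk', ← hk]

/-- The coordinates that generate the natural filtration of the limiting processes. -/
def limitCoord (Y : ℝ≥0 → RelaxedPath E 𝒰 → E) (i : ℝ≥0 × (C(E, ℝ) ⊕ C(E × (Unit ⊕ 𝒰), ℝ))) :
    RelaxedPath E 𝒰 → ℝ :=
  Sum.elim (fun κ s => κ (Y i.1 s)) (fun φ s => s.2.upToIntegral i.1 φ) i.2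

theorem measurable_limitCoord {Y : ℝ≥0 → RelaxedPath E 𝒰 → E} (hYm : ∀ t, Measurable (Y t))
    (i : ℝ≥0 × (C(E, ℝ) ⊕ C(E × (Unit ⊕ 𝒰), ℝ))) : Measurable (limitCoord Y i) := by
  obtain ⟨r, κ | φ⟩ := i
  · exact κ.continuous.measurable.comp (hYm r)
  · exact (RelaxedPath.continuous_upToIntegral r φ.continuous).measurable

theorem RelaxedPath.filtration_triple_le (t : ℝ≥0) :
    (RelaxedPath.triple Y hYm hYc).filtration t ≤
      ⨆ i ∈ {i : ℝ≥0 × (C(E, ℝ) ⊕ C(E × (Unit ⊕ 𝒰), ℝ)) | i.1 ≤ t},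
        MeasurableSpace.comap (limitCoord Y i) inferInstance := by
  refine ProcessTriple.filtration_le_of _ t _ (fun r hr => ?_) fun r hr B hB => ?_
  · refine @measurable_of_continuousMap_comp _ _ (_) _ _ _ _ fun f => ?_
    exact measurable_biSup_comap (ζ := limitCoord Y) (T := {i | i.1 ≤ t}) (i := (r, Sum.inl f)) hr
  · simp_rw [ctl_triple_Iic hYm hYc _ r hB]
    refine @OccMeasure.measurable_occ_Iic_prod _ _ _ _ _ _ (_) (fun s : RelaxedPath E 𝒰 => s.2) r
      (fun φ => ?_) _ (measurable_snd hB)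
    exact measurable_biSup_comap (ζ := limitCoord Y) (T := {i | i.1 ≤ t}) (i := (r, Sum.inr φ)) hr

end Triple

end LimitState

/-! ### Reconstruction of a solution from a relaxed solution. -/

section LimitSolution

variable {E : Type u} {𝒰 : Type v} [MetricSpace E] [MeasurableSpace E] [CompactSpace E]
  [BorelSpace E] [MetricSpace 𝒰] [MeasurableSpace 𝒰] [CompactSpace 𝒰] [BorelSpace 𝒰]
  {D : ControlledData E 𝒰} {δ : C(E, ℝ) → ℝ → ℝ≥0} {p : Measure (RelaxedPath E 𝒰)}

theorem RelaxedPath.tendsto_upToIntegral_gridSucc (s : RelaxedPath E 𝒰)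
    (φ : C(E × (Unit ⊕ 𝒰), ℝ)) (t : ℝ≥0) :
    Tendsto (fun n => s.2.upToIntegral (gridSucc n t) φ) atTop (𝓝 (s.2.upToIntegral t φ)) :=
  ((s.2.continuous_upToIntegral_time φ.continuous.measurable φ.norm_coe_le_norm).tendsto t).comp
    ((tendsto_gridSucc t).mono_right nhdsWithin_le_nhds)

/-- Real times are approximated from the right by `gridSucc n`. This map is monotone, so times in
the past of `a` are rounded to times in the past of the rounded `a`, and the identity at rational
times passes to the limit by dominated convergence. -/
theorem IsRelaxedSolution.integral_limit_testIncrement [IsProbabilityMeasure p]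
    (hp : IsRelaxedSolution D δ p) {Y : ℝ≥0 → RelaxedPath E 𝒰 → E}
    (hY : ∀ᵐ s ∂p, ∀ t, Tendsto s.1 (rightRat t) (𝓝 (Y t s)))
    {f : C(E, ℝ)} {G : C(E × (Unit ⊕ 𝒰), ℝ)} (hG : D.IsGen f G) {a b : ℝ≥0} (hab : a ≤ b)
    {J : Finset (ℝ≥0 × (C(E, ℝ) ⊕ C(E × (Unit ⊕ 𝒰), ℝ)))} (hJ : ∀ i ∈ J, i.1 ≤ a)
    {c : ℝ≥0 × (C(E, ℝ) ⊕ C(E × (Unit ⊕ 𝒰), ℝ)) → ℝ → ℝ} (hc : ∀ i, Continuous (c i))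
    (hc1 : ∀ i x, |c i x| ≤ 1) :
    ∫ s, (f (Y b s) - f (Y a s) - (s.2.upToIntegral b G - s.2.upToIntegral a G)) *
      ∏ i ∈ J, c i (limitCoord Y i s) ∂p = 0 := by
  set F : ℕ → RelaxedPath E 𝒰 → ℝ := fun n =>
    RelaxedPath.testIncrement f G (gridSucc n a) (gridSucc n b) (gridSucc n) J c
  have hFc : ∀ n, Continuous (F n) := fun n => RelaxedPath.continuous_testIncrement _ _ _ _ _ _ hc
  have hF0 : ∀ n, ∫ s, F n s ∂p = 0 := fun n =>
    hp.integral_testIncrement f G hG _ _ (gridSucc_mono n hab) _ J c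
      (fun i hi => gridSucc_mono n (hJ i hi)) hc hc1
  have hGm := G.continuous.measurable
  have hGC : ∀ k, |G k| ≤ ‖G‖ := G.norm_coe_le_norm
  have hFb : ∀ n s, ‖F n s‖ ≤ ‖f‖ + ‖f‖ + ‖G‖ * (b + 1) := by
    intro n s
    have hprod : |∏ i ∈ J, c i (RelaxedPath.coord (gridSucc n i.1) i.2 s)| ≤ 1 := by
      rw [Finset.abs_prod]
      exact Finset.prod_le_one (fun i _ => abs_nonneg _) fun i _ => hc1 i _
    have hab' : (gridSucc n a : ℝ≥0) ≤ gridSucc n b := by exact_mod_cast gridSucc_mono n hab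
    have h1 : ((gridSucc n b : ℝ≥0) : ℝ) - (gridSucc n a : ℝ≥0) ≤ b + 1 := by
      have h2 : ((gridSucc n b : ℝ≥0) : ℝ) ≤ b + 1 := by
        have h3 : 1 / (n.factorial : ℝ≥0) ≤ 1 := by
          rw [one_div]
          exact inv_le_one_of_one_le₀ (by exact_mod_cast n.factorial_pos)
        have h4 : (gridSucc n b : ℝ≥0) ≤ b + 1 := (gridSucc_le n b).trans (by gcongr)
        exact_mod_cast h4
      linarith [(gridSucc n a : ℝ≥0).coe_nonneg]
    have hfac : |f (s.1 (gridSucc n b)) - f (s.1 (gridSucc n a)) -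
        (s.2.upToIntegral (gridSucc n b) G - s.2.upToIntegral (gridSucc n a) G)| ≤
        ‖f‖ + ‖f‖ + ‖G‖ * (b + 1) := by
      refine (abs_sub _ _).trans (add_le_add ((abs_sub _ _).trans
        (add_le_add (f.norm_coe_le_norm _) (f.norm_coe_le_norm _))) ?_)
      exact (s.2.abs_upToIntegral_sub_le hab' hGm hGC).trans
        (mul_le_mul_of_nonneg_left h1 (norm_nonneg _))
    rw [Real.norm_eq_abs]
    refine (abs_mul _ _).trans_le ?_
    exact (mul_le_of_le_one_right (abs_nonneg _) hprod).trans hfac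
  have hlim : ∀ᵐ s ∂p, Tendsto (fun n => F n s) atTop
      (𝓝 ((f (Y b s) - f (Y a s) - (s.2.upToIntegral b G - s.2.upToIntegral a G)) *
        ∏ i ∈ J, c i (limitCoord Y i s))) := by
    filter_upwards [hY] with s hs
    have hκ : ∀ (κ : C(E, ℝ)) t, Tendsto (fun n => κ (s.1 (gridSucc n t))) atTop (𝓝 (κ (Y t s))) :=
      fun κ t => (κ.continuous.tendsto _).comp ((hs t).comp (tendsto_gridSucc_rightRat t))
    refine (((hκ f b).sub (hκ f a)).sub ((s.tendsto_upToIntegral_gridSucc G b).sub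
      (s.tendsto_upToIntegral_gridSucc G a))).mul (tendsto_finsetProd J fun i _ => ?_)
    refine ((hc i).tendsto _).comp ?_
    obtain ⟨r, κ | φ⟩ := i
    · exact hκ κ r
    · exact s.tendsto_upToIntegral_gridSucc φ r
  have h := tendsto_integral_of_dominated_convergence (μ := p) _
    (fun n => (hFc n).measurable.aestronglyMeasurable) (integrable_const _)
    (fun n => ae_of_all _ (hFb n)) hlim
  simp_rw [hF0] at h
  exact tendsto_nhds_unique h tendsto_const_nhds

/-- A relaxed solution gives rise to a solution of the controlled martingale problem on the space
of relaxed paths. -/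
theorem IsRelaxedSolution.exists_isControlledSolution [IsProbabilityMeasure p]
    (hp : IsRelaxedSolution D δ p) (hδ : ∀ κ ε, 0 < ε → 0 < δ κ ε) :
    ∃ Z : ProcessTriple (RelaxedPath E 𝒰) E 𝒰, IsControlledSolution D p Z ∧
      ∀ s t, (Z.lam t s : ℝ≥0∞) = s.2.occ (Set.Iic t ×ˢ (Prod.snd ⁻¹' {Sum.inl ()})) := by
  obtain ⟨Y, hYm, hYc, hY⟩ := hp.exists_regularization
  have hstate := hp.ae_state_eq hδ hYc hY
  have hcon := hp.ae_mem_constraint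
  refine ⟨RelaxedPath.triple Y hYm hYc, ?_, fun s t => ?_⟩
  swap
  · rw [ProcessTriple.coe_lam_eq, RelaxedPath.ctl_triple_Iic hYm hYc s t
      measurableSet_singleton_inl]
  have htime : ∀ s t, (RelaxedPath.triple Y hYm hYc).ctl s (Set.Iic t ×ˢ Set.univ) = t := by
    intro s t
    rw [RelaxedPath.ctl_triple_Iic hYm hYc s t MeasurableSet.univ, Set.preimage_univ,
      OccMeasure.occ_Iic_univ]
  refine (isControlledSolution_iff D p _).2 ⟨ae_of_all _ htime, ?_, fun f g h hA hB => ?_⟩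
  · filter_upwards [hstate, hcon] with s hs hs'
    have hmeas : MeasurableSet {k : ℝ≥0 × (Unit ⊕ 𝒰) | (Y k.1 s, k.2) ∈ D.constraint} :=
      (((measurable_path_of_rightCont (hYc s).1).comp measurable_fst).prodMk measurable_snd)
        (measurableSet_constraint D)
    rw [RelaxedPath.ctl_triple]
    refine (ae_map_iff RelaxedPath.measurable_timeControl.aemeasurable hmeas).2 ?_
    filter_upwards [hs, hs'] with k hk hk'
    rw [← hk]
    exact hk'
  · obtain ⟨G, hG, hGg⟩ := D.exists_isGen hA hB
    set Z := RelaxedPath.triple Y hYm hYc with hZ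
    obtain ⟨C, hC⟩ := D.exists_bound_genFun g h
    have hgm := D.measurable_genFun g h
    have hdrift : ∀ᵐ s ∂p, ∀ t, Z.drift (D.genFun g h) t s = s.2.upToIntegral t G := by
      filter_upwards [hstate, hcon] with s hs hs' t
      exact RelaxedPath.drift_triple hYm hYc hs hs' hgm hGg t
    have hadapted : ∀ t, StronglyMeasurable[Z.filtration t] fun s =>
        f (Z.Y t s) - f (Z.Y 0 s) - Z.drift (D.genFun g h) t s := fun t =>
      ((f.continuous.measurable.comp (Z.measurable_Y_filtration le_rfl)).stronglyMeasurable.sub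
        (f.continuous.measurable.comp (Z.measurable_Y_filtration zero_le)).stronglyMeasurable).sub
        (Z.stronglyMeasurable_drift hgm t)
    have hint : ∀ t, Integrable (fun s =>
        f (Z.Y t s) - f (Z.Y 0 s) - Z.drift (D.genFun g h) t s) p := by
      intro t
      refine ((f.integrable_comp_of_compact (Z.measurable_Y t)).sub
        (f.integrable_comp_of_compact (Z.measurable_Y 0))).sub ?_
      refine ((RelaxedPath.continuous_upToIntegral t G.continuous).integrable_relaxedPath).congr ?_
      filter_upwards [hdrift] with s hs
      exact (hs t).symm
    refine martingale_of_setIntegral_sub_eq_zero hadapted hint fun a b hab A hA' => ?_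
    refine setIntegral_eq_zero_of_test (measurable_limitCoord hYm) {i | i.1 ≤ a}
      ((hint b).sub (hint a)) (fun J hJ c hc hc1 => ?_)
      (RelaxedPath.filtration_triple_le hYm hYc a _ hA')
    rw [← hp.integral_limit_testIncrement hY hG hab (fun i hi => hJ hi) hc hc1]
    refine integral_congr_ae ?_
    filter_upwards [hdrift] with s hs
    simp only [Pi.sub_apply, hs]
    change ((f (Y b s) - f (Y 0 s) - s.2.upToIntegral b G) -
      (f (Y a s) - f (Y 0 s) - s.2.upToIntegral a G)) * _ = _
    ring

end LimitSolution

/-! ### The uniform bound, by contradiction and compactness. -/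

section Uniform

variable {E : Type u} {𝒰 : Type v} [MetricSpace E] [MeasurableSpace E] [CompactSpace E]
  [BorelSpace E] [MetricSpace 𝒰] [MeasurableSpace 𝒰] [CompactSpace 𝒰] [BorelSpace 𝒰]
  {D : ControlledData E 𝒰}

/-- The control `Sum.inl ()` is isolated, so its indicator is continuous and `λ₀(t)` is a continuous
functional of the relaxed path. -/
theorem upToIntegral_inlIndicator (m : OccMeasure (E × (Unit ⊕ 𝒰))) (t : ℝ≥0) :
    m.upToIntegral t inlIndicator = m.occ.real (Set.Iic t ×ˢ (Prod.snd ⁻¹' {Sum.inl ()})) := by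
  have hm : MeasurableSet {k : ℝ≥0 × (E × (Unit ⊕ 𝒰)) | k.2.2 = Sum.inl ()} :=
    measurable_snd.snd measurableSet_singleton_inl
  have he : (fun k : ℝ≥0 × (E × (Unit ⊕ 𝒰)) => (inlIndicator k.2 : ℝ)) =
      {k : ℝ≥0 × (E × (Unit ⊕ 𝒰)) | k.2.2 = Sum.inl ()}.indicator 1 := by
    funext k
    obtain ⟨r, x, c | c⟩ := k
    · rw [Set.indicator_of_mem (by exact rfl)]
      rfl
    · rw [Set.indicator_of_notMem (by exact Sum.inr_ne_inl)]
      rfl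
  rw [OccMeasure.upToIntegral, he, integral_indicator_one hm, measureReal_restrict_apply hm]
  congr 1
  ext k
  simp [and_comm]

theorem ProcessTriple.upToIntegral_occupation_inlIndicator {Ω : Type w} [MeasurableSpace Ω]
    (Z : ProcessTriple Ω E 𝒰) {N : Ω → Measure (ℝ≥0 × (Unit ⊕ 𝒰))}
    (hN : ∀ ω, (N ω).map Prod.fst = leb) {ω : Ω} (hω : N ω = Z.ctl ω) {t : ℝ≥0} :
    (Z.occupation N hN ω).upToIntegral t inlIndicator = (Z.lam t ω : ℝ) := by
  rw [upToIntegral_inlIndicator, measureReal_def, occupation, OccMeasure.occ_ofMeasure,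
    Measure.map_apply (measurable_stateControl Z ω)
      (measurableSet_Iic.prod (measurable_snd measurableSet_singleton_inl)), hω,
    ← ENNReal.coe_toReal (Z.lam t ω), coe_lam_eq]
  rfl

/-- `λ₀(1)` is bounded away from zero, uniformly over all solutions. -/
theorem exists_integral_exp_lam_le
    (hpos : ForEachSolution D fun P Z => ∀ᵐ ω ∂P, ∀ t : ℝ≥0, 0 < t → 0 < Z.lam t ω) :
    ∃ ρ : ℝ, ρ < 1 ∧
      ForEachSolution D fun P Z => ∫ ω, Real.exp (-(Z.lam 1 ω : ℝ)) ∂P ≤ ρ := by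
  by_contra! hcon
  have hmod : ∀ (κ : C(E, ℝ)) (ε : ℝ), ∃ δ : ℝ≥0, 0 < ε → 0 < δ ∧
      ∀ (Ω : Type (max u v)) [MeasurableSpace Ω] (P : Measure Ω)
      [IsProbabilityMeasure P] (Z : ProcessTriple Ω E 𝒰), IsControlledSolution D P Z →
      ∀ s t : ℝ≥0, s ≤ t → (t : ℝ) - s ≤ δ →
      ∫ ω, (κ (Z.Y s ω) - κ (Z.Y t ω)) ^ 2 ∂P ≤ ε := by
    intro κ ε
    by_cases hε : 0 < ε
    · obtain ⟨δ, hδ⟩ := exists_integral_sq_sub_le.{u, v, max u v} D κ hε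
      exact ⟨δ, fun _ => hδ⟩
    · exact ⟨0, fun h => absurd h hε⟩
  -- The modulus depends only on `κ` and `ε`, so one `δ` serves all the solutions of the
  -- contradicting family.
  choose δ hδ using hmod
  have hFc : Continuous fun s : RelaxedPath E 𝒰 => Real.exp (-(s.2.upToIntegral 1 inlIndicator)) :=
    Real.continuous_exp.comp
      (RelaxedPath.continuous_upToIntegral 1 inlIndicator.continuous).neg
  obtain ⟨p, hp, hp1⟩ := exists_isRelaxedSolution_integral_ge (D := D) (δ := δ) hFc (a := 1) (by
    intro b hb
    have hnot := hcon b hb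
    simp only [ForEachSolution] at hnot
    push Not at hnot
    obtain ⟨Ω, mΩ, P, hP, Z, hZ, hbZ⟩ := hnot
    obtain ⟨N, hNm, hN, hNZ⟩ := exists_control_modification hZ
    have hm := Z.measurable_relaxed hN hNm
    refine ⟨⟨P.map (Z.relaxed N hN), Measure.isProbabilityMeasure_map hm.aemeasurable⟩,
      isRelaxedSolution_map hZ hN hNm hNZ fun κ ε hε => (hδ κ ε hε).2 Ω P Z hZ, ?_⟩
    refine hbZ.le.trans (le_of_eq ?_)
    refine Eq.trans ?_ (Z.integral_relaxed hN hNm hFc).symm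
    refine integral_congr_ae ?_
    filter_upwards [hNZ] with ω hω
    congr 2
    exact (Z.upToIntegral_occupation_inlIndicator hN hω).symm)
  obtain ⟨Z, hZ, hZlam⟩ := hp.exists_isControlledSolution fun κ ε hε => (hδ κ ε hε).1
  have hlam : ∀ s : RelaxedPath E 𝒰, (Z.lam 1 s : ℝ) = s.2.upToIntegral 1 inlIndicator := by
    intro s
    rw [upToIntegral_inlIndicator, measureReal_def, ← hZlam, ENNReal.coe_toReal]
  simp_rw [← hlam] at hp1
  have hle : ∀ s : RelaxedPath E 𝒰, Real.exp (-(Z.lam 1 s : ℝ)) ≤ 1 := fun s =>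
    Real.exp_le_one_iff.2 (neg_nonpos.2 (Z.lam 1 s).2)
  have hi : Integrable (fun s => Real.exp (-(Z.lam 1 s : ℝ))) (p : Measure (RelaxedPath E 𝒰)) := by
    simp_rw [hlam]
    exact hFc.integrable_relaxedPath
  -- A function bounded by `1` with mean at least `1` equals `1` almost surely, which here means
  -- `λ₀(1) = 0`.
  have hzero : ∀ᵐ s ∂(p : Measure (RelaxedPath E 𝒰)), 1 - Real.exp (-(Z.lam 1 s : ℝ)) = 0 := by
    refine (integral_eq_zero_iff_of_nonneg (fun s => sub_nonneg.2 (hle s))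
      ((integrable_const 1).sub hi)).1 (le_antisymm ?_ (integral_nonneg fun s =>
        sub_nonneg.2 (hle s)))
    rw [integral_sub (integrable_const 1) hi, integral_const, probReal_univ, one_smul]
    linarith
  -- The relaxed paths themselves serve as probability space; they live in the universe over which
  -- solutions are quantified.
  have hP := hpos (RelaxedPath E 𝒰) (p : Measure (RelaxedPath E 𝒰)) Z hZ
  obtain ⟨s, hs0, hs1⟩ := (hzero.and hP).exists
  have h1 : (0 : ℝ) < Z.lam 1 s := NNReal.coe_pos.2 (hs1 1 one_pos)
  have h2 := (Real.exp_eq_one_iff _).1 (sub_eq_zero.1 hs0).symm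
  linarith

end Uniform

end

theorem proposition2p9 {E : Type u} {𝒰 : Type v}
    [MetricSpace E] [CompactSpace E] [MeasurableSpace E] [BorelSpace E]
    [MetricSpace 𝒰] [CompactSpace 𝒰] [MeasurableSpace 𝒰] [BorelSpace 𝒰]
    (D : ControlledData E 𝒰)
    (hex : HasSolutions D)
    (hpos : ForEachSolution D fun P Z => ∀ᵐ ω ∂P, ∀ t : ℝ≥0, 0 < t → 0 < Z.lam t ω) :
    (ForEachSolution D fun P Z => ∀ᵐ ω ∂P, StrictMono (fun t => Z.lam t ω)) ∧
      ∀ U : Set E, IsOpen U → LocalizationCondition D U := by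
  obtain ⟨ρ, hρ1, hρ⟩ := exists_integral_exp_lam_le hpos
  have hmono := strictMono_lam_of_pos hpos
  exact ⟨hmono, fun U _ => localizationCondition_of_bound hex hρ1 hρ hmono U⟩
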